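/- Let $M$ be a compact connected smooth $5$-manifold with a contact metric structure $(\xi,\eta,\Phi,g)$: a smooth vector field $\xi$, a smooth $1$-form $\eta$, a smooth endomorphism $\Phi$ of $TM$ and a Riemannian metric $g$ with $\eta(\xi)=1$, $\Phi^2=-I+\eta\otimes\xi$, $g(\Phi X,\Phi Y)=g(X,Y)-\eta(X)\eta(Y)$ and $d\eta=\omega$, where $\omega(X,Y)=g(X,\Phi Y)$ and $d\eta(X,Y)=X\eta(Y)-Y\eta(X)-\eta([X,Y])$. Orient $M$ by $\eta\wedge\omega\wedge\omega$. Assume that the structure is $K$-contact, that is, $\xi$ is a Killing vector field of $g$. Let $T\subseteq \mathrm{Isom}(M,g)$ be the torus obtained as the closure of the flow $\{\exp(t\xi)\}_{t\in\mathbb{R}}$ of $\xi$ in the isometry group of $(M,g)$ (with the compact-open topology). Let $G$ be a compact, connected, semisimple Lie group with trivial centre and Lie algebra $\mathfrak g$, let $\pi\colon P\to M$ be a smooth principal $G$-bundle, and let $\nabla$ be a connection on $P$ with connection form $A\in\Omega^1(P,\mathfrak g)$ and curvature $F$. Assume that $\nabla$ is a contact instanton, that is, $*F=\eta\wedge F$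 or $*F=-\eta\wedge F$, and that $\nabla$ is irreducible, that is, the gauge transformations of $P$ (automorphisms covering the identity of $M$) that preserve $\nabla$ are exactly the maps $p\mapsto p\,z$ with $z$ in the centre of $G$. Then the action of $T$ on $M$ lifts to an action of $T$ on $P$ by principal bundle automorphisms preserving $\nabla$: there is a group homomorphism $\rho$ from $T$ to the group of $G$-equivariant diffeomorphisms $\psi$ of $P$ with $\psi^*A=A$, such that $\pi(\rho(t)p)=t\cdot\pi(p)$ for all $t\in T$ and $p\in P$. Moreover the action map $T\times P\to P$, $(t,p)\mapsto\rho(t)p$, is continuous and smooth, smooth in the sense that for every $k$ and every map $u\colon\mathbb{R}^k\to T$ for which $(y,x)\mapsto u(y)\cdot x$ is a smooth map $\mathbb{R}^k\times M\to M$, the map $\mathbb{R}^k\times P\to P$, $(y,p)\mapsto\rho(u(y))p$, is smooth. -/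

import Mathlib

open scoped Manifold ContDiff Topology
open Bundle

noncomputable section

namespace ContactInstanton

/-! ### Exterior derivative of vector-valued one-forms on a manifold -/

section ExteriorDerivative

variable {E : Type*} [NormedAddCommGroup E] [NormedSpace ℝ E]
  {N : Type*} [TopologicalSpace N] [ChartedSpace E N] [IsManifold 𝓘(ℝ, E) ∞ N]
  {V : Type*} [NormedAddCommGroup V] [NormedSpace ℝ V]

/-- The vector field `X` on `N` is smooth. -/
def SmoothVectorField (X : ∀ x : N, TangentSpace 𝓘(ℝ, E) x) : Prop :=
  ContMDiff 𝓘(ℝ, E) 𝓘(ℝ, E).tangent ∞ (fun x => (⟨x, X x⟩ : TangentBundle 𝓘(ℝ, E) N))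

/-- The `V`-valued one-form `α` on `N` is smooth. -/
def SmoothOneForm (α : ∀ x : N, TangentSpace 𝓘(ℝ, E) x →L[ℝ] V) : Prop :=
  ContMDiff 𝓘(ℝ, E) (𝓘(ℝ, E).prod 𝓘(ℝ, E →L[ℝ] V)) ∞
    (fun x => TotalSpace.mk' (E →L[ℝ] V)
      (E := fun x : N => TangentSpace 𝓘(ℝ, E) x →L[ℝ] Bundle.Trivial N V x) x (α x))

/-- The local expression of the one-form `α` in the preferred chart at `x₀`: its pull-back under
the inverse of the chart. -/
def localOneForm (α : ∀ x : N, TangentSpace 𝓘(ℝ, E) x →L[ℝ] V) (x₀ : N) (y : E) : E →L[ℝ] V :=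
  (α ((extChartAt 𝓘(ℝ, E) x₀).symm y)).comp
    (mfderiv 𝓘(ℝ, E) 𝓘(ℝ, E) (extChartAt 𝓘(ℝ, E) x₀).symm y)

/-- The exterior derivative `dα` of a one-form at `x₀`, computed in the preferred chart at `x₀`,
with the convention `dα(X, Y) = X(α(Y)) - Y(α(X)) - α([X, Y])`. -/
def extDerivOneForm (α : ∀ x : N, TangentSpace 𝓘(ℝ, E) x →L[ℝ] V) (x₀ : N)
    (u v : TangentSpace 𝓘(ℝ, E) x₀) : V :=
  let D : E →L[ℝ] E →L[ℝ] V := fderiv ℝ (localOneForm α x₀) (extChartAt 𝓘(ℝ, E) x₀ x₀)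
  let u' : E := mfderiv 𝓘(ℝ, E) 𝓘(ℝ, E) (extChartAt 𝓘(ℝ, E) x₀) x₀ u
  let v' : E := mfderiv 𝓘(ℝ, E) 𝓘(ℝ, E) (extChartAt 𝓘(ℝ, E) x₀) x₀ v
  D u' v' - D v' u'

end ExteriorDerivative

/-! ### Homeomorphism groups and isometry groups -/

section Homeomorphisms

/-- The compact-open topology on the group of self-homeomorphisms. -/
instance homeoTopology {X : Type*} [TopologicalSpace X] : TopologicalSpace (X ≃ₜ X) :=
  TopologicalSpace.induced (fun φ : X ≃ₜ X => (φ : C(X, X))) inferInstance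

/-- The self-homeomorphisms of a compact Hausdorff space form a topological group. -/
instance homeoTopologicalGroup {X : Type*} [TopologicalSpace X] [CompactSpace X] [T2Space X] :
    IsTopologicalGroup (X ≃ₜ X) where
  continuous_mul := by
    rw [continuous_induced_rng]
    have h : Continuous (fun φ : X ≃ₜ X => (φ : C(X, X))) := continuous_induced_dom
    exact (ContinuousMap.continuous_comp' (X := X) (Y := X) (Z := X)).comp
      ((h.comp continuous_snd).prodMk (h.comp continuous_fst))
  continuous_inv := by
    rw [continuous_induced_rng, ContinuousMap.continuous_compactOpen]
    intro K hK U hU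
    have h : Continuous (fun φ : X ≃ₜ X => (φ : C(X, X))) := continuous_induced_dom
    have h' := (ContinuousMap.isOpen_setOfPred_mapsTo (X := X) (Y := X)
      hU.isClosed_compl.isCompact hK.isClosed.isOpen_compl).preimage h
    convert h' using 1
    ext φ
    constructor
    · intro hm x hx hxK
      apply hx
      have := hm hxK
      simpa using this
    · intro hm x hx
      by_contra hxU
      have := hm (show (φ⁻¹ : X ≃ₜ X) x ∈ Uᶜ from hxU)
      apply this
      simpa using hx

end Homeomorphisms

section Isometries

variable {E : Type*} [NormedAddCommGroup E] [NormedSpace ℝ E]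
  {M : Type*} [TopologicalSpace M] [ChartedSpace E M] [IsManifold 𝓘(ℝ, E) ∞ M]

/-- The isometry group `Isom(M, g)`: the diffeomorphisms `φ` of `M` with `φ^* g = g`. -/
def isom (g : ContMDiffRiemannianMetric 𝓘(ℝ, E) ∞ E (fun x : M => TangentSpace 𝓘(ℝ, E) x)) :
    Subgroup (M ≃ₜ M) where
  carrier := {φ | ContMDiff 𝓘(ℝ, E) 𝓘(ℝ, E) ∞ φ ∧ ContMDiff 𝓘(ℝ, E) 𝓘(ℝ, E) ∞ φ.symm ∧
    ∀ (x : M) (v w : TangentSpace 𝓘(ℝ, E) x),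
      g.inner (φ x) (mfderiv 𝓘(ℝ, E) 𝓘(ℝ, E) φ x v) (mfderiv 𝓘(ℝ, E) 𝓘(ℝ, E) φ x w) =
        g.inner x v w}
  one_mem' := by
    refine ⟨contMDiff_id, contMDiff_id, fun x v w => ?_⟩
    have h : mfderiv 𝓘(ℝ, E) 𝓘(ℝ, E) ((1 : M ≃ₜ M) : M → M) x = ContinuousLinearMap.id ℝ _ :=
      mfderiv_id
    rw [h]; rfl
  mul_mem' := by
    rintro φ ψ ⟨h1, h2, h3⟩ ⟨k1, k2, k3⟩
    refine ⟨h1.comp k1, k2.comp h2, fun x v w => ?_⟩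
    have h : mfderiv 𝓘(ℝ, E) 𝓘(ℝ, E) ((φ * ψ : M ≃ₜ M) : M → M) x =
        (mfderiv 𝓘(ℝ, E) 𝓘(ℝ, E) φ (ψ x)).comp (mfderiv 𝓘(ℝ, E) 𝓘(ℝ, E) ψ x) :=
      mfderiv_comp x (h1.mdifferentiable (by simp) _) (k1.mdifferentiable (by simp) _)
    rw [h, ← k3 x v w]
    exact h3 (ψ x) _ _
  inv_mem' := by
    rintro φ ⟨h1, h2, h3⟩
    refine ⟨h2, h1, fun x v w => ?_⟩
    have h : (mfderiv 𝓘(ℝ, E) 𝓘(ℝ, E) φ (φ.symm x)).comp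
        (mfderiv 𝓘(ℝ, E) 𝓘(ℝ, E) φ.symm x) = ContinuousLinearMap.id ℝ E := by
      have hc := mfderiv_comp (I'' := 𝓘(ℝ, E)) x
        (h1.mdifferentiable (by simp) (φ.symm x)) (h2.mdifferentiable (by simp) x)
      have hid : (φ ∘ φ.symm : M → M) = id := by ext y; simp
      rw [hid, mfderiv_id] at hc
      exact hc.symm
    have key := h3 (φ.symm x) (mfderiv 𝓘(ℝ, E) 𝓘(ℝ, E) φ.symm x v)
      (mfderiv 𝓘(ℝ, E) 𝓘(ℝ, E) φ.symm x w)
    have hv : ∀ u : E, mfderiv 𝓘(ℝ, E) 𝓘(ℝ, E) φ (φ.symm x)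
        (mfderiv 𝓘(ℝ, E) 𝓘(ℝ, E) φ.symm x u) = u := fun u =>
      congrArg (fun L : E →L[ℝ] E => L u) h
    have e1 := hv v
    have e2 := hv w
    rw [e1, e2] at key
    have hx : φ (φ.symm x) = x := φ.apply_symm_apply x
    have fin : ∀ y : M, y = x → (g.inner y : E →L[ℝ] E →L[ℝ] ℝ) v w =
      (g.inner x : E →L[ℝ] E →L[ℝ] ℝ) v w := by rintro y rfl; rfl
    exact key.symm.trans (fin _ hx)

/-- The vector field `X` is Killing for `g`: the Lie derivative `L_X g` vanishes. -/
def IsKilling (g : ContMDiffRiemannianMetric 𝓘(ℝ, E) ∞ E (fun x : M => TangentSpace 𝓘(ℝ, E) x))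
    (X : ∀ x : M, TangentSpace 𝓘(ℝ, E) x) : Prop :=
  ∀ Y Z : ∀ x : M, TangentSpace 𝓘(ℝ, E) x, SmoothVectorField Y → SmoothVectorField Z → ∀ x : M,
    (mfderiv 𝓘(ℝ, E) 𝓘(ℝ, ℝ) (fun y => g.inner y (Y y) (Z y)) x (X x) : ℝ) =
      g.inner x (VectorField.mlieBracket 𝓘(ℝ, E) X Y x) (Z x) +
        g.inner x (Y x) (VectorField.mlieBracket 𝓘(ℝ, E) X Z x)

/-- The isometries that are time-`t` maps of the flow of `X` for some `t`, that is, those sending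
`γ 0` to `γ t` for every integral curve `γ : ℝ → M` of `X`. (On a compact manifold there is exactly
one such curve through every point, so there is at most one such map for each `t`.) -/
def flowSubgroup
    (g : ContMDiffRiemannianMetric 𝓘(ℝ, E) ∞ E (fun x : M => TangentSpace 𝓘(ℝ, E) x))
    (X : ∀ x : M, TangentSpace 𝓘(ℝ, E) x) : Subgroup (isom g) where
  carrier := {φ | ∃ t : ℝ, ∀ γ : ℝ → M, IsMIntegralCurve γ X → φ.1 (γ 0) = γ t}
  one_mem' := ⟨0, fun _ _ => rfl⟩
  mul_mem' := by
    rintro φ ψ ⟨s, hs⟩ ⟨t, ht⟩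
    refine ⟨s + t, fun γ hγ => ?_⟩
    have h := hs _ (hγ.comp_add t)
    simp only [Function.comp_apply, zero_add] at h
    rw [← h, ← ht γ hγ]
    rfl
  inv_mem' := by
    rintro φ ⟨t, ht⟩
    refine ⟨-t, fun γ hγ => ?_⟩
    have h := ht _ (hγ.comp_add (-t))
    simp only [Function.comp_apply, zero_add, add_neg_cancel] at h
    rw [← h]
    exact φ.1.symm_apply_apply (γ (-t))

/-- The closure in `Isom(M, g)` of the flow of `X`. -/
def flowClosure [CompactSpace M] [T2Space M]
    (g : ContMDiffRiemannianMetric 𝓘(ℝ, E) ∞ E (fun x : M => TangentSpace 𝓘(ℝ, E) x))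
    (X : ∀ x : M, TangentSpace 𝓘(ℝ, E) x) : Subgroup (isom g) :=
  (flowSubgroup g X).topologicalClosure

end Isometries

/-! ### Contact metric structures on five-manifolds -/

/-- The model space of five-manifolds. -/
abbrev E5 : Type := EuclideanSpace ℝ (Fin 5)

section Contact

/-- A contact metric structure `(ξ, η, Φ, g)` on a five-manifold. -/
structure ContactMetricStructure (M : Type*) [TopologicalSpace M] [ChartedSpace E5 M]
    [IsManifold (𝓡 5) ∞ M] where
  /-- the Reeb vector field `ξ` -/
  reeb : ∀ x : M, TangentSpace (𝓡 5) x
  /-- the contact form `η` -/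
  form : ∀ x : M, TangentSpace (𝓡 5) x →L[ℝ] ℝ
  /-- the endomorphism `Φ` of `TM` -/
  endo : ∀ x : M, TangentSpace (𝓡 5) x →L[ℝ] TangentSpace (𝓡 5) x
  /-- the Riemannian metric `g` -/
  metric : ContMDiffRiemannianMetric (𝓡 5) ∞ E5 (fun x : M => TangentSpace (𝓡 5) x)
  smooth_reeb : SmoothVectorField reeb
  smooth_form : SmoothOneForm form
  smooth_endo : ContMDiff (𝓡 5) ((𝓡 5).prod 𝓘(ℝ, E5 →L[ℝ] E5)) ∞
    (fun x => TotalSpace.mk' (E5 →L[ℝ] E5)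
      (E := fun x : M => TangentSpace (𝓡 5) x →L[ℝ] TangentSpace (𝓡 5) x) x (endo x))
  form_reeb : ∀ x, form x (reeb x) = 1
  endo_endo : ∀ (x : M) (u : TangentSpace (𝓡 5) x),
    endo x (endo x u) = -u + form x u • reeb x
  metric_endo : ∀ (x : M) (u v : TangentSpace (𝓡 5) x),
    metric.inner x (endo x u) (endo x v) = metric.inner x u v - form x u * form x v
  /-- `dη = ω`, where `ω(u, v) = g(u, Φ v)` -/
  extDeriv_form : ∀ (x : M) (u v : TangentSpace (𝓡 5) x),
    extDerivOneForm form x u v = metric.inner x u (endo x v)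

namespace ContactMetricStructure

variable {M : Type*} [TopologicalSpace M] [ChartedSpace E5 M] [IsManifold (𝓡 5) ∞ M]
  (C : ContactMetricStructure M)

/-- The structure is K-contact: `ξ` is a Killing vector field of `g`. -/
def IsKContact : Prop := IsKilling C.metric C.reeb

/-- The torus `T`: the closure in `Isom(M, g)` of the flow of `ξ`. -/
def torus [CompactSpace M] [T2Space M] : Subgroup (isom C.metric) :=
  flowClosure C.metric C.reeb

/-- The fundamental two-form `ω(u, v) = g(u, Φ v)`. -/
def omega (x : M) (u v : TangentSpace (𝓡 5) x) : ℝ := C.metric.inner x u (C.endo x v)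

/-- The five-form `η ∧ ω ∧ ω`. -/
def volumeForm (x : M) (e : Fin 5 → TangentSpace (𝓡 5) x) : ℝ :=
  (1 / 4) * ∑ σ : Equiv.Perm (Fin 5), ((Equiv.Perm.sign σ : ℤ) : ℝ) *
    (C.form x (e (σ 0)) * C.omega x (e (σ 1)) (e (σ 2)) * C.omega x (e (σ 3)) (e (σ 4)))

/-- `e` is a `g`-orthonormal frame of `T_x M` which is positive for the orientation of `M` defined
by the contact structure, that is, by the volume form `η ∧ ω ∧ ω`. -/
def IsOrientedOrthonormal (x : M) (e : Fin 5 → TangentSpace (𝓡 5) x) : Prop :=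
  (∀ i j, C.metric.inner x (e i) (e j) = if i = j then 1 else 0) ∧ 0 < C.volumeForm x e

/-- The `V`-valued three-form `β` on `T_x M` is the Hodge star of the two-form `α`:
`β(e₂, e₃, e₄) = α(e₀, e₁)` for every oriented orthonormal frame `(e₀, ..., e₄)`. -/
def IsHodgeStar {V : Type*} (x : M)
    (α : TangentSpace (𝓡 5) x → TangentSpace (𝓡 5) x → V)
    (β : TangentSpace (𝓡 5) x → TangentSpace (𝓡 5) x → TangentSpace (𝓡 5) x → V) : Prop :=
  ∀ e : Fin 5 → TangentSpace (𝓡 5) x, C.IsOrientedOrthonormal x e →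
    β (e 2) (e 3) (e 4) = α (e 0) (e 1)

/-- The three-form `η ∧ α` on `T_x M`, for a `V`-valued two-form `α`. -/
def wedgeForm {V : Type*} [AddCommGroup V] [Module ℝ V] (x : M)
    (α : TangentSpace (𝓡 5) x → TangentSpace (𝓡 5) x → V)
    (u v w : TangentSpace (𝓡 5) x) : V :=
  C.form x u • α v w + C.form x v • α w u + C.form x w • α u v

end ContactMetricStructure

end Contact

/-! ### Principal bundles and connections -/

section LieGroups

variable {EG : Type*} [NormedAddCommGroup EG] [NormedSpace ℝ EG] [FiniteDimensional ℝ EG]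
  (G : Type*) [TopologicalSpace G] [ChartedSpace EG G] [Group G] [LieGroup 𝓘(ℝ, EG) ∞ G]

/-- The Lie group `G` is semisimple: its Lie algebra is semisimple. -/
def IsSemisimpleLieGroup : Prop :=
  haveI : CompleteSpace EG := FiniteDimensional.complete ℝ EG
  haveI : LieGroup 𝓘(ℝ, EG) (minSmoothness ℝ 3) G :=
    LieGroup.of_le (n := ∞) (by rw [minSmoothness_of_isRCLikeNormedField]; exact ENat.LEInfty.out)
  LieAlgebra.IsSemisimple ℝ (GroupLieAlgebra 𝓘(ℝ, EG) G)

variable {G} in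
/-- The adjoint representation: `Ad g` is the derivative at `1` of `h ↦ g h g⁻¹`. -/
def adjointRep (g : G) : GroupLieAlgebra 𝓘(ℝ, EG) G →L[ℝ] GroupLieAlgebra 𝓘(ℝ, EG) G :=
  mfderiv 𝓘(ℝ, EG) 𝓘(ℝ, EG) (fun h : G => g * h * g⁻¹) 1

end LieGroups

/-- A smooth principal `G`-bundle with total space `P` and base `M`: a smooth projection and a
smooth right action of `G` on `P`, locally isomorphic to `U × G → U` with `G` acting by right
translations on the second factor. -/
structure PrincipalBundle {EP EM EG : Type*} [NormedAddCommGroup EP] [NormedSpace ℝ EP]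
    [NormedAddCommGroup EM] [NormedSpace ℝ EM] [NormedAddCommGroup EG] [NormedSpace ℝ EG]
    (P M G : Type*) [TopologicalSpace P] [ChartedSpace EP P]
    [TopologicalSpace M] [ChartedSpace EM M]
    [TopologicalSpace G] [ChartedSpace EG G] [Group G] where
  /-- the projection -/
  proj : P → M
  /-- the right action of the structure group -/
  act : P → G → P
  act_one : ∀ p, act p 1 = p
  act_mul : ∀ p g h, act p (g * h) = act (act p g) h
  proj_act : ∀ p g, proj (act p g) = proj p
  smooth_proj : ContMDiff 𝓘(ℝ, EP) 𝓘(ℝ, EM) ∞ proj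
  smooth_act : ContMDiff (𝓘(ℝ, EP).prod 𝓘(ℝ, EG)) 𝓘(ℝ, EP) ∞ (fun q : P × G => act q.1 q.2)
  locally_trivial : ∀ x : M, ∃ e : Bundle.Trivialization G proj, x ∈ e.baseSet ∧
    ContMDiffOn 𝓘(ℝ, EP) (𝓘(ℝ, EM).prod 𝓘(ℝ, EG)) ∞ e e.source ∧
    ContMDiffOn (𝓘(ℝ, EM).prod 𝓘(ℝ, EG)) 𝓘(ℝ, EP) ∞ e.toOpenPartialHomeomorph.symm e.target ∧
    ∀ p ∈ e.source, ∀ g : G, (e (act p g)).2 = (e p).2 * g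

section Connections

variable {EP EM EG : Type*} [NormedAddCommGroup EP] [NormedSpace ℝ EP]
  [NormedAddCommGroup EM] [NormedSpace ℝ EM] [NormedAddCommGroup EG] [NormedSpace ℝ EG]
  {P M G : Type*} [TopologicalSpace P] [ChartedSpace EP P] [IsManifold 𝓘(ℝ, EP) ∞ P]
  [TopologicalSpace M] [ChartedSpace EM M]
  [TopologicalSpace G] [ChartedSpace EG G] [Group G]

/-- A connection on the principal bundle `Q`, given by its connection form
`A ∈ Ω¹(P, 𝔤)`, where `𝔤 = T₁G`. -/
structure Connection (Q : PrincipalBundle (EP := EP) (EM := EM) (EG := EG) P M G) where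
  /-- the connection form -/
  form : ∀ p : P, TangentSpace 𝓘(ℝ, EP) p →L[ℝ] GroupLieAlgebra 𝓘(ℝ, EG) G
  smooth_form : SmoothOneForm (V := EG) form
  /-- `A` reproduces the generators of the fundamental vector fields -/
  form_fundamental : ∀ (p : P) (v : GroupLieAlgebra 𝓘(ℝ, EG) G),
    form (Q.act p 1) (mfderiv 𝓘(ℝ, EG) 𝓘(ℝ, EP) (fun h : G => Q.act p h) 1 v) = v
  /-- `R_g^* A = Ad(g⁻¹) A` -/
  form_equivariant : ∀ (p : P) (g : G) (w : TangentSpace 𝓘(ℝ, EP) p),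
    form (Q.act p g) (mfderiv 𝓘(ℝ, EP) 𝓘(ℝ, EP) (fun q : P => Q.act q g) p w) =
      adjointRep g⁻¹ (form p w)

namespace Connection

variable {Q : PrincipalBundle (EP := EP) (EM := EM) (EG := EG) P M G} (A : Connection Q)

/-- The curvature `F = dA + ½ [A ∧ A]`, a `𝔤`-valued two-form on `P`. -/
def curvature (p : P) (u v : TangentSpace 𝓘(ℝ, EP) p) : GroupLieAlgebra 𝓘(ℝ, EG) G :=
  let dA : GroupLieAlgebra 𝓘(ℝ, EG) G := extDerivOneForm (V := EG) A.form p u v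
  dA + ⁅A.form p u, A.form p v⁆

/-- `u'` is the horizontal lift to `p` of the tangent vector `u` of `M` at `π(p)`. -/
def IsHorizontalLift (p : P) (u : TangentSpace 𝓘(ℝ, EM) (Q.proj p))
    (u' : TangentSpace 𝓘(ℝ, EP) p) : Prop :=
  mfderiv 𝓘(ℝ, EP) 𝓘(ℝ, EM) Q.proj p u' = u ∧ A.form p u' = 0

open Classical in
/-- The horizontal lift to `p` of a tangent vector of `M` at `π(p)` (it exists and is unique). -/
def horizontalLift (p : P) (u : TangentSpace 𝓘(ℝ, EM) (Q.proj p)) : TangentSpace 𝓘(ℝ, EP) p :=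
  if h : ∃ u', A.IsHorizontalLift p u u' then h.choose else 0

/-- The curvature as a two-form on `M` with values in the adjoint bundle: its value at `π(p)`, read
in the fibre of the adjoint bundle identified with `𝔤` through `p`. -/
def baseCurvature (p : P) (u v : TangentSpace 𝓘(ℝ, EM) (Q.proj p)) :
    GroupLieAlgebra 𝓘(ℝ, EG) G :=
  A.curvature p (A.horizontalLift p u) (A.horizontalLift p v)

/-- The group of automorphisms of `(P, ∇)`: the diffeomorphisms of `P` that commute with the action
of `G` and preserve the connection form. -/
def aut : Subgroup (P ≃ₜ P) where
  carrier := {ψ | ContMDiff 𝓘(ℝ, EP) 𝓘(ℝ, EP) ∞ ψ ∧ ContMDiff 𝓘(ℝ, EP) 𝓘(ℝ, EP) ∞ ψ.symm ∧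
    (∀ (p : P) (g : G), ψ (Q.act p g) = Q.act (ψ p) g) ∧
    ∀ (p : P) (w : TangentSpace 𝓘(ℝ, EP) p),
      A.form (ψ p) (mfderiv 𝓘(ℝ, EP) 𝓘(ℝ, EP) ψ p w) = A.form p w}
  one_mem' := by
    refine ⟨contMDiff_id, contMDiff_id, fun _ _ => rfl, fun x v => ?_⟩
    have h : mfderiv 𝓘(ℝ, EP) 𝓘(ℝ, EP) ((1 : P ≃ₜ P) : P → P) x = ContinuousLinearMap.id ℝ _ :=
      mfderiv_id
    rw [h]; rfl
  mul_mem' := by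
    rintro φ ψ ⟨h1, h2, h4, h3⟩ ⟨k1, k2, k4, k3⟩
    refine ⟨h1.comp k1, k2.comp h2, fun p g => ?_, fun x v => ?_⟩
    · change φ (ψ _) = Q.act (φ (ψ p)) g
      rw [k4, h4]
    have h : mfderiv 𝓘(ℝ, EP) 𝓘(ℝ, EP) ((φ * ψ : P ≃ₜ P) : P → P) x =
        (mfderiv 𝓘(ℝ, EP) 𝓘(ℝ, EP) φ (ψ x)).comp (mfderiv 𝓘(ℝ, EP) 𝓘(ℝ, EP) ψ x) :=
      mfderiv_comp x (h1.mdifferentiable (by simp) _) (k1.mdifferentiable (by simp) _)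
    rw [h, ← k3 x v]
    exact h3 (ψ x) _
  inv_mem' := by
    rintro φ ⟨h1, h2, h4, h3⟩
    refine ⟨h2, h1, fun p g => ?_, fun x v => ?_⟩
    · change φ.symm _ = Q.act (φ.symm p) g
      apply φ.injective
      rw [h4, φ.apply_symm_apply, φ.apply_symm_apply]
    have h : (mfderiv 𝓘(ℝ, EP) 𝓘(ℝ, EP) φ (φ.symm x)).comp
        (mfderiv 𝓘(ℝ, EP) 𝓘(ℝ, EP) φ.symm x) = ContinuousLinearMap.id ℝ EP := by
      have hc := mfderiv_comp (I'' := 𝓘(ℝ, EP)) x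
        (h1.mdifferentiable (by simp) (φ.symm x)) (h2.mdifferentiable (by simp) x)
      have hid : (φ ∘ φ.symm : P → P) = id := by ext y; simp
      rw [hid, mfderiv_id] at hc
      exact hc.symm
    have key := h3 (φ.symm x) (mfderiv 𝓘(ℝ, EP) 𝓘(ℝ, EP) φ.symm x v)
    have hv : mfderiv 𝓘(ℝ, EP) 𝓘(ℝ, EP) φ (φ.symm x)
        (mfderiv 𝓘(ℝ, EP) 𝓘(ℝ, EP) φ.symm x v) = v :=
      congrArg (fun L : EP →L[ℝ] EP => L v) h
    rw [hv] at key
    have hx : φ (φ.symm x) = x := φ.apply_symm_apply x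
    have fin : ∀ y : P, y = x → (A.form y : EP →L[ℝ] EG) v = (A.form x : EP →L[ℝ] EG) v := by
      rintro y rfl; rfl
    exact key.symm.trans (fin _ hx)

/-- `∇` is irreducible: `Aut(∇) = Z(G)`, that is, the gauge transformations (automorphisms of `P`
covering the identity of `M`) that preserve `∇` are exactly the maps `p ↦ p z` with `z` in the
centre of `G`. -/
def IsIrreducible : Prop :=
  ∀ ψ : P ≃ₜ P, (ψ ∈ A.aut ∧ ∀ p, Q.proj (ψ p) = Q.proj p) ↔
    ∃ z ∈ Subgroup.center G, ∀ p, ψ p = Q.act p z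

end Connection

end Connections

section Instantons

variable {EP EG : Type*} [NormedAddCommGroup EP] [NormedSpace ℝ EP]
  [NormedAddCommGroup EG] [NormedSpace ℝ EG]
  {P M G : Type*} [TopologicalSpace P] [ChartedSpace EP P] [IsManifold 𝓘(ℝ, EP) ∞ P]
  [TopologicalSpace M] [ChartedSpace E5 M] [IsManifold (𝓡 5) ∞ M]
  [TopologicalSpace G] [ChartedSpace EG G] [Group G]
  {Q : PrincipalBundle (EP := EP) (EM := E5) (EG := EG) P M G}

/-- `∇` is a self-dual contact instanton: `*F = η ∧ F`. -/
def IsSelfDualInstanton (C : ContactMetricStructure M) (A : Connection Q) : Prop :=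
  ∀ p : P, C.IsHodgeStar (V := EG) (Q.proj p) (A.baseCurvature p)
    (C.wedgeForm (V := EG) (Q.proj p) (A.baseCurvature p))

/-- `∇` is an anti-self-dual contact instanton: `*F = -η ∧ F`. -/
def IsAntiSelfDualInstanton (C : ContactMetricStructure M) (A : Connection Q) : Prop :=
  ∀ p : P, C.IsHodgeStar (V := EG) (Q.proj p) (A.baseCurvature p)
    (fun u v w => -C.wedgeForm (V := EG) (Q.proj p) (A.baseCurvature p) u v w)

/-- A contact instanton is a connection that is a self-dual or an anti-self-dual one. -/
def IsContactInstanton (C : ContactMetricStructure M) (A : Connection Q) : Prop :=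
  IsSelfDualInstanton C A ∨ IsAntiSelfDualInstanton C A

/-- `ρ` lifts the action of the torus `T` on `M` to a smooth action on `P` by automorphisms of
`(P, ∇)`. -/
structure IsSmoothLift [CompactSpace M] [T2Space M] (C : ContactMetricStructure M)
    (A : Connection Q) (ρ : C.torus →* A.aut) : Prop where
  /-- `ρ t` covers `t` -/
  covers : ∀ (t : C.torus) (p : P), Q.proj ((ρ t).1 p) = t.1.1 (Q.proj p)
  /-- the action map `T × P → P` is continuous -/
  continuous : Continuous (fun q : C.torus × P => (ρ q.1).1 q.2)
  /-- the action map `T × P → P` is smooth, for the smooth structure of `T` as a group of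
  diffeomorphisms of `M`, in which a map `u : ℝᵏ → T` is smooth when `(y, x) ↦ u(y) x` is -/
  smooth : ∀ (k : ℕ) (u : EuclideanSpace ℝ (Fin k) → C.torus),
    ContMDiff ((𝓡 k).prod (𝓡 5)) (𝓡 5) ∞
      (fun q : EuclideanSpace ℝ (Fin k) × M => (u q.1).1.1 q.2) →
    ContMDiff ((𝓡 k).prod 𝓘(ℝ, EP)) 𝓘(ℝ, EP) ∞
      (fun q : EuclideanSpace ℝ (Fin k) × P => (ρ (u q.1)).1 q.2)

end Instantons

end ContactInstanton

end

open scoped Manifold ContDiff Topology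
open Bundle

noncomputable section

namespace ContactInstanton

set_option linter.unusedSectionVars false

/-! ### Superposition operators and local flows in Banach spaces -/

section Superposition

universe u

variable {K : Type*} [TopologicalSpace K] [CompactSpace K]
  {E F : Type u} [NormedAddCommGroup E] [NormedSpace ℝ E] [NormedAddCommGroup F] [NormedSpace ℝ F]

/-! Write `ξ` for the Reeb field. In a positive orthonormal frame `(ξ, e₁, ..., e₄)` with `e₁, ...,
e₄` in `ker η`, the equation `*F = ±η ∧ F` evaluated on `(e₂, e₃, e₄)` reads `F(ξ, e₁) = 0`. Every
unit vector of `ker η` occurs as `e₁` in such a frame, so `F` vanishes on `ξ`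
(`IsContactInstanton.extDerivOneForm_reeb`). The Lie derivative of `A` along the horizontal lift of
`ξ` is the contraction of this lift with `F`, hence zero: the flow of the lift preserves `∇` and
covers the flow of `ξ` (`Connection.preservesAt_hflow`).

To pass to the closure `T`, note that the differential of an automorphism covering `φ` is determined
by `dφ` and by the values of `A` at a point and at its image. Isometries have uniformly bounded
differentials, so lifts of a convergent family of isometries are equicontinuous; as `P` is compact
they converge along ultrafilters, and the limit is again an automorphism of `(P, ∇)`
(`Connection.exists_limit_of_lifts`). So every `t ∈ T` has a lift. Two lifts of `t` differ by a
gauge transformation preserving `∇`, which is the identity by irreducibility and triviality of the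
centre (`Connection.IsIrreducible.eq_of_covers`). Uniqueness makes the lifts a homomorphism, and
together with the limit argument it makes the action continuous.

For smoothness, let `ψ_y` be the lift of `u(y)`. Conjugation by `ψ_y` sends the horizontal flow of
`X` to the horizontal flow of the push-forward of `X` by `u(y)`. Therefore `ψ_y θ ψ_y⁻¹` is smooth
in `y` for every composite `θ` of horizontal flows, although `ψ_y` itself is only known to be
continuous in `y`. If `θ p₀ = p₀ h`, the orbit point `q = ψ_y p₀` satisfies the smooth equations
`π(q) = u(y) π(p₀)` and `ψ_y θ ψ_y⁻¹ q = q h`. Their linearization in `q` is injective for finitely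
many suitable `θ`, because the holonomy group fixes no nonzero vector of the Lie algebra
(`Connection.IsIrreducible.eq_zero_of_fixed`): such a vector would generate nontrivial group
elements commuting with the holonomy, hence forbidden gauge transformations. So the orbit is smooth
(`Connection.IsIrreducible.contMDiff_orbit`), and conjugated horizontal transport carries this to
nearby points.

The analytic basis, smooth dependence of flows on points and parameters, comes from the implicit
function theorem in a Banach space of curves. -/

set_option synthInstance.maxHeartbeats 200000 in
/-- Pointwise application of a continuous family of continuous linear maps. -/
def pointwiseApply : C(K, E →L[ℝ] F) →L[ℝ] C(K, E) →L[ℝ] C(K, F) :=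
  LinearMap.mkContinuous₂
    (LinearMap.mk₂ ℝ (fun (B : C(K, E →L[ℝ] F)) (β : C(K, E)) =>
        (⟨fun t => B t (β t), B.continuous.clm_apply β.continuous⟩ : C(K, F)))
      (by intros; ext; simp) (by intros; ext; simp) (by intros; ext; simp)
      (by intros; ext; simp)) 1 (by
    intro B β
    rw [ContinuousMap.norm_le _ (by positivity), one_mul]
    intro t
    exact (ContinuousLinearMap.le_opNorm _ _).trans (by
      gcongr
      · exact B.norm_coe_le_norm t
      · exact β.norm_coe_le_norm t))

/-- The range of `α` is compact, so one radius `δ` controls the oscillation of `f'` around every `α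
t`; the mean value inequality on these balls then bounds the remainder uniformly in `t`. -/
theorem hasFDerivAt_superposition {f : C(E, F)} {f' : C(E, E →L[ℝ] F)}
    (hf : ∀ x, HasFDerivAt f (f' x) x) (α : C(K, E)) :
    HasFDerivAt (fun β : C(K, E) => f.comp β) (pointwiseApply (f'.comp α)) α := by
  rw [hasFDerivAt_iff_isLittleO_nhds_zero, Asymptotics.isLittleO_iff]
  intro c hc
  have hK : IsCompact (Set.range α) := isCompact_range α.continuous
  have hu := hK.uniformContinuousAt_of_continuousAt f' (fun a _ => f'.continuous.continuousAt)
    (Metric.dist_mem_uniformity hc)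
  obtain ⟨δ, hδ, hδ'⟩ := Metric.mem_uniformity_dist.1 hu
  filter_upwards [Metric.ball_mem_nhds 0 hδ] with β hβ
  rw [ContinuousMap.norm_le _ (by positivity)]
  intro t
  have hβt : ‖β t‖ ≤ ‖β‖ := β.norm_coe_le_norm t
  have hβδ : ‖β‖ < δ := by simpa using hβ
  have key : ‖f (α t + β t) - f (α t) - f' (α t) (α t + β t - α t)‖ ≤ c * ‖α t + β t - α t‖ := by
    apply (convex_ball (α t) δ).norm_image_sub_le_of_norm_hasFDerivWithin_le'
      (fun x _ => (hf x).hasFDerivWithinAt) _ (Metric.mem_ball_self hδ)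
    · simpa using hβt.trans_lt hβδ
    · intro x hx
      have h1 := @hδ' (α t) x (by rw [dist_comm]; exact hx) ⟨t, rfl⟩
      rw [← dist_eq_norm, dist_comm]
      exact le_of_lt h1
  simp only [add_sub_cancel_left] at key
  calc _ = ‖f (α t + β t) - f (α t) - f' (α t) (β t)‖ := rfl
    _ ≤ c * ‖β t‖ := key
    _ ≤ c * ‖β‖ := by gcongr

-- The derivative of a superposition operator is the superposition operator of `f'` followed by a
-- continuous linear map. The induction therefore runs over all target spaces at once, and `E` and
-- `F` share a universe so that `E →L[ℝ] F` is again an admissible target.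
set_option synthInstance.maxHeartbeats 200000 in
set_option maxHeartbeats 1000000 in
theorem contDiff_superposition_nat (n : ℕ) : ∀ {F : Type u} [NormedAddCommGroup F]
    [NormedSpace ℝ F] (f : C(E, F)), ContDiff ℝ ∞ f →
      ContDiff ℝ n (fun β : C(K, E) => f.comp β) := by
  induction n with
  | zero =>
    intro F _ _ f hf
    exact contDiff_zero.2 (ContinuousMap.continuous_postcomp f)
  | succ n ih =>
    intro F _ _ f hf
    let f' : C(E, E →L[ℝ] F) := ⟨fderiv ℝ f, hf.continuous_fderiv (by simp)⟩
    have hd : ∀ α : C(K, E), HasFDerivAt (fun β : C(K, E) => f.comp β)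
        (pointwiseApply (f'.comp α)) α :=
      hasFDerivAt_superposition (fun x => (hf.differentiable (by simp) x).hasFDerivAt)
    push_cast
    rw [contDiff_succ_iff_fderiv]
    refine ⟨fun α => (hd α).differentiableAt, by simp, ?_⟩
    have : fderiv ℝ (fun β : C(K, E) => f.comp β) = fun α => pointwiseApply (f'.comp α) := by
      ext1 α; exact (hd α).fderiv
    rw [this]
    exact pointwiseApply.contDiff.comp (ih f' (hf.fderiv_right (m := ∞) (by simp)))

end Superposition

section LocalFlow

variable {E : Type*} [NormedAddCommGroup E] [NormedSpace ℝ E]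

/-- The primitive vanishing at `0` of a continuous function on `[-1, 1]`. -/
def primitive : C(Set.Icc (-1 : ℝ) 1, E) →L[ℝ] C(Set.Icc (-1 : ℝ) 1, E) :=
  LinearMap.mkContinuous
    { toFun := fun β => ⟨fun t => ∫ τ in (0 : ℝ)..t, Set.IccExtend (by norm_num) β τ, by
        have h : Continuous (Set.IccExtend (by norm_num : (-1 : ℝ) ≤ 1) β) :=
          β.continuous.Icc_extend'
        exact (intervalIntegral.continuous_primitive (fun a b => h.intervalIntegrable a b)
          0).comp continuous_subtype_val⟩
      map_add' := by
        intro β γ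
        ext t
        have h : ∀ β : C(Set.Icc (-1 : ℝ) 1, E),
          Continuous (Set.IccExtend (by norm_num : (-1 : ℝ) ≤ 1) β) :=
          fun β => β.continuous.Icc_extend'
        simp only [ContinuousMap.coe_mk, ContinuousMap.add_apply]
        rw [← intervalIntegral.integral_add ((h β).intervalIntegrable _ _)
          ((h γ).intervalIntegrable _ _)]
        rfl
      map_smul' := by
        intro c β
        ext t
        simp only [ContinuousMap.coe_mk, ContinuousMap.smul_apply, RingHom.id_apply]
        rw [← intervalIntegral.integral_smul]
        rfl } 1 (by
    intro β
    rw [ContinuousMap.norm_le _ (by positivity), one_mul]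
    intro t
    have h := intervalIntegral.norm_integral_le_of_norm_le_const (a := 0) (b := (t : ℝ))
      (C := ‖β‖) (f := Set.IccExtend (by norm_num : (-1 : ℝ) ≤ 1) β)
      (fun x _ => β.norm_coe_le_norm _)
    refine h.trans ?_
    have : |(t : ℝ) - 0| ≤ 1 := by
      rw [sub_zero, abs_le]; exact t.2
    nlinarith [norm_nonneg β])

theorem primitive_apply (β : C(Set.Icc (-1 : ℝ) 1, E)) (t : Set.Icc (-1 : ℝ) 1) :
    primitive β t = ∫ τ in (0 : ℝ)..t, Set.IccExtend (by norm_num) β τ := rfl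

/-- Local flows of smooth vector fields on Banach spaces. -/
theorem exists_local_flow [CompleteSpace E] {f : E → E} (hf : ContDiff ℝ ∞ f) (z₀ : E) (n : ℕ) {O : Set E}
    (hO : O ∈ 𝓝 z₀) :
    ∃ ε > 0, ∃ U ∈ 𝓝 z₀, ∃ Γ : E → ℝ → E,
      (∀ z ∈ U, Γ z 0 = z ∧ ∀ t ∈ Set.Ioo (-ε) ε, HasDerivAt (Γ z) (f (Γ z t)) t ∧ Γ z t ∈ O) ∧
      ∀ t ∈ Set.Ioo (-ε) ε, ∀ z ∈ U, ContDiffAt ℝ n (fun z => Γ z t) z := by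
  let X := C(Set.Icc (-1 : ℝ) 1, E)
  let cst : E →L[ℝ] X := ContinuousLinearMap.const ℝ (Set.Icc (-1 : ℝ) 1)
  let fc : C(E, E) := ⟨f, hf.continuous⟩
  -- After rescaling time by `ε`, the integral equation of the flow on `[-ε, ε]` becomes `β = z + ε
  -- ∫ f(β)` on `[-1, 1]`, that is, `H ((ε, z), β) = 0`. For `ε = 0` the solutions are the constant
  -- curves and the derivative in `β` is the identity, so the implicit function theorem applies.
  let H : (ℝ × E) × X → X := fun q => q.2 - cst q.1.2 - q.1.1 • primitive (fc.comp q.2)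
  -- Order `n + 1` because the implicit function theorem needs a nonzero order and `n` may be `0`.
  have hN : ContDiff ℝ (n + 1 : ℕ) (fun β : X => fc.comp β) :=
    contDiff_superposition_nat (n + 1) fc hf
  have hH : ContDiff ℝ (n + 1 : ℕ) H := by
    have h1 : ContDiff ℝ (n + 1 : ℕ) (fun q : (ℝ × E) × X => primitive (fc.comp q.2)) :=
      primitive.contDiff.comp (hN.comp contDiff_snd)
    exact (contDiff_snd.sub (cst.contDiff.comp contDiff_fst.snd)).sub (contDiff_fst.fst.smul h1)
  let q₀ : (ℝ × E) × X := ((0, z₀), cst z₀)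
  have hn : ((n + 1 : ℕ) : WithTop ℕ∞) ≠ 0 := by
    exact_mod_cast Nat.succ_ne_zero n
  have hinr : fderiv ℝ H q₀ ∘L .inr ℝ (ℝ × E) X = ContinuousLinearMap.id ℝ X := by
    have h1 : HasFDerivAt H (fderiv ℝ H q₀) q₀ :=
      (hH.differentiable hn q₀).hasFDerivAt
    have h2 : HasFDerivAt (fun β : X => ((0, z₀), β)) (ContinuousLinearMap.inr ℝ (ℝ × E) X)
      (cst z₀) := hasFDerivAt_prodMk_right _ _
    have h3 := HasFDerivAt.comp (cst z₀) (f := fun β : X => ((0, z₀), β)) h1 h2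
    have h4 : H ∘ (fun β : X => ((0, z₀), β)) = fun β => β - cst z₀ := by
      ext1 β; simp [H]
    rw [h4] at h3
    exact h3.unique ((hasFDerivAt_id _).sub_const _)
  have hinv : (fderiv ℝ H q₀ ∘L .inr ℝ (ℝ × E) X).IsInvertible := by
    rw [hinr]; exact ⟨ContinuousLinearEquiv.refl ℝ X, rfl⟩
  have hHq : H q₀ = 0 := by simp [H, q₀]
  let a : ℝ × E → X := hH.contDiffAt.implicitFunction (u := q₀) hn hinv
  have ha0 : a (0, z₀) = cst z₀ := hH.contDiffAt.implicitFunction_apply_self (u := q₀) hn hinv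
  have haC : ContDiffAt ℝ (n + 1 : ℕ) a (0, z₀) :=
    hH.contDiffAt.contDiffAt_implicitFunction (u := q₀) hn hinv
  have haH : ∀ᶠ x in 𝓝 (0, z₀), H (x, a x) = 0 := by
    have := hH.contDiffAt.eventually_apply_implicitFunction (u := q₀) hn hinv
    rwa [hHq] at this
  obtain ⟨r, hr, hrO⟩ := Metric.mem_nhds_iff.1 hO
  have haO : ∀ᶠ x in 𝓝 ((0 : ℝ), z₀), dist (a x) (cst z₀) < r := by
    have := haC.continuousAt.eventually_mem (Metric.ball_mem_nhds (a (0, z₀)) hr)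
    rwa [ha0] at this
  have hev := (haH.and haO).and (haC.eventually (by simp))
  rw [nhds_prod_eq] at hev
  obtain ⟨S, hS, U, hU, hSU⟩ := Filter.eventually_prod_iff.1 hev
  obtain ⟨ε', hε', hεS⟩ := Metric.eventually_nhds_iff.1 hS
  -- One value of the scaling parameter serves all times in `(-ε, ε)`: the rescaling is undone by `t
  -- ↦ t / ε`.
  let ε := ε' / 2
  have hε : 0 < ε := by positivity
  have hSε : S ε := hεS (by simp [ε, abs_of_pos hε']; linarith)
  refine ⟨ε, hε, {z | U z}, hU, fun z t => Set.IccExtend (by norm_num) (a (ε, z)) (t / ε), ?_, ?_⟩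
  · intro z hz
    obtain ⟨⟨hHz, haz⟩, -⟩ := hSU hSε hz
    have hsol : ∀ t ∈ Set.Icc (-1 : ℝ) 1, Set.IccExtend (by norm_num) (a (ε, z)) t =
        z + ε • ∫ τ in (0 : ℝ)..t, f (Set.IccExtend (by norm_num) (a (ε, z)) τ) := by
      intro t ht
      have h1 : a (ε, z) ⟨t, ht⟩ - z - ε • primitive (fc.comp (a (ε, z))) ⟨t, ht⟩ = 0 :=
        congrArg (fun β : X => β ⟨t, ht⟩) hHz
      rw [primitive_apply] at h1
      rw [Set.IccExtend_of_mem _ _ ht]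
      have h2 : a (ε, z) ⟨t, ht⟩ = z + ε • ∫ τ in (0 : ℝ)..t,
          Set.IccExtend (by norm_num) (fc.comp (a (ε, z))) τ := by
        rw [sub_sub, sub_eq_zero] at h1
        exact h1
      rw [h2]
      rfl
    refine ⟨?_, fun t ht => ⟨?_, ?_⟩⟩
    · simp only [zero_div]
      rw [hsol 0 (by norm_num)]; simp
    · have ht' : t / ε ∈ Set.Ioo (-1 : ℝ) 1 := by
        constructor
        · rw [lt_div_iff₀ hε]; linarith [ht.1]
        · rw [div_lt_iff₀ hε]; linarith [ht.2]
      have hc : Continuous (fun τ => f (Set.IccExtend (by norm_num : (-1 : ℝ) ≤ 1)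
          (a (ε, z)) τ)) := hf.continuous.comp (a (ε, z)).continuous.Icc_extend'
      have h1 : HasDerivAt (fun t => z + ε • ∫ τ in (0 : ℝ)..t,
          f (Set.IccExtend (by norm_num) (a (ε, z)) τ))
          (ε • f (Set.IccExtend (by norm_num) (a (ε, z)) (t / ε))) (t / ε) :=
        ((hc.integral_hasStrictDerivAt 0 (t / ε)).hasDerivAt.const_smul ε).const_add z
      have h2 := h1.scomp t ((hasDerivAt_id t).div_const ε)
      rw [smul_smul, one_div, inv_mul_cancel₀ hε.ne', one_smul] at h2
      refine h2.congr_of_eventuallyEq ?_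
      have : ∀ᶠ s in 𝓝 t, s / ε ∈ Set.Ioo (-1 : ℝ) 1 :=
        (continuous_id.div_const ε).continuousAt.eventually_mem (isOpen_Ioo.mem_nhds ht')
      filter_upwards [this] with s hs
      exact hsol (s / ε) (Set.Ioo_subset_Icc_self hs)
    · apply hrO
      exact (ContinuousMap.dist_apply_le_dist (f := a (ε, z)) (g := cst z₀) _).trans_lt haz
  · intro t _ z hz
    obtain ⟨-, hC⟩ := hSU hSε hz
    let ev : X →L[ℝ] E := ContinuousMap.evalCLM ℝ (Set.projIcc (-1) 1 (by norm_num) (t / ε))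
    have h1 : ContDiffAt ℝ (n + 1 : ℕ) (fun z => ev (a (ε, z))) z :=
      ev.contDiff.contDiffAt.comp z
        (hC.comp z (contDiffAt_const.prodMk contDiffAt_id))
    exact h1.of_le (by exact_mod_cast Nat.le_succ n)

end LocalFlow

/-! ### Total differential equations, limits of their solutions, and maps into immersions. -/

section Calculus

variable {E F : Type*} [NormedAddCommGroup E] [NormedSpace ℝ E] [NormedAddCommGroup F]
  [NormedSpace ℝ F]

/-- A solution of a smooth total differential equation `df = R(z, f)` is smooth. -/
theorem contDiffAt_of_hasFDerivAt_eq {f : E → F} {R : E × F → E →L[ℝ] F} {z₀ : E}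
    (hR : ContDiffAt ℝ ∞ R (z₀, f z₀)) (hf : ∀ᶠ z in 𝓝 z₀, HasFDerivAt f (R (z, f z)) z) :
    ContDiffAt ℝ ∞ f z₀ := by
  rw [contDiffAt_infty]
  intro n
  -- Bootstrapping: if `f` is of class `Cⁿ`, so is its derivative `z ↦ R (z, f z)`.
  induction n with
  | zero =>
    rw [Nat.cast_zero, contDiffAt_zero]
    exact ⟨_, hf, fun z hz => (hz : HasFDerivAt f _ z).continuousAt.continuousWithinAt⟩
  | succ n ih =>
    push_cast
    rw [contDiffAt_succ_iff_hasFDerivAt]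
    refine ⟨fun z => R (z, f z), ⟨_, hf, fun z hz => hz⟩, ?_⟩
    exact (hR.of_le (by exact_mod_cast le_top)).comp z₀ (contDiffAt_id.prodMk ih)

/-- Pointwise limits of solutions of `df = S(f) (da, B)`, with `da` bounded, equicontinuous at
`z₀`, are differentiable at `z₀` where the limit of the `a`s is. -/
theorem hasFDerivAt_of_tendsto_of_equicontinuous {ι : Type*} {l : Filter ι} [l.NeBot]
    {H K : Type*} [NormedAddCommGroup H] [NormedSpace ℝ H] [NormedAddCommGroup K]
    [NormedSpace ℝ K] {f : ι → E → F} {a : ι → E → H} {a' : ι → E → E →L[ℝ] H} {f₀ : E → F}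
    {a₀ : E → H} {L : E →L[ℝ] H} {S : F → H × K →L[ℝ] F} {B : E → E →L[ℝ] K} {z₀ : E} {r C : ℝ}
    (hr : 0 < r)
    (hf : ∀ᶠ i in l, ∀ z ∈ Metric.ball z₀ r,
      HasFDerivAt (f i) (S (f i z) ∘L (a' i z).prod (B z)) z)
    (ha : ∀ᶠ i in l, ∀ z ∈ Metric.ball z₀ r, HasFDerivAt (a i) (a' i z) z)
    (hC : ∀ᶠ i in l, ∀ z ∈ Metric.ball z₀ r, ‖a' i z‖ ≤ C)
    (hS : ContinuousAt S (f₀ z₀)) (hB : ContinuousAt B z₀)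
    (hfl : ∀ z ∈ Metric.ball z₀ r, Filter.Tendsto (f · z) l (𝓝 (f₀ z)))
    (hal : ∀ z ∈ Metric.ball z₀ r, Filter.Tendsto (a · z) l (𝓝 (a₀ z)))
    (heq : ∀ ε > 0, ∃ δ > 0, ∀ᶠ i in l, ∀ z ∈ Metric.ball z₀ δ, dist (f i z) (f i z₀) < ε)
    (ha₀ : HasFDerivAt a₀ L z₀) :
    HasFDerivAt f₀ (S (f₀ z₀) ∘L L.prod (B z₀)) z₀ := by
  obtain ⟨S₀, hS₀⟩ : ∃ S₀ : H × K →L[ℝ] F, S₀ = S (f₀ z₀) := ⟨_, rfl⟩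
  rw [← hS₀]
  -- With `S` and `B` frozen at the limit point, the difference has small derivative near `z₀`,
  -- uniformly in `i`. The mean value inequality turns this into an increment bound that survives
  -- the pointwise limit; no convergence of the derivatives `a' i` is needed.
  have main : HasFDerivAt (fun z => f₀ z - S₀ (a₀ z, B z₀ z)) (0 : E →L[ℝ] F) z₀ := by
    rw [hasFDerivAt_iff_isLittleO, Asymptotics.isLittleO_iff]
    intro c hc
    set Q : ℝ := |C| + ‖B z₀‖ + 1 + ‖S₀‖ with hQ
    have hQ0 : 0 < Q := by positivity
    -- The derivative of the difference will be at most `c₁ * Q`; the minimum with `1` serves to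
    -- bound `‖B w‖` by `‖B z₀‖ + 1`.
    set c₁ : ℝ := min 1 (c / (2 * Q)) with hc₁
    have hc₁0 : 0 < c₁ := by positivity
    obtain ⟨η, hη, hSη⟩ := Metric.continuousAt_iff.1 hS c₁ hc₁0
    rw [← hS₀] at hSη
    obtain ⟨δ₁, hδ₁, hBδ⟩ := Metric.continuousAt_iff.1 hB c₁ hc₁0
    obtain ⟨δ₂, hδ₂, heq'⟩ := heq (η / 2) (by positivity)
    have hev := Metric.tendsto_nhds.1 (hfl z₀ (Metric.mem_ball_self hr)) (η / 2) (by positivity)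
    set δ := min r (min δ₁ δ₂) with hδ
    have hδ0 : 0 < δ := by positivity
    have hδr : δ ≤ r := min_le_left _ _
    have hδ1 : δ ≤ δ₁ := (min_le_right _ _).trans (min_le_left _ _)
    have hδ2 : δ ≤ δ₂ := (min_le_right _ _).trans (min_le_right _ _)
    filter_upwards [Metric.ball_mem_nhds z₀ hδ0] with z hz
    have hzr : z ∈ Metric.ball z₀ r := Metric.ball_subset_ball hδr hz
    have hz₀r : z₀ ∈ Metric.ball z₀ r := Metric.mem_ball_self hr
    have hlim : Filter.Tendsto (fun i => ‖(f i z - S₀ (a i z, B z₀ z)) -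
        (f i z₀ - S₀ (a i z₀, B z₀ z₀))‖) l
        (𝓝 ‖(f₀ z - S₀ (a₀ z, B z₀ z)) - (f₀ z₀ - S₀ (a₀ z₀, B z₀ z₀))‖) := by
      have h : ∀ w ∈ Metric.ball z₀ r, Filter.Tendsto (fun i => f i w - S₀ (a i w, B z₀ w)) l
          (𝓝 (f₀ w - S₀ (a₀ w, B z₀ w))) := fun w hw =>
        (hfl w hw).sub ((S₀.continuous.tendsto _).comp
          ((hal w hw).prodMk_nhds tendsto_const_nhds))
      exact ((h z hzr).sub (h z₀ hz₀r)).norm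
    simp only [zero_apply, sub_zero]
    refine le_of_tendsto hlim ?_
    filter_upwards [hf, ha, hC, heq', hev] with i hfi hai hCi heqi hevi
    have hder : ∀ w ∈ Metric.ball z₀ δ, HasFDerivWithinAt (fun z => f i z - S₀ (a i z, B z₀ z))
        (S (f i w) ∘L (a' i w).prod (B w) - S₀ ∘L (a' i w).prod (B z₀)) (Metric.ball z₀ δ) w := by
      intro w hw
      have hwr := Metric.ball_subset_ball hδr hw
      exact ((hfi w hwr).sub (S₀.hasFDerivAt.comp w
        ((hai w hwr).prodMk (B z₀).hasFDerivAt))).hasFDerivWithinAt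
    refine (convex_ball z₀ δ).norm_image_sub_le_of_norm_hasFDerivWithin_le hder ?_
      (Metric.mem_ball_self hδ0) hz
    intro w hw
    have hwr := Metric.ball_subset_ball hδr hw
    have hBw : ‖B w - B z₀‖ ≤ c₁ := by
      rw [← dist_eq_norm]; exact (hBδ (lt_of_lt_of_le hw hδ1)).le
    have hSw : ‖S (f i w) - S₀‖ ≤ c₁ := by
      rw [← dist_eq_norm]
      refine (hSη ?_).le
      have := heqi w (Metric.ball_subset_ball hδ2 hw)
      linarith [dist_triangle (f i w) (f i z₀) (f₀ z₀)]
    have hdec : S (f i w) ∘L (a' i w).prod (B w) - S₀ ∘L (a' i w).prod (B z₀) =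
        (S (f i w) - S₀) ∘L (a' i w).prod (B w) +
          S₀ ∘L (0 : E →L[ℝ] H).prod (B w - B z₀) := by
      ext v
      have h0 : ((a' i w v, B w v) : H × K) = (a' i w v, B z₀ v) + (0, B w v - B z₀ v) := by
        simp
      have h1 : S₀ (a' i w v, B w v) = S₀ (a' i w v, B z₀ v) + S₀ (0, B w v - B z₀ v) := by
        rw [h0, map_add]
      simp only [sub_apply, ContinuousLinearMap.comp_apply, ContinuousLinearMap.prod_apply,
        add_apply, h1, zero_apply]
      abel
    rw [hdec]
    have hn1 : ‖(a' i w).prod (B w)‖ ≤ |C| + ‖B z₀‖ + 1 := by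
      refine ContinuousLinearMap.opNorm_le_bound _ (by positivity) fun v => ?_
      have e1 : ‖a' i w v‖ ≤ |C| * ‖v‖ := ((a' i w).le_opNorm v).trans
        (mul_le_mul_of_nonneg_right ((hCi w hwr).trans (le_abs_self C)) (norm_nonneg v))
      have hBn : ‖B w‖ ≤ ‖B z₀‖ + 1 := by
        have h1 : ‖B w‖ ≤ ‖B w - B z₀‖ + ‖B z₀‖ := by
          simpa using norm_add_le (B w - B z₀) (B z₀)
        linarith [min_le_left 1 (c / (2 * Q))]
      have e2 : ‖B w v‖ ≤ (‖B z₀‖ + 1) * ‖v‖ := ((B w).le_opNorm v).trans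
        (mul_le_mul_of_nonneg_right hBn (norm_nonneg v))
      rw [ContinuousLinearMap.prod_apply, Prod.norm_def]
      refine max_le ?_ ?_
      · nlinarith [norm_nonneg v, norm_nonneg (B z₀)]
      · nlinarith [norm_nonneg v, abs_nonneg C]
    have hn2 : ‖(0 : E →L[ℝ] H).prod (B w - B z₀)‖ ≤ c₁ := by
      refine ContinuousLinearMap.opNorm_le_bound _ hc₁0.le fun v => ?_
      rw [ContinuousLinearMap.prod_apply, Prod.norm_def]
      refine max_le (by simp; positivity) (((B w - B z₀).le_opNorm v).trans (by gcongr))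
    calc _ ≤ ‖(S (f i w) - S₀)‖ * ‖(a' i w).prod (B w)‖ +
          ‖S₀‖ * ‖(0 : E →L[ℝ] H).prod (B w - B z₀)‖ :=
        (norm_add_le _ _).trans (add_le_add (ContinuousLinearMap.opNorm_comp_le _ _)
          (ContinuousLinearMap.opNorm_comp_le _ _))
      _ ≤ c₁ * (|C| + ‖B z₀‖ + 1) + ‖S₀‖ * c₁ := by gcongr
      _ = c₁ * Q := by rw [hQ]; ring
      _ ≤ c / (2 * Q) * Q := by gcongr; exact min_le_right _ _
      _ = c / 2 := by field_simp
      _ ≤ c := by linarith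
  have h2 : HasFDerivAt (fun z => S₀ (a₀ z, B z₀ z)) (S₀ ∘L L.prod (B z₀)) z₀ :=
    S₀.hasFDerivAt.comp z₀ (ha₀.prodMk (B z₀).hasFDerivAt)
  have h3 := main.add h2
  rw [zero_add] at h3
  refine h3.congr_of_eventuallyEq (Filter.Eventually.of_forall fun z => ?_)
  simp

/-- A continuous map whose composition with an immersion is smooth is smooth. -/
theorem contDiffAt_of_comp_immersion {Y : Type*} [NormedAddCommGroup Y] [NormedSpace ℝ Y]
    [FiniteDimensional ℝ E] [FiniteDimensional ℝ F] {f : E → F} {c : Y → E} {y₀ : Y}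
    {n : WithTop ℕ∞} (hn : n ≠ 0) (hf : ContDiffAt ℝ n f (c y₀))
    (hinj : Function.Injective (fderiv ℝ f (c y₀))) (hc : ContinuousAt c y₀)
    (hfc : ContDiffAt ℝ n (fun y => f (c y)) y₀) : ContDiffAt ℝ n c y₀ := by
  have : CompleteSpace E := FiniteDimensional.complete ℝ E
  -- A left inverse `L'` of the derivative makes `L' ∘ f` a local diffeomorphism at `c y₀`.
  -- Continuity of `c` keeps `c y` where the local inverse recovers it from `L' (f (c y))`.
  obtain ⟨L, hL⟩ := LinearMap.exists_leftInverse_of_injective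
    (fderiv ℝ f (c y₀)).toLinearMap (LinearMap.ker_eq_bot.2 hinj)
  let L' : F →L[ℝ] E := LinearMap.toContinuousLinearMap L
  have hg : ContDiffAt ℝ n (fun z => L' (f z)) (c y₀) := L'.contDiff.contDiffAt.comp _ hf
  have hg' : HasFDerivAt (fun z => L' (f z))
      ((ContinuousLinearEquiv.refl ℝ E : E ≃L[ℝ] E) : E →L[ℝ] E) (c y₀) := by
    have h1 := L'.hasFDerivAt.comp (c y₀) (hf.differentiableAt hn).hasFDerivAt
    refine h1.congr_fderiv ?_
    ext v
    exact LinearMap.congr_fun hL v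
  have hsymm := hg.to_localInverse hg' hn
  have h1 : ContDiffAt ℝ n (fun y => hg.localInverse hg' hn (L' (f (c y)))) y₀ :=
    ContDiffAt.comp (f := fun y => L' (f (c y))) y₀ hsymm (L'.contDiff.contDiffAt.comp y₀ hfc)
  refine h1.congr_of_eventuallyEq ?_
  have h2 : ∀ᶠ z in 𝓝 (c y₀), hg.localInverse hg' hn (L' (f z)) = z :=
    (hg.hasStrictFDerivAt' hg' hn).eventually_left_inverse
  filter_upwards [hc.eventually h2] with y hy
  exact hy.symm

end Calculus

/-! ### Charts of boundaryless manifolds -/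

section Charts

variable {E : Type*} [NormedAddCommGroup E] [NormedSpace ℝ E]
  {N : Type*} [TopologicalSpace N] [ChartedSpace E N]

variable [IsManifold 𝓘(ℝ, E) ∞ N]

theorem contMDiffAt_extChartAt_symm {x₀ : N} {z : E} (hz : z ∈ (extChartAt 𝓘(ℝ, E) x₀).target) :
    ContMDiffAt 𝓘(ℝ, E) 𝓘(ℝ, E) ∞ (extChartAt 𝓘(ℝ, E) x₀).symm z :=
  (contMDiffOn_extChartAt_symm x₀).contMDiffAt ((isOpen_extChartAt_target x₀).mem_nhds hz)

theorem mdifferentiableAt_extChartAt_symm {x₀ : N} {z : E}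
    (hz : z ∈ (extChartAt 𝓘(ℝ, E) x₀).target) :
    MDifferentiableAt 𝓘(ℝ, E) 𝓘(ℝ, E) (extChartAt 𝓘(ℝ, E) x₀).symm z :=
  (contMDiffAt_extChartAt_symm hz).mdifferentiableAt (by simp)

theorem mdifferentiableAt_extChartAt_of_mem {x₀ x : N} (hx : x ∈ (extChartAt 𝓘(ℝ, E) x₀).source) :
    MDifferentiableAt 𝓘(ℝ, E) 𝓘(ℝ, E) (extChartAt 𝓘(ℝ, E) x₀) x :=
  (contMDiffAt_extChartAt' (n := ∞) (by simpa using hx)).mdifferentiableAt (by simp)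

theorem mfderiv_extChartAt_symm_mfderiv_extChartAt {x₀ x : N}
    (hx : x ∈ (extChartAt 𝓘(ℝ, E) x₀).source) (v : TangentSpace 𝓘(ℝ, E) x) :
    (mfderiv 𝓘(ℝ, E) 𝓘(ℝ, E) (extChartAt 𝓘(ℝ, E) x₀).symm (extChartAt 𝓘(ℝ, E) x₀ x) :
      E →L[ℝ] E) (mfderiv 𝓘(ℝ, E) 𝓘(ℝ, E) (extChartAt 𝓘(ℝ, E) x₀) x v) = v := by
  have h := mfderiv_comp x
    (mdifferentiableAt_extChartAt_symm ((extChartAt 𝓘(ℝ, E) x₀).map_source hx))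
    (mdifferentiableAt_extChartAt_of_mem hx)
  have he : ((extChartAt 𝓘(ℝ, E) x₀).symm ∘ (extChartAt 𝓘(ℝ, E) x₀)) =ᶠ[𝓝 x] id := by
    filter_upwards [(isOpen_extChartAt_source x₀).mem_nhds hx] with y hy
    exact (extChartAt 𝓘(ℝ, E) x₀).left_inv hy
  rw [he.mfderiv_eq, mfderiv_id] at h
  exact (congrArg (fun L : E →L[ℝ] E => L v) h).symm

theorem mfderiv_extChartAt_mfderiv_extChartAt_symm {x₀ : N} {z : E}
    (hz : z ∈ (extChartAt 𝓘(ℝ, E) x₀).target) (v : E) :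
    (mfderiv 𝓘(ℝ, E) 𝓘(ℝ, E) (extChartAt 𝓘(ℝ, E) x₀) ((extChartAt 𝓘(ℝ, E) x₀).symm z) :
      E →L[ℝ] E) (mfderiv 𝓘(ℝ, E) 𝓘(ℝ, E) (extChartAt 𝓘(ℝ, E) x₀).symm z v) = v := by
  have h := mfderiv_comp z
    (mdifferentiableAt_extChartAt_of_mem ((extChartAt 𝓘(ℝ, E) x₀).map_target hz))
    (mdifferentiableAt_extChartAt_symm hz)
  have he : ((extChartAt 𝓘(ℝ, E) x₀) ∘ (extChartAt 𝓘(ℝ, E) x₀).symm) =ᶠ[𝓝 z] id := by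
    filter_upwards [(isOpen_extChartAt_target x₀).mem_nhds hz] with y hy
    exact (extChartAt 𝓘(ℝ, E) x₀).right_inv hy
  rw [he.mfderiv_eq, mfderiv_id] at h
  exact (congrArg (fun L : E →L[ℝ] E => L v) h).symm

/-- The coordinates of a tangent vector in the chart at `x₀`. -/
def tangentCoord (x₀ : N) (w : TangentBundle 𝓘(ℝ, E) N) : E :=
  mfderiv 𝓘(ℝ, E) 𝓘(ℝ, E) (extChartAt 𝓘(ℝ, E) x₀) w.1 w.2

theorem tangentCoord_eq_trivializationAt {x₀ : N} {w : TangentBundle 𝓘(ℝ, E) N}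
    (hw : w.1 ∈ (extChartAt 𝓘(ℝ, E) x₀).source) :
    tangentCoord x₀ w = (trivializationAt E (TangentSpace 𝓘(ℝ, E)) x₀ w).2 := by
  have hw' : w.1 ∈ (chartAt E x₀).source := by simpa using hw
  have := TangentBundle.continuousLinearMapAt_trivializationAt (I := 𝓘(ℝ, E)) (𝕜 := ℝ) hw'
  have h : (trivializationAt E (TangentSpace 𝓘(ℝ, E)) x₀).continuousLinearMapAt ℝ w.1 w.2 =
      (trivializationAt E (TangentSpace 𝓘(ℝ, E)) x₀ w).2 := by
    rw [Trivialization.continuousLinearMapAt_apply, Trivialization.linearMapAt_apply,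
      if_pos (by simpa using hw')]
  exact (congrArg (fun L : TangentSpace 𝓘(ℝ, E) w.1 →L[ℝ] E => L w.2) this).symm.trans h

/-- Tests smoothness of vectors along a map in any one chart around the base point. The bound `n + 1
≤ ∞` accounts for the derivative lost in passing to the tangent bundle; it holds for `n = ∞`. -/
theorem contMDiffAt_tangentBundle_iff {F H : Type*} [NormedAddCommGroup F] [NormedSpace ℝ F]
    [TopologicalSpace H] {J : ModelWithCorners ℝ F H} {N' : Type*} [TopologicalSpace N']
    [ChartedSpace H N'] {n : WithTop ℕ∞} (hn : n + 1 ≤ ∞) {w : N' → TangentBundle 𝓘(ℝ, E) N}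
    {a : N'} {x₀ : N} (ha : (w a).1 ∈ (extChartAt 𝓘(ℝ, E) x₀).source) :
    ContMDiffAt J 𝓘(ℝ, E).tangent n w a ↔ ContMDiffAt J 𝓘(ℝ, E) n (fun b => (w b).1) a ∧
      ContMDiffAt J 𝓘(ℝ, E) n (fun b => tangentCoord x₀ (w b)) a := by
  have : IsManifold 𝓘(ℝ, E) (n + 1) N := IsManifold.of_le hn
  have : ContMDiffVectorBundle n E (TangentSpace 𝓘(ℝ, E) : N → Type _) 𝓘(ℝ, E) :=
    TangentBundle.contMDiffVectorBundle
  have key := (trivializationAt E (TangentSpace 𝓘(ℝ, E)) x₀).contMDiffAt_iff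
    (IM := J) (IB := 𝓘(ℝ, E)) (n := n) (f := w) (x₀ := a) (by
      rw [Trivialization.mem_source]; simpa using ha)
  refine key.trans (and_congr_right fun h => ?_)
  refine Filter.EventuallyEq.contMDiffAt_iff ?_
  filter_upwards [h.continuousAt.eventually_mem ((isOpen_extChartAt_source x₀).mem_nhds ha)]
    with b hb
  exact (tangentCoord_eq_trivializationAt hb).symm

end Charts

/-! ### Flows with parameters -/

section Flows

variable {E : Type*} [NormedAddCommGroup E] [NormedSpace ℝ E]
  {N : Type*} [TopologicalSpace N] [ChartedSpace E N] [IsManifold 𝓘(ℝ, E) ∞ N]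
  {Y : Type*} [NormedAddCommGroup Y] [NormedSpace ℝ Y]

/-- The family `V` of vector fields on `N` depends smoothly on the parameter and the point. -/
def SmoothFamily (V : Y → ∀ x : N, TangentSpace 𝓘(ℝ, E) x) : Prop :=
  ContMDiff (𝓘(ℝ, Y).prod 𝓘(ℝ, E)) 𝓘(ℝ, E).tangent ∞
    (fun q : Y × N => (⟨q.2, V q.1 q.2⟩ : TangentBundle 𝓘(ℝ, E) N))

theorem SmoothFamily.smoothVectorField {V : Y → ∀ x : N, TangentSpace 𝓘(ℝ, E) x}
    (hV : SmoothFamily V) (y : Y) : SmoothVectorField (V y) :=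
  ContMDiff.comp (I' := 𝓘(ℝ, Y).prod 𝓘(ℝ, E)) (g := fun q : Y × N =>
    (⟨q.2, V q.1 q.2⟩ : TangentBundle 𝓘(ℝ, E) N)) hV
    (contMDiff_const.prodMk contMDiff_id : ContMDiff 𝓘(ℝ, E) (𝓘(ℝ, Y).prod 𝓘(ℝ, E)) ∞
      (fun x : N => (y, x)))

theorem SmoothVectorField.contMDiff_one {X : ∀ x : N, TangentSpace 𝓘(ℝ, E) x}
    (hX : SmoothVectorField X) :
    ContMDiff 𝓘(ℝ, E) 𝓘(ℝ, E).tangent 1 (fun x => (⟨x, X x⟩ : TangentBundle 𝓘(ℝ, E) N)) :=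
  ContMDiff.of_le hX (by simp)

theorem SmoothFamily.contDiffAt_coord {V : Y → ∀ x : N, TangentSpace 𝓘(ℝ, E) x}
    (hV : SmoothFamily V) (x₀ : N) (y : Y) {z : E} (hz : z ∈ (extChartAt 𝓘(ℝ, E) x₀).target) :
    ContDiffAt ℝ ∞ (fun q : Y × E => tangentCoord x₀
      ⟨(extChartAt 𝓘(ℝ, E) x₀).symm q.2, V q.1 ((extChartAt 𝓘(ℝ, E) x₀).symm q.2)⟩) (y, z) := by
  rw [← contMDiffAt_iff_contDiffAt]
  have h1 : ContMDiffAt 𝓘(ℝ, Y × E) (𝓘(ℝ, Y).prod 𝓘(ℝ, E)) ∞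
      (fun q : Y × E => (q.1, (extChartAt 𝓘(ℝ, E) x₀).symm q.2)) (y, z) := by
    refine ContMDiffAt.prodMk ?_ ?_
    · exact contMDiffAt_iff_contDiffAt.2 contDiffAt_fst
    · exact ContMDiffAt.comp (y, z) (contMDiffAt_extChartAt_symm hz)
        (contMDiffAt_iff_contDiffAt.2 contDiffAt_snd)
  have h2 := ContMDiffAt.comp (y, z) (hV.contMDiffAt (x := (y, (extChartAt 𝓘(ℝ, E) x₀).symm z))) h1
  exact ((contMDiffAt_tangentBundle_iff (x₀ := x₀) (by simp)
    ((extChartAt 𝓘(ℝ, E) x₀).map_target hz)).1 h2).2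

/-- A solution of the equation of integral curves in a chart gives an integral curve. -/
theorem isMIntegralCurveOn_extChartAt_symm {X : ∀ x : N, TangentSpace 𝓘(ℝ, E) x} {x₀ : N}
    {c : ℝ → E} {s : Set ℝ} (hc : ∀ t ∈ s, c t ∈ (extChartAt 𝓘(ℝ, E) x₀).target)
    (hd : ∀ t ∈ s, HasDerivAt c (tangentCoord x₀
      ⟨(extChartAt 𝓘(ℝ, E) x₀).symm (c t), X ((extChartAt 𝓘(ℝ, E) x₀).symm (c t))⟩) t) :
    IsMIntegralCurveOn (fun t => (extChartAt 𝓘(ℝ, E) x₀).symm (c t)) X s := by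
  intro t ht
  have h1 := (mdifferentiableAt_extChartAt_symm (hc t ht)).hasMFDerivAt
  have h2 : HasMFDerivAt 𝓘(ℝ, ℝ) 𝓘(ℝ, E) c t _ := (hd t ht).hasFDerivAt.hasMFDerivAt
  have h3 := HasMFDerivAt.comp t h1 h2
  refine (HasMFDerivAt.congr_mfderiv h3 ?_).hasMFDerivWithinAt
  refine ContinuousLinearMap.ext fun r => ?_
  have h4 := mfderiv_extChartAt_symm_mfderiv_extChartAt
    ((extChartAt 𝓘(ℝ, E) x₀).map_target (hc t ht)) (X ((extChartAt 𝓘(ℝ, E) x₀).symm (c t)))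
  rw [(extChartAt 𝓘(ℝ, E) x₀).right_inv (hc t ht)] at h4
  have h5 : ∀ (a : ℝ) (w : E),
      (mfderiv 𝓘(ℝ, E) 𝓘(ℝ, E) (extChartAt 𝓘(ℝ, E) x₀).symm (c t) : E →L[ℝ] E) (a • w) =
      a • (mfderiv 𝓘(ℝ, E) 𝓘(ℝ, E) (extChartAt 𝓘(ℝ, E) x₀).symm (c t) : E →L[ℝ] E) w :=
    fun a w => map_smul _ _ _
  exact (h5 r _).trans (congrArg (fun w : E => @HSMul.hSMul ℝ E E _ r w) h4)

/-- Local flows with parameters on a manifold. -/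
theorem SmoothFamily.exists_local_flow [FiniteDimensional ℝ E] [CompleteSpace Y]
    {V : Y → ∀ x : N, TangentSpace 𝓘(ℝ, E) x} (hV : SmoothFamily V) (y₀ : Y) (x₀ : N) (n : ℕ) :
    ∃ ε > 0, ∃ W ∈ 𝓝 (y₀, x₀), ∃ Γ : Y × N → ℝ → N,
      (∀ q ∈ W, Γ q 0 = q.2 ∧ IsMIntegralCurveOn (Γ q) (V q.1) (Set.Ioo (-ε) ε)) ∧
      ∀ t ∈ Set.Ioo (-ε) ε, ∀ q ∈ W, ContMDiffAt (𝓘(ℝ, Y).prod 𝓘(ℝ, E)) 𝓘(ℝ, E) n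
        (fun q => Γ q t) q := by
  have : CompleteSpace E := FiniteDimensional.complete ℝ E
  set e := extChartAt 𝓘(ℝ, E) x₀ with he
  have hz₀ : e x₀ ∈ e.target := mem_extChartAt_target x₀
  obtain ⟨r, hr, hre⟩ := Metric.isOpen_iff.1 (isOpen_extChartAt_target (I := 𝓘(ℝ, E)) x₀) _ hz₀
  -- Multiplication by a bump function extends the chart expression to a smooth field on all of `Y ×
  -- E`, with zero component along the parameters. The local flow is kept in the ball of radius `r /
  -- 3`, where the bump is `1`.
  let χ : ContDiffBump (e x₀) := ⟨r / 3, r / 2, by positivity, by linarith⟩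
  let f : Y × E → E := fun q => tangentCoord x₀ ⟨e.symm q.2, V q.1 (e.symm q.2)⟩
  let F : Y × E → Y × E := fun q => (0, χ q.2 • f q)
  have hF : ContDiff ℝ ∞ F := by
    refine contDiff_const.prodMk (contDiff_iff_contDiffAt.2 fun q => ?_)
    by_cases hq : q.2 ∈ Metric.ball (e x₀) r
    · exact (χ.contDiff.comp contDiff_snd).contDiffAt.smul (hV.contDiffAt_coord x₀ q.1 (hre hq))
    · have hq' : q.2 ∈ (Metric.closedBall (e x₀) (r / 2))ᶜ := by
        simp only [Set.mem_compl_iff, Metric.mem_closedBall, Metric.mem_ball] at hq ⊢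
        linarith
      have hev : ∀ᶠ q' in 𝓝 q, q'.2 ∈ (Metric.closedBall (e x₀) (r / 2))ᶜ :=
        continuous_snd.continuousAt.eventually_mem (Metric.isClosed_closedBall.isOpen_compl.mem_nhds hq')
      refine (contDiffAt_const (c := (0 : E))).congr_of_eventuallyEq ?_
      filter_upwards [hev] with q' hq'
      have : χ q'.2 = 0 := χ.zero_of_le_dist (by
        simp only [Set.mem_compl_iff, Metric.mem_closedBall, not_le] at hq'
        exact hq'.le)
      simp [this]
  obtain ⟨ε, hε, U, hU, Γ, hΓ, hΓs⟩ := ContactInstanton.exists_local_flow hF (y₀, e x₀) n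
    (O := {q | q.2 ∈ Metric.ball (e x₀) (r / 3)})
    (continuous_snd.continuousAt.eventually_mem (Metric.ball_mem_nhds _ (by positivity)))
  have hcont : ContinuousAt (fun q : Y × N => (q.1, e q.2)) (y₀, x₀) :=
    continuousAt_fst.prodMk
      (ContinuousAt.comp (x := (y₀, x₀)) (continuousAt_extChartAt x₀) continuousAt_snd)
  refine ⟨ε, hε, (fun q : Y × N => (q.1, e q.2)) ⁻¹' U ∩ {q | q.2 ∈ e.source}, ?_,
    fun q t => e.symm (Γ (q.1, e q.2) t).2, ?_, ?_⟩
  · refine Filter.inter_mem (hcont.preimage_mem_nhds hU) ?_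
    exact continuousAt_snd.eventually_mem (extChartAt_source_mem_nhds x₀)
  · rintro ⟨y, x⟩ ⟨hqU, hqs⟩
    obtain ⟨h0, hd⟩ := hΓ _ hqU
    have h0' : Γ (y, e x) 0 = (y, e x) := h0
    have hqs' : x ∈ e.source := hqs
    have hy : ∀ t ∈ Set.Ioo (-ε) ε, (Γ (y, e x) t).1 = y := by
      have hda : ∀ t ∈ Set.Ioo (-ε) ε, HasDerivWithinAt (fun t => (Γ (y, e x) t).1) 0
          (Set.Ioo (-ε) ε) t := fun t ht => by
        have := (hd t ht).1.hasFDerivAt.fst.hasDerivAt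
        simpa [F] using this.hasDerivWithinAt
      intro t ht
      have hc := (convex_Ioo (-ε) ε).norm_image_sub_le_of_norm_hasDerivWithin_le (C := 0) hda
        (by simp) (show (0 : ℝ) ∈ Set.Ioo (-ε) ε from ⟨by linarith, hε⟩) ht
      simp only [zero_mul, norm_le_zero_iff, sub_eq_zero] at hc
      rw [hc, h0']
    refine ⟨?_, isMIntegralCurveOn_extChartAt_symm (c := fun t => (Γ (y, e x) t).2) ?_ ?_⟩
    · change e.symm (Γ (y, e x) 0).2 = x
      rw [h0']; exact e.left_inv hqs'
    · intro t ht
      exact hre (Metric.ball_subset_ball (by linarith) (hd t ht).2)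
    · intro t ht
      have h1 : HasDerivAt (fun t => (Γ (y, e x) t).2) (F (Γ (y, e x) t)).2 t :=
        (hd t ht).1.hasFDerivAt.snd.hasDerivAt.congr_deriv (by simp)
      have h2 : χ (Γ (y, e x) t).2 = 1 :=
        χ.one_of_mem_closedBall (Metric.ball_subset_closedBall (hd t ht).2)
      have h3 : (F (Γ (y, e x) t)).2 = tangentCoord x₀ ⟨e.symm (Γ (y, e x) t).2,
          V y (e.symm (Γ (y, e x) t).2)⟩ := by
        change χ (Γ (y, e x) t).2 • f (Γ (y, e x) t) = _
        rw [h2, one_smul]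
        change tangentCoord x₀ ⟨_, V (Γ (y, e x) t).1 _⟩ = _
        rw [hy t ht]
      rw [h3] at h1
      exact h1
  · rintro t ht ⟨y, x⟩ ⟨hqU, hqs⟩
    have hqs' : x ∈ e.source := hqs
    have h1 : ContMDiffAt 𝓘(ℝ, Y × E) 𝓘(ℝ, E) n (fun q => (Γ q t).2) (y, e x) :=
      contMDiffAt_iff_contDiffAt.2 (ContDiffAt.snd (hΓs t ht _ hqU))
    have h2 : ContMDiffAt (𝓘(ℝ, Y).prod 𝓘(ℝ, E)) 𝓘(ℝ, Y × E) n
        (fun q : Y × N => (q.1, e q.2)) (y, x) := by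
      refine ContMDiffAt.prodMk_space contMDiffAt_fst ?_
      exact ContMDiffAt.comp (y, x) (contMDiffAt_extChartAt' (by simpa [he] using hqs'))
        contMDiffAt_snd
    have h3 : (Γ (y, e x) t).2 ∈ e.target :=
      hre (Metric.ball_subset_ball (by linarith) ((hΓ _ hqU).2 t ht).2)
    exact ContMDiffAt.comp (y, x) ((contMDiffAt_extChartAt_symm h3).of_le
      (by exact_mod_cast le_top)) 
      (ContMDiffAt.comp (y, x) (g := fun q => (Γ q t).2) (f := fun q : Y × N => (q.1, e q.2)) h1 h2)

/-- Finitely many local flows cover `N`, so integral curves through all points exist on one common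
interval, and they can be continued to all times. The parameter space `ℝ` in the proof is a dummy.
-/
theorem exists_isMIntegralCurve_of_compact [FiniteDimensional ℝ E] [T2Space N] [CompactSpace N]
    {X : ∀ x : N, TangentSpace 𝓘(ℝ, E) x} (hX : SmoothVectorField X) (x : N) :
    ∃ γ : ℝ → N, γ 0 = x ∧ IsMIntegralCurve γ X := by
  have hV : SmoothFamily (fun _ : ℝ => X) := ContMDiff.comp (I' := 𝓘(ℝ, E)) hX contMDiff_snd
  have hloc : ∀ x₀ : N, ∃ ε > 0, ∃ W ∈ 𝓝 x₀, ∀ x ∈ W, ∃ γ : ℝ → N, γ 0 = x ∧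
      IsMIntegralCurveOn γ X (Set.Ioo (-ε) ε) := by
    intro x₀
    obtain ⟨ε, hε, W, hW, Γ, hΓ, -⟩ := hV.exists_local_flow 0 x₀ 0
    refine ⟨ε, hε, {x | ((0 : ℝ), x) ∈ W}, ?_, fun x hx => ⟨Γ (0, x), hΓ _ hx⟩⟩
    exact (Continuous.prodMk_right (0 : ℝ)).continuousAt.preimage_mem_nhds hW
  choose ε hε W hW hWγ using hloc
  obtain ⟨S, -, hS⟩ := isCompact_univ.elim_nhds_subcover W (fun x _ => hW x)
  have hne : S.Nonempty := by
    obtain ⟨i, hi, -⟩ := Set.mem_iUnion₂.1 (hS (Set.mem_univ x))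
    exact ⟨i, hi⟩
  refine exists_isMIntegralCurve_of_isMIntegralCurveOn hX.contMDiff_one (ε := S.inf' hne ε)
    ((Finset.lt_inf'_iff hne).2 fun i _ => hε i) (fun x => ?_) x
  obtain ⟨i, hi, hxi⟩ := Set.mem_iUnion₂.1 (hS (Set.mem_univ x))
  obtain ⟨γ, h0, hγ⟩ := hWγ i x hxi
  have := Finset.inf'_le ε hi
  exact ⟨γ, h0, hγ.mono (Set.Ioo_subset_Ioo (by linarith) this)⟩

/-- The flow of a vector field, on a manifold on which integral curves are defined for all times. -/
def flow [FiniteDimensional ℝ E] [T2Space N] [CompactSpace N]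
    {X : ∀ x : N, TangentSpace 𝓘(ℝ, E) x} (hX : SmoothVectorField X) (t : ℝ) (x : N) : N :=
  (exists_isMIntegralCurve_of_compact hX x).choose t

section Compact

variable [FiniteDimensional ℝ E] [T2Space N] [CompactSpace N]
  {X : ∀ x : N, TangentSpace 𝓘(ℝ, E) x} (hX : SmoothVectorField X)

theorem flow_zero (x : N) : flow hX 0 x = x :=
  (exists_isMIntegralCurve_of_compact hX x).choose_spec.1

theorem isMIntegralCurve_flow (x : N) : IsMIntegralCurve (fun t => flow hX t x) X :=
  (exists_isMIntegralCurve_of_compact hX x).choose_spec.2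

theorem eq_flow {γ : ℝ → N} (hγ : IsMIntegralCurve γ X) (t : ℝ) : γ t = flow hX t (γ 0) :=
  congrFun (isMIntegralCurve_Ioo_eq_of_contMDiff_boundaryless (t₀ := 0) hX.contMDiff_one hγ
    (isMIntegralCurve_flow hX (γ 0)) (flow_zero hX _).symm) t

theorem eq_flow_of_mem_Ioo {γ : ℝ → N} {a b : ℝ} (h0 : (0 : ℝ) ∈ Set.Ioo a b)
    (hγ : IsMIntegralCurveOn γ X (Set.Ioo a b)) {t : ℝ} (ht : t ∈ Set.Ioo a b) :
    γ t = flow hX t (γ 0) :=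
  isMIntegralCurveOn_Ioo_eqOn_of_contMDiff_boundaryless h0 hX.contMDiff_one hγ
    ((isMIntegralCurve_flow hX (γ 0)).isMIntegralCurveOn _) (flow_zero hX _).symm ht

theorem flow_add (s t : ℝ) (x : N) : flow hX (s + t) x = flow hX s (flow hX t x) := by
  have h := eq_flow hX ((isMIntegralCurve_flow hX x).comp_add t) s
  simpa using h

theorem flow_smul {c : ℝ} (hcX : SmoothVectorField (c • X)) (t : ℝ) (x : N) :
    flow hcX t x = flow hX (t * c) x := by
  have h := eq_flow hcX ((isMIntegralCurve_flow hX x).comp_mul c) t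
  simp only [Function.comp_apply, zero_mul, flow_zero] at h
  exact h.symm

end Compact

/-- The flow at time one of a smooth family of vector fields is smooth in the parameters and the
point. -/
theorem SmoothFamily.contMDiff_flow [FiniteDimensional ℝ E] [T2Space N] [CompactSpace N]
    [CompleteSpace Y] {V : Y → ∀ x : N, TangentSpace 𝓘(ℝ, E) x} (hV : SmoothFamily V) (t : ℝ) :
    ContMDiff (𝓘(ℝ, Y).prod 𝓘(ℝ, E)) 𝓘(ℝ, E) ∞
      (fun q : Y × N => flow (hV.smoothVectorField q.1) t q.2) := by
  rintro ⟨y₀, x₀⟩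
  rw [contMDiffAt_infty]
  intro n
  set Φ : ℝ → Y × N → N := fun t q => flow (hV.smoothVectorField q.1) t q.2 with hΦ
  set S : Set ℝ := {t | ContMDiffAt (𝓘(ℝ, Y).prod 𝓘(ℝ, E)) 𝓘(ℝ, E) n (Φ t) (y₀, x₀)} with hS
  -- Near every `τ`, membership in `S` passes between any two times, since `Φ s'` is `Φ s` followed
  -- by a local flow for time `s' - s`; so `S` is open and closed. The order `n` is fixed beforehand
  -- because the local flow box depends on it.
  have hloc : ∀ τ : ℝ, ∃ δ > 0, ∀ s ∈ Metric.ball τ δ, ∀ s' ∈ Metric.ball τ δ, s ∈ S → s' ∈ S := by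
    intro τ
    obtain ⟨ε, hε, W, hW, Γ, hΓ, hΓs⟩ := hV.exists_local_flow y₀ (Φ τ (y₀, x₀)) n
    have hcτ : ContinuousAt (fun s => (y₀, Φ s (y₀, x₀))) τ :=
      continuousAt_const.prodMk (isMIntegralCurve_flow _ x₀).continuous.continuousAt
    obtain ⟨δ, hδ, hδW⟩ := Metric.mem_nhds_iff.1 (hcτ.preimage_mem_nhds (interior_mem_nhds.2 hW))
    refine ⟨min δ (ε / 2), by positivity, fun s hs s' hs' hsS => ?_⟩
    have hsW : (y₀, Φ s (y₀, x₀)) ∈ interior W :=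
      hδW (Metric.ball_subset_ball (min_le_left _ _) hs)
    have hss : s' - s ∈ Set.Ioo (-ε) ε := by
      have h1 := (Metric.mem_ball.1 hs).trans_le (min_le_right _ _)
      have h2 := (Metric.mem_ball.1 hs').trans_le (min_le_right _ _)
      rw [Real.dist_eq, abs_lt] at h1 h2
      constructor <;> linarith [h1.1, h1.2, h2.1, h2.2]
    have hsS' : ContMDiffAt (𝓘(ℝ, Y).prod 𝓘(ℝ, E)) 𝓘(ℝ, E) n (Φ s) (y₀, x₀) := hsS
    have hcomp : ContMDiffAt (𝓘(ℝ, Y).prod 𝓘(ℝ, E)) 𝓘(ℝ, E) n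
        (fun q : Y × N => Γ (q.1, Φ s q) (s' - s)) (y₀, x₀) :=
      ContMDiffAt.comp (y₀, x₀) (g := fun q => Γ q (s' - s)) (f := fun q : Y × N => (q.1, Φ s q))
        (hΓs _ hss _ (interior_subset hsW)) (contMDiffAt_fst.prodMk hsS')
    refine hcomp.congr_of_eventuallyEq ?_
    have hcs : ContinuousAt (fun q : Y × N => (q.1, Φ s q)) (y₀, x₀) :=
      continuousAt_fst.prodMk hsS'.continuousAt
    filter_upwards [hcs.preimage_mem_nhds (isOpen_interior.mem_nhds hsW)] with q hq
    obtain ⟨h0, hcurve⟩ := hΓ _ (interior_subset hq)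
    have h1 := eq_flow_of_mem_Ioo (hV.smoothVectorField q.1)
      (show (0 : ℝ) ∈ Set.Ioo (-ε) ε from ⟨by linarith, hε⟩) hcurve hss
    rw [h0] at h1
    rw [h1]
    change flow (hV.smoothVectorField q.1) s' q.2 = flow (hV.smoothVectorField q.1) (s' - s)
      (flow (hV.smoothVectorField q.1) s q.2)
    rw [← flow_add, sub_add_cancel]
  have hopen : IsOpen S := by
    rw [Metric.isOpen_iff]
    intro τ hτ
    obtain ⟨δ, hδ, h⟩ := hloc τ
    exact ⟨δ, hδ, fun s hs => h τ (Metric.mem_ball_self hδ) s hs hτ⟩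
  have hclosed : IsClosed S := by
    rw [← isOpen_compl_iff, Metric.isOpen_iff]
    intro τ hτ
    obtain ⟨δ, hδ, h⟩ := hloc τ
    exact ⟨δ, hδ, fun s hs hsS => hτ (h s hs τ (Metric.mem_ball_self hδ) hsS)⟩
  have h0 : (0 : ℝ) ∈ S := by
    have : Φ 0 = Prod.snd := by
      ext1 q; exact flow_zero _ _
    change ContMDiffAt _ _ _ (Φ 0) _
    rw [this]
    exact contMDiffAt_snd
  have huniv : S = Set.univ := IsClopen.eq_univ ⟨hclosed, hopen⟩ ⟨0, h0⟩
  have : t ∈ S := huniv ▸ Set.mem_univ t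
  exact this

end Flows

/-! ### Derivatives as maps of model spaces -/

section TDeriv

variable (E F : Type*) [NormedAddCommGroup E] [NormedSpace ℝ E] [NormedAddCommGroup F]
  [NormedSpace ℝ F]
  {F' : Type*} [NormedAddCommGroup F'] [NormedSpace ℝ F']
  {N'' N' N : Type*} [TopologicalSpace N''] [ChartedSpace F' N''] [TopologicalSpace N']
  [ChartedSpace F N'] [TopologicalSpace N] [ChartedSpace E N]

/-- The derivative of `f` at `x` as a linear map between the model spaces. -/
def tderiv (f : N → N') (x : N) : E →L[ℝ] F := mfderiv 𝓘(ℝ, E) 𝓘(ℝ, F) f x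

variable {E F}

theorem hasMFDerivAt_tderiv {f : N → N'} {x : N} (hf : MDifferentiableAt 𝓘(ℝ, E) 𝓘(ℝ, F) f x) :
    HasMFDerivAt 𝓘(ℝ, E) 𝓘(ℝ, F) f x (tderiv E F f x) := hf.hasMFDerivAt

theorem tderiv_comp {g : N' → N''} {f : N → N'} {x : N}
    (hg : MDifferentiableAt 𝓘(ℝ, F) 𝓘(ℝ, F') g (f x))
    (hf : MDifferentiableAt 𝓘(ℝ, E) 𝓘(ℝ, F) f x) (v : E) :
    tderiv E F' (fun y => g (f y)) x v = tderiv F F' g (f x) (tderiv E F f x v) :=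
  congrArg (fun L : E →L[ℝ] F' => L v) (mfderiv_comp x hg hf)

theorem tderiv_congr {f g : N → N'} {x : N} (h : f =ᶠ[𝓝 x] g) :
    tderiv E F f x = tderiv E F g x := h.mfderiv_eq

@[simp]
theorem tderiv_id (x : N) (v : E) : tderiv E E (fun y : N => y) x v = v :=
  congrArg (fun L : E →L[ℝ] E => L v) (mfderiv_id (I := 𝓘(ℝ, E)) (x := x))

@[simp]
theorem tderiv_const (c : N') (x : N) : tderiv E F (fun _ : N => c) x = 0 :=
  mfderiv_const

theorem HasMFDerivAt.tderiv_eq {f : N → N'} {x : N} {L : E →L[ℝ] F}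
    (hf : HasMFDerivAt 𝓘(ℝ, E) 𝓘(ℝ, F) f x L) : tderiv E F f x = L := hf.mfderiv

end TDeriv


/-! ### Principal bundles, fundamental vectors, and the splitting of `TP` by a connection. -/

section Bundle

variable {EP EM EG : Type*} [NormedAddCommGroup EP] [NormedSpace ℝ EP]
  [NormedAddCommGroup EM] [NormedSpace ℝ EM] [NormedAddCommGroup EG] [NormedSpace ℝ EG]
  {P M G : Type*} [TopologicalSpace P] [ChartedSpace EP P] [IsManifold 𝓘(ℝ, EP) ∞ P]
  [TopologicalSpace M] [ChartedSpace EM M] [IsManifold 𝓘(ℝ, EM) ∞ M]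
  [TopologicalSpace G] [ChartedSpace EG G] [Group G] [LieGroup 𝓘(ℝ, EG) ∞ G]

namespace PrincipalBundle

variable (Q : PrincipalBundle (EP := EP) (EM := EM) (EG := EG) P M G)

theorem mdiff_proj (p : P) : MDifferentiableAt 𝓘(ℝ, EP) 𝓘(ℝ, EM) Q.proj p :=
  Q.smooth_proj.mdifferentiable (by simp) p

theorem contMDiff_act_left (g : G) : ContMDiff 𝓘(ℝ, EP) 𝓘(ℝ, EP) ∞ (fun p => Q.act p g) :=
  ContMDiff.comp (g := fun q : P × G => Q.act q.1 q.2) (f := fun p : P => (p, g))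
    Q.smooth_act (contMDiff_id.prodMk contMDiff_const)

theorem contMDiff_act_right (p : P) : ContMDiff 𝓘(ℝ, EG) 𝓘(ℝ, EP) ∞ (fun g => Q.act p g) :=
  ContMDiff.comp (g := fun q : P × G => Q.act q.1 q.2) (f := fun g : G => (p, g))
    Q.smooth_act (contMDiff_const.prodMk contMDiff_id)

theorem mdiff_act_left (g : G) (p : P) :
    MDifferentiableAt 𝓘(ℝ, EP) 𝓘(ℝ, EP) (fun p => Q.act p g) p :=
  (Q.contMDiff_act_left g).mdifferentiable (by simp) p

theorem mdiff_act_right (p : P) (g : G) :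
    MDifferentiableAt 𝓘(ℝ, EG) 𝓘(ℝ, EP) (fun g => Q.act p g) g :=
  (Q.contMDiff_act_right p).mdifferentiable (by simp) g

theorem eq_of_act_eq {p : P} {g h : G} (hgh : Q.act p g = Q.act p h) : g = h := by
  obtain ⟨e, hx, -, -, he⟩ := Q.locally_trivial (Q.proj p)
  have hp : p ∈ e.source := e.mem_source.2 hx
  have h1 := he p hp g
  rw [hgh, he p hp h] at h1
  exact (mul_left_cancel h1).symm

theorem exists_act_eq {p q : P} (hpq : Q.proj p = Q.proj q) : ∃ g, Q.act p g = q := by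
  obtain ⟨e, hx, -, -, he⟩ := Q.locally_trivial (Q.proj p)
  have hp : p ∈ e.source := e.mem_source.2 hx
  have hq : q ∈ e.source := e.mem_source.2 (hpq ▸ hx)
  refine ⟨(e p).2⁻¹ * (e q).2, ?_⟩
  have ha : Q.act p ((e p).2⁻¹ * (e q).2) ∈ e.source :=
    e.mem_source.2 (by rw [Q.proj_act]; exact hx)
  have h : e (Q.act p ((e p).2⁻¹ * (e q).2)) = e q := by
    refine Prod.ext ?_ ?_
    · rw [e.coe_fst ha, e.coe_fst hq, Q.proj_act, hpq]
    · rw [he p hp]; group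
  exact e.injOn ha hq h

/-- Finitely many sets `K × G`, with `K` compact inside a trivializing open set, cover `P`. -/
theorem compactSpace (Q : PrincipalBundle (EP := EP) (EM := EM) (EG := EG) P M G)
    [CompactSpace M] [T2Space M] [CompactSpace G] : CompactSpace P := by
  choose e hx h1 h2 h3 using Q.locally_trivial
  have hK : ∀ x : M, ∃ K ∈ 𝓝 x, IsCompact K ∧ K ⊆ (e x).baseSet := fun x => by
    obtain ⟨K, hK, hKe, hKc⟩ := local_compact_nhds ((e x).open_baseSet.mem_nhds (hx x))
    exact ⟨K, hK, hKc, hKe⟩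
  choose K hK hKc hKe using hK
  obtain ⟨S, -, hS⟩ := isCompact_univ.elim_nhds_subcover K (fun x _ => hK x)
  have hcomp : IsCompact (⋃ x ∈ S, (e x).toOpenPartialHomeomorph.symm '' (K x ×ˢ Set.univ)) := by
    refine S.isCompact_biUnion fun x _ => ?_
    refine ((hKc x).prod isCompact_univ).image_of_continuousOn ?_
    refine (e x).toOpenPartialHomeomorph.continuousOn_symm.mono ?_
    rintro ⟨y, g⟩ ⟨hy, -⟩
    exact (e x).mem_target.2 (hKe x hy)
  refine ⟨hcomp.of_isClosed_subset isClosed_univ fun p _ => ?_⟩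
  obtain ⟨x, hxS, hpx⟩ := Set.mem_iUnion₂.1 (hS (Set.mem_univ (Q.proj p)))
  have hp : p ∈ (e x).source := (e x).mem_source.2 (hKe x hpx)
  refine Set.mem_iUnion₂.2 ⟨x, hxS, e x p, ⟨?_, trivial⟩, (e x).left_inv hp⟩
  rw [(e x).coe_fst hp]; exact hpx

/-- The fundamental vector at `p` of an element of the Lie algebra. -/
def fund (p : P) : EG →L[ℝ] EP := tderiv EG EP (fun h : G => Q.act p h) 1

theorem tderiv_proj_fund (p : P) (X : EG) : tderiv EP EM Q.proj p (Q.fund p X) = 0 := by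
  have h := tderiv_comp (g := Q.proj) (f := fun h : G => Q.act p h) (x := 1)
    (Q.mdiff_proj _) (Q.mdiff_act_right p 1) X
  have hc : (fun h : G => Q.proj (Q.act p h)) = fun _ => Q.proj p := by
    ext h; exact Q.proj_act p h
  rw [hc, tderiv_const] at h
  simp only [Q.act_one] at h
  exact h.symm

/-- A smooth local trivialization: the inverse of the trivialization is `(x, g) ↦ s(x) g`. -/
theorem exists_trivialization (x : M) : ∃ e : Bundle.Trivialization G Q.proj, x ∈ e.baseSet ∧
    (∀ p ∈ e.source, ContMDiffAt 𝓘(ℝ, EP) 𝓘(ℝ, EG) ∞ (fun q => (e q).2) p) ∧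
    (∀ q ∈ e.target, ContMDiffAt (𝓘(ℝ, EM).prod 𝓘(ℝ, EG)) 𝓘(ℝ, EP) ∞
      e.toOpenPartialHomeomorph.symm q) ∧
    ∀ p ∈ e.source, ∀ g : G, (e (Q.act p g)).2 = (e p).2 * g := by
  obtain ⟨e, hx, h1, h2, h3⟩ := Q.locally_trivial x
  refine ⟨e, hx, fun p hp => ?_, fun q hq => ?_, h3⟩
  · exact contMDiffAt_snd.comp p (h1.contMDiffAt (e.open_source.mem_nhds hp))
  · exact h2.contMDiffAt (e.open_target.mem_nhds hq)

theorem exists_section (p : P) : ∃ s : M → P, s (Q.proj p) = p ∧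
    ContMDiffAt 𝓘(ℝ, EM) 𝓘(ℝ, EP) ∞ s (Q.proj p) ∧ ∀ᶠ x in 𝓝 (Q.proj p), Q.proj (s x) = x := by
  obtain ⟨e, hx, h1, h2, h3⟩ := Q.exists_trivialization (Q.proj p)
  have hp : p ∈ e.source := e.mem_source.2 hx
  have hep : (Q.proj p, (e p).2) = e p := Prod.ext (e.coe_fst hp).symm rfl
  refine ⟨fun x => e.toOpenPartialHomeomorph.symm (x, (e p).2), ?_, ?_, ?_⟩
  · change e.toOpenPartialHomeomorph.symm (Q.proj p, (e p).2) = p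
    rw [hep]; exact e.left_inv hp
  · exact ContMDiffAt.comp (Q.proj p) (g := e.toOpenPartialHomeomorph.symm)
      (f := fun x : M => (x, (e p).2)) (h2 _ (e.mem_target.2 hx))
      (contMDiffAt_id.prodMk contMDiffAt_const)
  · filter_upwards [e.open_baseSet.mem_nhds hx] with x hx'
    exact e.proj_symm_apply (e.mem_target.2 hx')

theorem tderiv_proj_surjective (p : P) : Function.Surjective (tderiv EP EM Q.proj p) := by
  obtain ⟨s, hs0, hs, hps⟩ := Q.exists_section p
  intro u
  refine ⟨tderiv EM EP s (Q.proj p) u, ?_⟩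
  have h := tderiv_comp (g := Q.proj) (f := s) (x := Q.proj p) (Q.mdiff_proj _)
    (hs.mdifferentiableAt (by simp)) u
  rw [tderiv_congr (g := fun x => x) hps, tderiv_id, hs0] at h
  exact h.symm

/-- In a trivialization `v` has coordinates `(0, w)`, with `w` tangent to `G` at the group
coordinate `k` of `p`. Left translation of `w` by `k⁻¹` gives the generator. -/
theorem exists_fund_eq {p : P} {v : EP} (hv : tderiv EP EM Q.proj p v = 0) :
    ∃ X, Q.fund p X = v := by
  obtain ⟨e, hx, h1, h2, h3⟩ := Q.exists_trivialization (Q.proj p)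
  have hp : p ∈ e.source := e.mem_source.2 hx
  have hep : (Q.proj p, (e p).2) = e p := Prod.ext (e.coe_fst hp).symm rfl
  set k := (e p).2 with hk
  set w : EG := tderiv EP EG (fun q => (e q).2) p v with hw
  refine ⟨tderiv EG EG (fun h : G => k⁻¹ * h) k w, ?_⟩
  have hsymm : MDifferentiableAt (𝓘(ℝ, EM).prod 𝓘(ℝ, EG)) 𝓘(ℝ, EP)
      e.toOpenPartialHomeomorph.symm (Q.proj p, k) :=
    (h2 _ (e.mem_target.2 hx)).mdifferentiableAt (by simp)
  set L : EM × EG →L[ℝ] EP := mfderiv (𝓘(ℝ, EM).prod 𝓘(ℝ, EG)) 𝓘(ℝ, EP)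
      e.toOpenPartialHomeomorph.symm (Q.proj p, k) with hL
  have hsymm' : HasMFDerivAt (𝓘(ℝ, EM).prod 𝓘(ℝ, EG)) 𝓘(ℝ, EP)
      e.toOpenPartialHomeomorph.symm (Q.proj p, k) L := hsymm.hasMFDerivAt
  have hsnd := hasMFDerivAt_tderiv ((h1 p hp).mdifferentiableAt (by simp))
  have hA : HasMFDerivAt 𝓘(ℝ, EP) (𝓘(ℝ, EM).prod 𝓘(ℝ, EG)) (fun q => (Q.proj q, (e q).2)) p
      ((tderiv EP EM Q.proj p).prod (tderiv EP EG (fun q => (e q).2) p)) :=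
    (hasMFDerivAt_tderiv (Q.mdiff_proj p)).prodMk hsnd
  have hB : HasMFDerivAt 𝓘(ℝ, EP) 𝓘(ℝ, EP)
      (fun q => e.toOpenPartialHomeomorph.symm (Q.proj q, (e q).2)) p
      (L.comp ((tderiv EP EM Q.proj p).prod (tderiv EP EG (fun q => (e q).2) p))) :=
    HasMFDerivAt.comp p hsymm' hA
  have hid : (fun q => e.toOpenPartialHomeomorph.symm (Q.proj q, (e q).2)) =ᶠ[𝓝 p]
      fun q => q := by
    filter_upwards [e.open_source.mem_nhds hp] with q hq
    have : (Q.proj q, (e q).2) = e q := Prod.ext (e.coe_fst hq).symm rfl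
    rw [this]; exact e.left_inv hq
  have hvL : v = L (0, w) := by
    have h := HasMFDerivAt.tderiv_eq hB
    rw [tderiv_congr hid] at h
    have h' : tderiv EP EP (fun q : P => q) p v = L (tderiv EP EM Q.proj p v, w) :=
      congrArg (fun T : EP →L[ℝ] EP => T v) h
    rwa [tderiv_id, hv] at h'
  have hC : HasMFDerivAt 𝓘(ℝ, EG) 𝓘(ℝ, EP)
      (fun h : G => e.toOpenPartialHomeomorph.symm (Q.proj p, h)) k
      (L.comp ((0 : EG →L[ℝ] EM).prod (ContinuousLinearMap.id ℝ EG))) :=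
    HasMFDerivAt.comp k hsymm'
      (HasMFDerivAt.prodMk (hasMFDerivAt_const (Q.proj p) k) (hasMFDerivAt_id k))
  have hfun : (fun h : G => e.toOpenPartialHomeomorph.symm (Q.proj p, h)) =
      fun h => Q.act p (k⁻¹ * h) := by
    ext1 h
    have ha : Q.act p (k⁻¹ * h) ∈ e.source := e.mem_source.2 (by rw [Q.proj_act]; exact hx)
    have : (Q.proj p, h) = e (Q.act p (k⁻¹ * h)) := by
      refine Prod.ext ?_ ?_
      · rw [e.coe_fst ha, Q.proj_act]
      · rw [h3 p hp, ← hk]; simp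
    rw [this]; exact e.left_inv ha
  have hmul : MDifferentiableAt 𝓘(ℝ, EG) 𝓘(ℝ, EG) (fun h : G => k⁻¹ * h) k :=
    (contMDiff_mul_left (I := 𝓘(ℝ, EG)) (n := ∞) (a := k⁻¹)).mdifferentiable (by simp) k
  have hD := tderiv_comp (g := fun h : G => Q.act p h) (f := fun h : G => k⁻¹ * h) (x := k)
    (Q.mdiff_act_right p _) hmul w
  rw [← hfun, HasMFDerivAt.tderiv_eq hC, inv_mul_cancel] at hD
  rw [hvL]
  exact hD.symm

/-- Differentiate `p h g = (p g)(g⁻¹ h g)` at `h = 1`. The form `g⁻¹⁻¹` matches the unfolding of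
`adjointRep g⁻¹`. -/
theorem tderiv_act_fund (p : P) (g : G) (X : EG) :
    tderiv EP EP (fun q => Q.act q g) p (Q.fund p X) =
      Q.fund (Q.act p g) (tderiv EG EG (fun h : G => g⁻¹ * h * g⁻¹⁻¹) 1 X) := by
  have hconj : MDifferentiableAt 𝓘(ℝ, EG) 𝓘(ℝ, EG) (fun h : G => g⁻¹ * h * g⁻¹⁻¹) 1 :=
    ((contMDiff_mul_right (I := 𝓘(ℝ, EG)) (n := ∞) (a := g⁻¹⁻¹)).comp
      (contMDiff_mul_left (I := 𝓘(ℝ, EG)) (n := ∞) (a := g⁻¹))).mdifferentiable (by simp) 1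
  have h1 := tderiv_comp (g := fun q => Q.act q g) (f := fun h : G => Q.act p h) (x := 1)
    (Q.mdiff_act_left g _) (Q.mdiff_act_right p 1) X
  have h2 := tderiv_comp (g := fun h => Q.act (Q.act p g) h)
    (f := fun h : G => g⁻¹ * h * g⁻¹⁻¹) (x := 1)
    (Q.mdiff_act_right _ _) hconj X
  have h3 : (fun h : G => Q.act (Q.act p h) g) =
      fun h => Q.act (Q.act p g) (g⁻¹ * h * g⁻¹⁻¹) := by
    ext h
    rw [← Q.act_mul, ← Q.act_mul]
    congr 1; group
  rw [h3] at h1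
  rw [h1] at h2
  simp only [Q.act_one, mul_one, mul_inv_cancel] at h2
  exact h2

end PrincipalBundle

namespace Connection

variable {Q : PrincipalBundle (EP := EP) (EM := EM) (EG := EG) P M G} (A : Connection Q)

/-- The connection form at `p` as a linear map of model spaces. -/
def formAt (p : P) : EP →L[ℝ] EG := A.form p

theorem formAt_fund (p : P) (X : EG) : A.formAt p (Q.fund p X) = X := by
  have h := A.form_fundamental p X
  change A.formAt (Q.act p 1) (Q.fund p X) = X at h
  rwa [Q.act_one] at h

theorem formAt_act (p : P) (g : G) (v : EP) :
    A.formAt (Q.act p g) (tderiv EP EP (fun q => Q.act q g) p v) =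
      tderiv EG EG (fun h : G => g⁻¹ * h * g⁻¹⁻¹) 1 (A.formAt p v) :=
  A.form_equivariant p g v

/-- The isomorphism of `T_p P` with `T_{π(p)} M × 𝔤` defined by the connection. -/
def frame (p : P) : EP →L[ℝ] EM × EG := (tderiv EP EM Q.proj p).prod (A.formAt p)

@[simp]
theorem frame_apply (p : P) (v : EP) :
    A.frame p v = (tderiv EP EM Q.proj p v, A.formAt p v) := rfl

theorem frame_fund (p : P) (X : EG) : A.frame p (Q.fund p X) = (0, X) := by
  rw [frame_apply, Q.tderiv_proj_fund, A.formAt_fund]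

/-- A vector killed by `dπ` is fundamental, and the connection form detects its generator.
Conversely any lift of `u` can be corrected by a fundamental vector. -/
theorem frame_bijective (p : P) : Function.Bijective (A.frame p) := by
  constructor
  · rw [injective_iff_map_eq_zero]
    intro v hv
    rw [frame_apply, Prod.mk_eq_zero] at hv
    obtain ⟨X, rfl⟩ := Q.exists_fund_eq hv.1
    rw [A.formAt_fund] at hv
    rw [hv.2, map_zero]
  · rintro ⟨u, a⟩
    obtain ⟨v, rfl⟩ := Q.tderiv_proj_surjective p u
    refine ⟨v + Q.fund p (a - A.formAt p v), ?_⟩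
    rw [map_add, frame_fund, frame_apply]
    simp

theorem frame_isInvertible [FiniteDimensional ℝ EP] (p : P) : (A.frame p).IsInvertible := by
  have : FiniteDimensional ℝ (EM × EG) :=
    Module.Finite.of_surjective (A.frame p).toLinearMap (A.frame_bijective p).2
  exact ⟨(LinearEquiv.ofBijective (A.frame p).toLinearMap
    (A.frame_bijective p)).toContinuousLinearEquiv, by ext v <;> rfl⟩

/-- The inverse of `frame`. -/
def coframe (p : P) : EM × EG →L[ℝ] EP := (A.frame p).inverse

theorem frame_coframe [FiniteDimensional ℝ EP] (p : P) (w : EM × EG) :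
    A.frame p (A.coframe p w) = w :=
  (A.frame_isInvertible p).self_apply_inverse w

theorem eq_coframe [FiniteDimensional ℝ EP] {p : P} {v : EP} {w : EM × EG}
    (h : A.frame p v = w) : v = A.coframe p w :=
  (A.frame_bijective p).1 (by rw [h, frame_coframe])

/-- The horizontal lift of a tangent vector. -/
def hlift (p : P) (u : EM) : EP := A.coframe p (u, 0)

variable [FiniteDimensional ℝ EP]

theorem tderiv_proj_hlift (p : P) (u : EM) : tderiv EP EM Q.proj p (A.hlift p u) = u :=
  congrArg Prod.fst (A.frame_coframe p (u, 0))

theorem formAt_hlift (p : P) (u : EM) : A.formAt p (A.hlift p u) = 0 :=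
  congrArg Prod.snd (A.frame_coframe p (u, 0))

theorem eq_hlift {p : P} {v : EP} {u : EM} (h1 : tderiv EP EM Q.proj p v = u)
    (h2 : A.formAt p v = 0) : v = A.hlift p u :=
  A.eq_coframe (by rw [frame_apply, h1, h2])

theorem horizontalLift_eq_hlift (p : P) (u : EM) : A.horizontalLift p u = A.hlift p u := by
  have hex : ∃ u', A.IsHorizontalLift p u u' :=
    ⟨A.hlift p u, A.tderiv_proj_hlift p u, A.formAt_hlift p u⟩
  exact (dif_pos hex).trans (A.eq_hlift hex.choose_spec.1 hex.choose_spec.2)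

theorem exists_decomposition (p : P) (v : EP) :
    v = A.hlift p (tderiv EP EM Q.proj p v) + Q.fund p (A.formAt p v) := by
  apply (A.frame_bijective p).1
  rw [map_add, frame_fund, frame_apply, frame_apply, tderiv_proj_hlift, formAt_hlift]
  simp

theorem tderiv_act_hlift (p : P) (g : G) (u : EM) :
    tderiv EP EP (fun q => Q.act q g) p (A.hlift p u) = A.hlift (Q.act p g) u := by
  apply A.eq_hlift
  · have h := tderiv_comp (g := Q.proj) (f := fun q => Q.act q g) (x := p) (Q.mdiff_proj _)
      (Q.mdiff_act_left g p) (A.hlift p u)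
    have hc : (fun q => Q.proj (Q.act q g)) = Q.proj := by ext q; exact Q.proj_act q g
    rw [hc, tderiv_proj_hlift] at h
    exact h.symm
  · rw [formAt_act, formAt_hlift, map_zero]

end Connection

end Bundle

/-! ### Local expressions -/

section LocalForms

variable {E : Type*} [NormedAddCommGroup E] [NormedSpace ℝ E]
  {N : Type*} [TopologicalSpace N] [ChartedSpace E N] [IsManifold 𝓘(ℝ, E) ∞ N]
  {V : Type*} [NormedAddCommGroup V] [NormedSpace ℝ V]

/-- Read in the chart at `x₀`, this field is the constant `v`. -/
theorem contMDiffAt_mfderiv_extChartAt_symm {x₀ : N} {z : E}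
    (hz : z ∈ (extChartAt 𝓘(ℝ, E) x₀).target) (v : E) :
    ContMDiffAt 𝓘(ℝ, E) 𝓘(ℝ, E).tangent ∞ (fun z => (⟨(extChartAt 𝓘(ℝ, E) x₀).symm z,
      mfderiv 𝓘(ℝ, E) 𝓘(ℝ, E) (extChartAt 𝓘(ℝ, E) x₀).symm z v⟩ : TangentBundle 𝓘(ℝ, E) N)) z := by
  refine (contMDiffAt_tangentBundle_iff (x₀ := x₀) (by simp)
    ((extChartAt 𝓘(ℝ, E) x₀).map_target hz)).2 ⟨contMDiffAt_extChartAt_symm hz, ?_⟩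
  refine (contMDiffAt_const (c := v)).congr_of_eventuallyEq ?_
  filter_upwards [(isOpen_extChartAt_target x₀).mem_nhds hz] with y hy
  exact mfderiv_extChartAt_mfderiv_extChartAt_symm hy v

theorem SmoothOneForm.contMDiffAt_apply {α : ∀ x : N, TangentSpace 𝓘(ℝ, E) x →L[ℝ] V}
    (hα : SmoothOneForm α) {F H : Type*} [NormedAddCommGroup F] [NormedSpace ℝ F]
    [TopologicalSpace H] {J : ModelWithCorners ℝ F H} {N' : Type*} [TopologicalSpace N']
    [ChartedSpace H N'] {w : N' → TangentBundle 𝓘(ℝ, E) N} {a : N'}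
    (hw : ContMDiffAt J 𝓘(ℝ, E).tangent ∞ w a) :
    ContMDiffAt J 𝓘(ℝ, V) ∞ (fun b => α (w b).1 (w b).2) a := by
  have hb : ContMDiffAt J 𝓘(ℝ, E) ∞ (fun b => (w b).1) a :=
    ((contMDiffAt_tangentBundle_iff (x₀ := (w a).1) (by simp) (mem_extChartAt_source _)).1 hw).1
  have h1 := ContMDiffAt.clm_bundle_apply (F₁ := E) (F₂ := V) (E₁ := fun x : N => TangentSpace 𝓘(ℝ, E) x)
    (E₂ := Bundle.Trivial N V) (b := fun b => (w b).1) (ϕ := fun b => α (w b).1)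
    (v := fun b => (w b).2) (IM := J) (IB := 𝓘(ℝ, E)) (n := ∞) (x := a)
    (ContMDiffAt.comp a (hα.contMDiffAt (x := (w a).1)) hb) hw
  exact ((contMDiffAt_totalSpace (F := V) (E := Bundle.Trivial N V)).1 h1).2

theorem SmoothOneForm.contDiffAt_localOneForm [FiniteDimensional ℝ E]
    {α : ∀ x : N, TangentSpace 𝓘(ℝ, E) x →L[ℝ] V}
    (hα : SmoothOneForm α) {x₀ : N} {z : E} (hz : z ∈ (extChartAt 𝓘(ℝ, E) x₀).target) :
    ContDiffAt ℝ ∞ (localOneForm α x₀) z := by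
  have h : ContDiffOn ℝ ∞ (localOneForm α x₀) (extChartAt 𝓘(ℝ, E) x₀).target := by
    rw [contDiffOn_clm_apply]
    intro v y hy
    refine ContDiffAt.contDiffWithinAt ?_
    rw [← contMDiffAt_iff_contDiffAt]
    exact hα.contMDiffAt_apply (contMDiffAt_mfderiv_extChartAt_symm hy v)
  exact h.contDiffAt ((isOpen_extChartAt_target x₀).mem_nhds hz)

theorem localOneForm_tderiv_extChartAt (α : ∀ x : N, TangentSpace 𝓘(ℝ, E) x →L[ℝ] V) {x₀ x : N}
    (hx : x ∈ (extChartAt 𝓘(ℝ, E) x₀).source) (v : E) :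
    localOneForm α x₀ (extChartAt 𝓘(ℝ, E) x₀ x) (tderiv E E (extChartAt 𝓘(ℝ, E) x₀) x v) =
      (α x : E →L[ℝ] V) v := by
  have h1 := mfderiv_extChartAt_symm_mfderiv_extChartAt hx v
  have h2 : ∀ y : N, y = x → (α y : E →L[ℝ] V) v = (α x : E →L[ℝ] V) v := by rintro y rfl; rfl
  refine Eq.trans ?_ (h2 _ ((extChartAt 𝓘(ℝ, E) x₀).left_inv hx))
  exact congrArg (fun u : E => (α ((extChartAt 𝓘(ℝ, E) x₀).symm
    (extChartAt 𝓘(ℝ, E) x₀ x)) : E →L[ℝ] V) u) h1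

end LocalForms

/-! ### Maps read in charts -/

section ChartRep

variable {E F : Type*} [NormedAddCommGroup E] [NormedSpace ℝ E] [NormedAddCommGroup F]
  [NormedSpace ℝ F]
  {N' N : Type*} [TopologicalSpace N'] [ChartedSpace F N'] [IsManifold 𝓘(ℝ, F) ∞ N']
  [TopologicalSpace N] [ChartedSpace E N] [IsManifold 𝓘(ℝ, E) ∞ N]

/-- The map `f` read in the charts at `x₀` and `y₀`. -/
def chartRep (x₀ : N) (y₀ : N') (f : N → N') (z : E) : F :=
  extChartAt 𝓘(ℝ, F) y₀ (f ((extChartAt 𝓘(ℝ, E) x₀).symm z))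

variable {x₀ : N} {y₀ : N'} {f : N → N'}

theorem chartRep_extChartAt {x : N} (hx : x ∈ (extChartAt 𝓘(ℝ, E) x₀).source) :
    chartRep (E := E) (F := F) x₀ y₀ f (extChartAt 𝓘(ℝ, E) x₀ x) = extChartAt 𝓘(ℝ, F) y₀ (f x) := by
  rw [chartRep, (extChartAt 𝓘(ℝ, E) x₀).left_inv hx]

theorem ContMDiffAt.contDiffAt_chartRep {n : WithTop ℕ∞} (hn : n ≤ ∞) {x : N}
    (hf : ContMDiffAt 𝓘(ℝ, E) 𝓘(ℝ, F) n f x) (hx : x ∈ (extChartAt 𝓘(ℝ, E) x₀).source)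
    (hy : f x ∈ (extChartAt 𝓘(ℝ, F) y₀).source) :
    ContDiffAt ℝ n (chartRep (E := E) (F := F) x₀ y₀ f) (extChartAt 𝓘(ℝ, E) x₀ x) := by
  rw [← contMDiffAt_iff_contDiffAt]
  have h1 := (contMDiffAt_extChartAt_symm ((extChartAt 𝓘(ℝ, E) x₀).map_source hx)).of_le hn
  have hxx := (extChartAt 𝓘(ℝ, E) x₀).left_inv hx
  have h2 := ContMDiffAt.comp (extChartAt 𝓘(ℝ, E) x₀ x) (g := f) (by rw [hxx]; exact hf) h1
  refine ContMDiffAt.comp (extChartAt 𝓘(ℝ, E) x₀ x) (g := extChartAt 𝓘(ℝ, F) y₀)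
    (f := fun z => f ((extChartAt 𝓘(ℝ, E) x₀).symm z)) ?_ h2
  rw [hxx]
  exact (contMDiffAt_extChartAt' (by simpa using hy)).of_le hn

theorem DifferentiableAt.mdifferentiableAt_of_chartRep {x : N} (hc : ContinuousAt f x)
    (hx : x ∈ (extChartAt 𝓘(ℝ, E) x₀).source) (hy : f x ∈ (extChartAt 𝓘(ℝ, F) y₀).source)
    (hf : DifferentiableAt ℝ (chartRep (E := E) (F := F) x₀ y₀ f) (extChartAt 𝓘(ℝ, E) x₀ x)) :
    MDifferentiableAt 𝓘(ℝ, E) 𝓘(ℝ, F) f x := by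
  have h1 : MDifferentiableAt 𝓘(ℝ, E) 𝓘(ℝ, F) (fun x' => (extChartAt 𝓘(ℝ, F) y₀).symm
      (chartRep (E := E) (F := F) x₀ y₀ f (extChartAt 𝓘(ℝ, E) x₀ x'))) x := by
    refine MDifferentiableAt.comp x (g := (extChartAt 𝓘(ℝ, F) y₀).symm) (I' := 𝓘(ℝ, F)) ?_
      (MDifferentiableAt.comp x (I' := 𝓘(ℝ, E)) (g := chartRep (E := E) (F := F) x₀ y₀ f)
        (f := extChartAt 𝓘(ℝ, E) x₀) hf.mdifferentiableAt
        (mdifferentiableAt_extChartAt_of_mem hx))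
    apply mdifferentiableAt_extChartAt_symm
    rw [chartRep_extChartAt hx]
    exact (extChartAt 𝓘(ℝ, F) y₀).map_source hy
  refine h1.congr_of_eventuallyEq ?_
  filter_upwards [(isOpen_extChartAt_source x₀).mem_nhds hx,
    hc.preimage_mem_nhds ((isOpen_extChartAt_source y₀).mem_nhds hy)] with x' hx' hy'
  rw [chartRep_extChartAt hx', (extChartAt 𝓘(ℝ, F) y₀).left_inv hy']

theorem ContDiffAt.contMDiffAt_of_chartRep {n : WithTop ℕ∞} (hn : n ≤ ∞) {x : N}
    (hc : ContinuousAt f x)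
    (hx : x ∈ (extChartAt 𝓘(ℝ, E) x₀).source) (hy : f x ∈ (extChartAt 𝓘(ℝ, F) y₀).source)
    (hf : ContDiffAt ℝ n (chartRep (E := E) (F := F) x₀ y₀ f) (extChartAt 𝓘(ℝ, E) x₀ x)) :
    ContMDiffAt 𝓘(ℝ, E) 𝓘(ℝ, F) n f x := by
  have h1 : ContMDiffAt 𝓘(ℝ, E) 𝓘(ℝ, F) n (fun x' => (extChartAt 𝓘(ℝ, F) y₀).symm
      (chartRep (E := E) (F := F) x₀ y₀ f (extChartAt 𝓘(ℝ, E) x₀ x'))) x := by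
    refine ContMDiffAt.comp x (g := (extChartAt 𝓘(ℝ, F) y₀).symm) (I' := 𝓘(ℝ, F)) ?_
      (ContMDiffAt.comp x (I' := 𝓘(ℝ, E)) (g := chartRep (E := E) (F := F) x₀ y₀ f)
        (f := extChartAt 𝓘(ℝ, E) x₀) hf.contMDiffAt
        ((contMDiffAt_extChartAt' (by simpa using hx)).of_le hn))
    refine (contMDiffAt_extChartAt_symm ?_).of_le hn
    rw [chartRep_extChartAt hx]
    exact (extChartAt 𝓘(ℝ, F) y₀).map_source hy
  refine h1.congr_of_eventuallyEq ?_
  filter_upwards [(isOpen_extChartAt_source x₀).mem_nhds hx,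
    hc.preimage_mem_nhds ((isOpen_extChartAt_source y₀).mem_nhds hy)] with x' hx' hy'
  rw [chartRep_extChartAt hx', (extChartAt 𝓘(ℝ, F) y₀).left_inv hy']

theorem MDifferentiableAt.differentiableAt_chartRep {x : N}
    (hf : MDifferentiableAt 𝓘(ℝ, E) 𝓘(ℝ, F) f x) (hx : x ∈ (extChartAt 𝓘(ℝ, E) x₀).source)
    (hy : f x ∈ (extChartAt 𝓘(ℝ, F) y₀).source) :
    DifferentiableAt ℝ (chartRep (E := E) (F := F) x₀ y₀ f) (extChartAt 𝓘(ℝ, E) x₀ x) := by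
  rw [← mdifferentiableAt_iff_differentiableAt]
  have h1 := mdifferentiableAt_extChartAt_symm ((extChartAt 𝓘(ℝ, E) x₀).map_source hx)
  have hxx := (extChartAt 𝓘(ℝ, E) x₀).left_inv hx
  have h2 := MDifferentiableAt.comp (extChartAt 𝓘(ℝ, E) x₀ x) (g := f) (by rw [hxx]; exact hf) h1
  refine MDifferentiableAt.comp (extChartAt 𝓘(ℝ, E) x₀ x) (g := extChartAt 𝓘(ℝ, F) y₀)
    (f := fun z => f ((extChartAt 𝓘(ℝ, E) x₀).symm z)) ?_ h2
  rw [hxx]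
  exact mdifferentiableAt_extChartAt_of_mem hy

theorem fderiv_chartRep_tderiv {x : N}
    (hf : MDifferentiableAt 𝓘(ℝ, E) 𝓘(ℝ, F) f x) (hx : x ∈ (extChartAt 𝓘(ℝ, E) x₀).source)
    (hy : f x ∈ (extChartAt 𝓘(ℝ, F) y₀).source) (v : E) :
    fderiv ℝ (chartRep (E := E) (F := F) x₀ y₀ f) (extChartAt 𝓘(ℝ, E) x₀ x)
      (tderiv E E (extChartAt 𝓘(ℝ, E) x₀) x v) =
    tderiv F F (extChartAt 𝓘(ℝ, F) y₀) (f x) (tderiv E F f x v) := by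
  have h1 := tderiv_comp (g := extChartAt 𝓘(ℝ, F) y₀) (mdifferentiableAt_extChartAt_of_mem hy) hf v
  have h2 := tderiv_comp (g := chartRep (E := E) (F := F) x₀ y₀ f)
    (f := extChartAt 𝓘(ℝ, E) x₀) (x := x)
    (MDifferentiableAt.differentiableAt_chartRep hf hx hy).mdifferentiableAt
    (mdifferentiableAt_extChartAt_of_mem hx) v
  have h3 : (fun x' => chartRep (E := E) (F := F) x₀ y₀ f (extChartAt 𝓘(ℝ, E) x₀ x')) =ᶠ[𝓝 x]
      fun x' => extChartAt 𝓘(ℝ, F) y₀ (f x') := by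
    filter_upwards [(isOpen_extChartAt_source x₀).mem_nhds hx] with x' hx'
    exact chartRep_extChartAt hx'
  rw [tderiv_congr h3, h1] at h2
  rw [h2]
  exact congrArg (fun L : E →L[ℝ] F => L _) mfderiv_eq_fderiv.symm

theorem tderiv_extChartAt_bijective {x : N} (hx : x ∈ (extChartAt 𝓘(ℝ, E) x₀).source) :
    Function.Bijective (tderiv E E (extChartAt 𝓘(ℝ, E) x₀) x) := by
  constructor
  · intro v w h
    have h1 := mfderiv_extChartAt_symm_mfderiv_extChartAt hx v
    have h2 := mfderiv_extChartAt_symm_mfderiv_extChartAt hx w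
    rw [← h1, ← h2]
    exact congrArg (fun u : E => tderiv E E (extChartAt 𝓘(ℝ, E) x₀).symm
      (extChartAt 𝓘(ℝ, E) x₀ x) u) h
  · intro v
    have h := mfderiv_extChartAt_mfderiv_extChartAt_symm
      ((extChartAt 𝓘(ℝ, E) x₀).map_source hx) v
    refine ⟨tderiv E E (extChartAt 𝓘(ℝ, E) x₀).symm (extChartAt 𝓘(ℝ, E) x₀ x) v, ?_⟩
    have h2 : ∀ y : N, y = x → tderiv E E (extChartAt 𝓘(ℝ, E) x₀) y
      (tderiv E E (extChartAt 𝓘(ℝ, E) x₀).symm (extChartAt 𝓘(ℝ, E) x₀ x) v) =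
      tderiv E E (extChartAt 𝓘(ℝ, E) x₀) x
      (tderiv E E (extChartAt 𝓘(ℝ, E) x₀).symm (extChartAt 𝓘(ℝ, E) x₀ x) v) := by rintro y rfl; rfl
    exact (h2 _ ((extChartAt 𝓘(ℝ, E) x₀).left_inv hx)).symm.trans h

end ChartRep

/-! ### The connection in charts -/

section Connection

variable {EP EM EG : Type*} [NormedAddCommGroup EP] [NormedSpace ℝ EP]
  [NormedAddCommGroup EM] [NormedSpace ℝ EM] [NormedAddCommGroup EG] [NormedSpace ℝ EG]
  {P M G : Type*} [TopologicalSpace P] [ChartedSpace EP P] [IsManifold 𝓘(ℝ, EP) ∞ P]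
  [TopologicalSpace M] [ChartedSpace EM M] [IsManifold 𝓘(ℝ, EM) ∞ M]
  [TopologicalSpace G] [ChartedSpace EG G] [Group G] [LieGroup 𝓘(ℝ, EG) ∞ G]

namespace Connection

variable {Q : PrincipalBundle (EP := EP) (EM := EM) (EG := EG) P M G} (A : Connection Q)

/-- The connection form read in the chart at `p₀`. -/
def localForm (p₀ : P) : EP → EP →L[ℝ] EG := localOneForm (V := EG) A.form p₀

theorem localForm_tderiv {p₀ p : P} (hp : p ∈ (extChartAt 𝓘(ℝ, EP) p₀).source) (v : EP) :
    A.localForm p₀ (extChartAt 𝓘(ℝ, EP) p₀ p) (tderiv EP EP (extChartAt 𝓘(ℝ, EP) p₀) p v) =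
      A.formAt p v :=
  localOneForm_tderiv_extChartAt (V := EG) A.form hp v

theorem contDiffAt_localForm [FiniteDimensional ℝ EP] {p₀ : P} {z : EP}
    (hz : z ∈ (extChartAt 𝓘(ℝ, EP) p₀).target) : ContDiffAt ℝ ∞ (A.localForm p₀) z :=
  A.smooth_form.contDiffAt_localOneForm hz

/-- The isomorphism `frame` read in the charts at `p₀` and `x₀`. -/
def localFrame (p₀ : P) (x₀ : M) (z : EP) : EP →L[ℝ] EM × EG :=
  (fderiv ℝ (chartRep (E := EP) (F := EM) p₀ x₀ Q.proj) z).prod (A.localForm p₀ z)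

/-- The inverse of `localFrame`. -/
def localCoframe (p₀ : P) (x₀ : M) (z : EP) : EM × EG →L[ℝ] EP := (A.localFrame p₀ x₀ z).inverse

variable {p₀ p : P} {x₀ : M}

theorem localFrame_tderiv (hp : p ∈ (extChartAt 𝓘(ℝ, EP) p₀).source)
    (hx : Q.proj p ∈ (extChartAt 𝓘(ℝ, EM) x₀).source) (v : EP) :
    A.localFrame p₀ x₀ (extChartAt 𝓘(ℝ, EP) p₀ p) (tderiv EP EP (extChartAt 𝓘(ℝ, EP) p₀) p v) =
      (tderiv EM EM (extChartAt 𝓘(ℝ, EM) x₀) (Q.proj p) (tderiv EP EM Q.proj p v),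
        A.formAt p v) := by
  rw [localFrame, ContinuousLinearMap.prod_apply, localForm_tderiv A hp,
    fderiv_chartRep_tderiv (Q.mdiff_proj p) hp hx]

variable [FiniteDimensional ℝ EP]

theorem localFrame_isInvertible (hp : p ∈ (extChartAt 𝓘(ℝ, EP) p₀).source)
    (hx : Q.proj p ∈ (extChartAt 𝓘(ℝ, EM) x₀).source) :
    (A.localFrame p₀ x₀ (extChartAt 𝓘(ℝ, EP) p₀ p)).IsInvertible := by
  have hb : Function.Bijective (A.localFrame p₀ x₀ (extChartAt 𝓘(ℝ, EP) p₀ p)) := by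
    constructor
    · rw [injective_iff_map_eq_zero]
      intro v hv
      obtain ⟨v, rfl⟩ := (tderiv_extChartAt_bijective hp).2 v
      rw [localFrame_tderiv A hp hx, Prod.mk_eq_zero] at hv
      have h1 := (tderiv_extChartAt_bijective hx).1 (hv.1.trans (map_zero _).symm)
      have : v = 0 := (A.frame_bijective p).1 (by rw [frame_apply, h1, hv.2, map_zero]; rfl)
      rw [this, map_zero]
    · rintro ⟨u, a⟩
      obtain ⟨u, rfl⟩ := (tderiv_extChartAt_bijective hx).2 u
      obtain ⟨v, hv⟩ := (A.frame_bijective p).2 (u, a)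
      rw [frame_apply, Prod.mk.injEq] at hv
      exact ⟨tderiv EP EP (extChartAt 𝓘(ℝ, EP) p₀) p v, by
        rw [localFrame_tderiv A hp hx, hv.1, hv.2]⟩
  have : FiniteDimensional ℝ (EM × EG) := Module.Finite.of_surjective
    (A.localFrame p₀ x₀ (extChartAt 𝓘(ℝ, EP) p₀ p)).toLinearMap hb.2
  exact ⟨(LinearEquiv.ofBijective (A.localFrame p₀ x₀ (extChartAt 𝓘(ℝ, EP) p₀ p)).toLinearMap
    hb).toContinuousLinearEquiv, by ext v <;> rfl⟩

theorem tderiv_coframe (hp : p ∈ (extChartAt 𝓘(ℝ, EP) p₀).source)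
    (hx : Q.proj p ∈ (extChartAt 𝓘(ℝ, EM) x₀).source) (u : EM) (a : EG) :
    tderiv EP EP (extChartAt 𝓘(ℝ, EP) p₀) p (A.coframe p (u, a)) =
      A.localCoframe p₀ x₀ (extChartAt 𝓘(ℝ, EP) p₀ p)
        (tderiv EM EM (extChartAt 𝓘(ℝ, EM) x₀) (Q.proj p) u, a) := by
  obtain ⟨v, hv⟩ := (A.frame_bijective p).2 (u, a)
  have hv' : tderiv EP EM Q.proj p v = u ∧ A.formAt p v = a := by
    rwa [frame_apply, Prod.mk.injEq] at hv
  rw [← A.eq_coframe hv, ← hv'.1, ← hv'.2, ← localFrame_tderiv A hp hx, localCoframe,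
    (A.localFrame_isInvertible hp hx).inverse_apply_self]

theorem contDiffAt_localFrame (hp : p ∈ (extChartAt 𝓘(ℝ, EP) p₀).source)
    (hx : Q.proj p ∈ (extChartAt 𝓘(ℝ, EM) x₀).source) :
    ContDiffAt ℝ ∞ (A.localFrame p₀ x₀) (extChartAt 𝓘(ℝ, EP) p₀ p) := by
  have h1 := (ContMDiffAt.contDiffAt_chartRep le_rfl (Q.smooth_proj p) hp hx).fderiv_right
    (m := ∞) (by simp)
  exact (ContinuousLinearMap.prodₗᵢ (𝕜 := ℝ) (E := EP) (F := EM) (G := EG)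
    ℝ).contDiff.contDiffAt.comp _
    (h1.prodMk (A.contDiffAt_localForm ((extChartAt 𝓘(ℝ, EP) p₀).map_source hp)))

theorem contDiffAt_localCoframe (hp : p ∈ (extChartAt 𝓘(ℝ, EP) p₀).source)
    (hx : Q.proj p ∈ (extChartAt 𝓘(ℝ, EM) x₀).source) :
    ContDiffAt ℝ ∞ (A.localCoframe p₀ x₀) (extChartAt 𝓘(ℝ, EP) p₀ p) := by
  have : CompleteSpace EP := FiniteDimensional.complete ℝ EP
  exact (A.localFrame_isInvertible hp hx).contDiffAt_map_inverse.comp _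
    (A.contDiffAt_localFrame hp hx)

/-- In charts `coframe` is the inverse of a smooth family of invertible operators, hence smooth.
Smoothness of horizontal lifts and of fundamental vector fields both come from here. -/
theorem contMDiffAt_coframe {F H : Type*} [NormedAddCommGroup F] [NormedSpace ℝ F]
    [TopologicalSpace H] {J : ModelWithCorners ℝ F H} {N' : Type*} [TopologicalSpace N']
    [ChartedSpace H N'] {f : N' → P} {w : N' → TangentBundle 𝓘(ℝ, EM) M} {c : N' → EG} {a : N'}
    (hf : ContMDiffAt J 𝓘(ℝ, EP) ∞ f a) (hw : ContMDiffAt J 𝓘(ℝ, EM).tangent ∞ w a)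
    (hc : ContMDiffAt J 𝓘(ℝ, EG) ∞ c a) (hwf : ∀ b, (w b).1 = Q.proj (f b)) :
    ContMDiffAt J 𝓘(ℝ, EP).tangent ∞ (fun b => (⟨f b, A.coframe (f b)
      (((w b).2 : EM), c b)⟩ : TangentBundle 𝓘(ℝ, EP) P)) a := by
  have hp : f a ∈ (extChartAt 𝓘(ℝ, EP) (f a)).source := mem_extChartAt_source _
  have hx : Q.proj (f a) ∈ (extChartAt 𝓘(ℝ, EM) (Q.proj (f a))).source := mem_extChartAt_source _
  refine (contMDiffAt_tangentBundle_iff (x₀ := f a) (by simp) hp).2 ⟨hf, ?_⟩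
  have hw2 := ((contMDiffAt_tangentBundle_iff (x₀ := Q.proj (f a)) (by simp)
    (by rw [hwf]; exact hx)).1 hw).2
  have hS : ContMDiffAt J 𝓘(ℝ, EM × EG →L[ℝ] EP) ∞
      (fun b => A.localCoframe (f a) (Q.proj (f a)) (extChartAt 𝓘(ℝ, EP) (f a) (f b))) a :=
    ContMDiffAt.comp a (I' := 𝓘(ℝ, EP)) (g := A.localCoframe (f a) (Q.proj (f a)))
      (f := fun b => extChartAt 𝓘(ℝ, EP) (f a) (f b))
      (A.contDiffAt_localCoframe hp hx).contMDiffAt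
      (ContMDiffAt.comp a (I' := 𝓘(ℝ, EP)) (contMDiffAt_extChartAt' (by simp)) hf)
  have hprod : ContMDiffAt J 𝓘(ℝ, EM × EG) ∞
      (fun b => (tangentCoord (Q.proj (f a)) (w b), c b)) a := hw2.prodMk_space hc
  refine (hS.clm_apply hprod).congr_of_eventuallyEq ?_
  filter_upwards [hf.continuousAt.preimage_mem_nhds ((isOpen_extChartAt_source _).mem_nhds hp),
    (Q.smooth_proj.continuous.continuousAt.comp hf.continuousAt).preimage_mem_nhds
      ((isOpen_extChartAt_source _).mem_nhds hx)] with b hb hb'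
  refine (A.tderiv_coframe (x₀ := Q.proj (f a)) hb hb' _ _).trans ?_
  have h2 : ∀ y : M, y = Q.proj (f b) → ∀ u : EM,
      tderiv EM EM (extChartAt 𝓘(ℝ, EM) (Q.proj (f a))) (Q.proj (f b)) u =
      tderiv EM EM (extChartAt 𝓘(ℝ, EM) (Q.proj (f a))) y u := by rintro y rfl u; rfl
  exact congrArg (fun u : EM => A.localCoframe (f a) (Q.proj (f a))
    (extChartAt 𝓘(ℝ, EP) (f a) (f b)) (u, c b)) (h2 _ (hwf b) _)

/-- The horizontal lift of a smooth family of vector fields is smooth. -/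
theorem smoothFamily_hlift {Y : Type*} [NormedAddCommGroup Y] [NormedSpace ℝ Y]
    {V : Y → ∀ x : M, TangentSpace 𝓘(ℝ, EM) x} (hV : SmoothFamily V) :
    SmoothFamily (fun y p => A.hlift p (V y (Q.proj p)) :
      Y → ∀ p : P, TangentSpace 𝓘(ℝ, EP) p) := by
  rintro ⟨y, p⟩
  have h1 : ContMDiff (𝓘(ℝ, Y).prod 𝓘(ℝ, EP)) (𝓘(ℝ, Y).prod 𝓘(ℝ, EM)) ∞
      (fun q : Y × P => (q.1, Q.proj q.2)) :=
    contMDiff_fst.prodMk (Q.smooth_proj.comp contMDiff_snd)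
  exact A.contMDiffAt_coframe (f := fun q : Y × P => q.2)
    (w := fun q : Y × P => ⟨Q.proj q.2, V q.1 (Q.proj q.2)⟩) (c := fun _ => 0)
    contMDiffAt_snd (ContMDiffAt.comp (y, p) (hV.contMDiffAt (x := (y, Q.proj p)))
      (h1.contMDiffAt)) contMDiffAt_const (fun _ => rfl)

theorem smoothVectorField_hlift {X : ∀ x : M, TangentSpace 𝓘(ℝ, EM) x}
    (hX : SmoothVectorField X) :
    SmoothVectorField (fun p => A.hlift p (X (Q.proj p)) : ∀ p : P, TangentSpace 𝓘(ℝ, EP) p) :=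
  fun p => A.contMDiffAt_coframe (f := fun q : P => q)
    (w := fun q : P => ⟨Q.proj q, X (Q.proj q)⟩) (c := fun _ => 0)
    contMDiffAt_id (ContMDiffAt.comp p (hX.contMDiffAt (x := Q.proj p))
      (Q.smooth_proj p)) contMDiffAt_const (fun _ => rfl)

end Connection

end Connection

/-! ### Curves of small speed stay in a chart. -/

section Trapping

variable {F : Type*} [NormedAddCommGroup F] [NormedSpace ℝ F] [FiniteDimensional ℝ F]
  {N : Type*} [TopologicalSpace N] [ChartedSpace F N] [T2Space N]

/-- A curve starting near the centre of a chart and with small speed in the chart stays there. -/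
theorem norm_extChartAt_sub_le_of_norm_deriv_le {c : ℝ → N}
    (hc : ∀ t ∈ Set.Icc (0 : ℝ) 1, ContinuousAt c t) {y₀ : N} {ρ K : ℝ}
    (hρ : Metric.closedBall (extChartAt 𝓘(ℝ, F) y₀ y₀) ρ ⊆ (extChartAt 𝓘(ℝ, F) y₀).target)
    (h0 : c 0 ∈ (extChartAt 𝓘(ℝ, F) y₀).source)
    (h0' : dist (extChartAt 𝓘(ℝ, F) y₀ (c 0)) (extChartAt 𝓘(ℝ, F) y₀ y₀) < ρ / 2) (hK : K < ρ / 2)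
    (hK0 : 0 ≤ K)
    (hd : ∀ t ∈ Set.Icc (0 : ℝ) 1, c t ∈ (extChartAt 𝓘(ℝ, F) y₀).source →
      dist (extChartAt 𝓘(ℝ, F) y₀ (c t)) (extChartAt 𝓘(ℝ, F) y₀ y₀) < ρ →
      ∃ d, HasDerivAt (fun s => extChartAt 𝓘(ℝ, F) y₀ (c s)) d t ∧ ‖d‖ ≤ K) :
    c 1 ∈ (extChartAt 𝓘(ℝ, F) y₀).source ∧
      dist (extChartAt 𝓘(ℝ, F) y₀ (c 1)) (extChartAt 𝓘(ℝ, F) y₀ (c 0)) ≤ K := by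
  set κ := extChartAt 𝓘(ℝ, F) y₀ with hκ
  set B := Metric.closedBall (κ y₀) ρ with hB
  have hcl : IsClosed (κ.symm '' B) :=
    ((isCompact_closedBall _ _).image_of_continuousOn
      ((continuousOn_extChartAt_symm y₀).mono hρ)).isClosed
  have hmem : ∀ q, q ∈ κ.symm '' B ↔ q ∈ κ.source ∧ κ q ∈ B := by
    intro q
    constructor
    · rintro ⟨w, hw, rfl⟩
      exact ⟨κ.map_target (hρ hw), by rwa [κ.right_inv (hρ hw)]⟩
    · rintro ⟨h1, h2⟩
      exact ⟨κ q, h2, κ.left_inv h1⟩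
  set s : Set ℝ := {t | c t ∈ κ.symm '' B ∧ dist (κ (c t)) (κ (c 0)) ≤ K * t} with hs
  have hκc : ∀ t ∈ Set.Icc (0 : ℝ) 1, c t ∈ κ.source → ContinuousAt (fun s => κ (c s)) t :=
    fun t ht ht' =>
    ContinuousAt.comp (f := c) (continuousAt_extChartAt' (by simpa [hκ] using ht')) (hc t ht)
  -- Continuous induction. `s` is closed in the interval because the image of the compact ball is
  -- closed in `N`; it extends to the right of `t` because the distance to the centre is less than
  -- `ρ / 2 + K < ρ`.
  have hsub : Set.Icc (0 : ℝ) 1 ⊆ s := by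
    refine IsClosed.Icc_subset_of_forall_mem_nhdsWithin ?_ ?_ ?_
    · refine isClosed_of_closure_subset fun t ht => ?_
      have ht1 : t ∈ Set.Icc (0 : ℝ) 1 :=
        closure_minimal Set.inter_subset_right isClosed_Icc ht
      have : (𝓝[s ∩ Set.Icc 0 1] t).NeBot := mem_closure_iff_nhdsWithin_neBot.1 ht
      have ht2 : c t ∈ κ.symm '' B :=
        hcl.mem_of_tendsto ((hc t ht1).mono_left nhdsWithin_le_nhds)
          (Filter.eventually_of_mem (U := s ∩ Set.Icc 0 1) self_mem_nhdsWithin fun u hu => hu.1.1)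
      refine ⟨⟨ht2, ?_⟩, ht1⟩
      have hcont := hκc t ht1 ((hmem _).1 ht2).1
      refine le_of_tendsto_of_tendsto (b := 𝓝[s ∩ Set.Icc 0 1] t)
        ((hcont.mono_left nhdsWithin_le_nhds).dist tendsto_const_nhds)
        ((continuous_const.mul continuous_id).continuousAt.mono_left nhdsWithin_le_nhds) ?_
      filter_upwards [self_mem_nhdsWithin] with u hu
      exact hu.1.2
    · refine ⟨(hmem _).2 ⟨h0, ?_⟩, by simp⟩
      have := dist_nonneg.trans_lt h0'
      exact Metric.mem_closedBall.2 (by linarith)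
    · rintro t ⟨⟨ht1, ht2⟩, ht3⟩
      have hsrc := ((hmem _).1 ht1).1
      have hlt : dist (κ (c t)) (κ y₀) < ρ := by
        have h1 := dist_triangle (κ (c t)) (κ (c 0)) (κ y₀)
        have h2 : K * t ≤ K := by nlinarith [ht3.1, ht3.2]
        linarith
      have hopen : ∀ᶠ u in 𝓝 t, c u ∈ κ.source ∧ dist (κ (c u)) (κ y₀) < ρ :=
        ((hc t ⟨ht3.1, ht3.2.le⟩).eventually_mem
          ((isOpen_extChartAt_source y₀).mem_nhds hsrc)).and
          ((hκc t ⟨ht3.1, ht3.2.le⟩ hsrc).eventually_mem (Metric.isOpen_ball.mem_nhds hlt))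
      obtain ⟨δ, hδ, hball⟩ := Metric.eventually_nhds_iff_ball.1 hopen
      have hδ' : t < min (t + δ) 1 := lt_min (by linarith) ht3.2
      filter_upwards [Ioo_mem_nhdsGT hδ'] with u hu
      have hu1 : u < t + δ := hu.2.trans_le (min_le_left _ _)
      have hu2 : u < 1 := hu.2.trans_le (min_le_right _ _)
      have hin : ∀ v ∈ Set.Icc t u, c v ∈ κ.source ∧ dist (κ (c v)) (κ y₀) < ρ := fun v hv =>
        hball v (by rw [Metric.mem_ball, Real.dist_eq, abs_lt]; constructor <;>
          linarith [hv.1, hv.2])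
      have hder : ∀ v ∈ Set.Icc t u, ∃ d, HasDerivAt (fun s => κ (c s)) d v ∧ ‖d‖ ≤ K := fun v hv =>
        hd v ⟨ht3.1.trans hv.1, hv.2.trans hu2.le⟩ (hin v hv).1 (hin v hv).2
      have hut : u ∈ Set.Icc t u := ⟨hu.1.le, le_rfl⟩
      have hmv : ‖κ (c u) - κ (c t)‖ ≤ K * ‖u - t‖ :=
        (convex_Icc t u).norm_image_sub_le_of_norm_hasDerivWithin_le
          (f := fun s => κ (c s)) (f' := fun v => deriv (fun s => κ (c s)) v)
          (fun v hv => by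
            obtain ⟨d, h1, -⟩ := hder v hv
            exact h1.differentiableAt.hasDerivAt.hasDerivWithinAt)
          (fun v hv => by
            obtain ⟨d, h1, h2⟩ := hder v hv
            rw [h1.deriv]; exact h2) (show t ∈ Set.Icc t u from ⟨le_rfl, hu.1.le⟩) hut
      refine ⟨(hmem _).2 ⟨(hin u hut).1, Metric.mem_closedBall.2 (hin u hut).2.le⟩, ?_⟩
      have h1 := dist_triangle (κ (c u)) (κ (c t)) (κ (c 0))
      rw [dist_eq_norm (κ (c u)) (κ (c t))] at h1
      rw [Real.norm_of_nonneg (by linarith [hu.1])] at hmv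
      nlinarith
  have h1 := hsub (show (1 : ℝ) ∈ Set.Icc (0 : ℝ) 1 by simp)
  exact ⟨((hmem _).1 h1.1).1, by simpa using h1.2⟩

end Trapping

/-! ### Uniform bounds on the differentials of isometries. -/

section IsometryBound

variable {E : Type*} [NormedAddCommGroup E] [NormedSpace ℝ E]
  {M : Type*} [TopologicalSpace M] [ChartedSpace E M] [IsManifold 𝓘(ℝ, E) ∞ M]

/-- For the fibre norms defined by a continuous metric, the trivialization of the tangent bundle at
`x₀` and its inverse have locally bounded operator norms. -/
theorem exists_metric_bounds
    (g : ContMDiffRiemannianMetric 𝓘(ℝ, E) ∞ E (fun x : M => TangentSpace 𝓘(ℝ, E) x)) (x₀ : M) :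
    ∃ C > 0, ∀ᶠ x in 𝓝 x₀, ∀ v : E,
      ‖tderiv E E (extChartAt 𝓘(ℝ, E) x₀) x v‖ ≤ C * √((g.inner x : E →L[ℝ] E →L[ℝ] ℝ) v v) ∧
      √((g.inner x : E →L[ℝ] E →L[ℝ] ℝ) v v) ≤ C * ‖tderiv E E (extChartAt 𝓘(ℝ, E) x₀) x v‖ := by
  let _ : RiemannianBundle (fun x : M => TangentSpace 𝓘(ℝ, E) x) := ⟨g.toRiemannianMetric⟩
  have hcont : IsContinuousRiemannianBundle E (fun x : M => TangentSpace 𝓘(ℝ, E) x) :=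
    ⟨⟨g.inner, g.contMDiff.continuous, fun _ _ _ => rfl⟩⟩
  have hnorm : ∀ (x : M) (v : TangentSpace 𝓘(ℝ, E) x),
      ‖v‖ = √((g.inner x : E →L[ℝ] E →L[ℝ] ℝ) v v) := fun x v => norm_eq_sqrt_real_inner v
  obtain ⟨C₁, hC₁, h1⟩ :=
    eventually_norm_trivializationAt_lt E (fun x : M => TangentSpace 𝓘(ℝ, E) x) x₀
  obtain ⟨C₂, hC₂, h2⟩ :=
    eventually_norm_symmL_trivializationAt_lt E (fun x : M => TangentSpace 𝓘(ℝ, E) x) x₀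
  have hsrc : (chartAt E x₀).source ∈ 𝓝 x₀ := chart_source_mem_nhds E x₀
  refine ⟨max C₁ C₂, lt_max_of_lt_left hC₁, ?_⟩
  filter_upwards [h1, h2, hsrc] with x h1 h2 hx v
  have hL := TangentBundle.continuousLinearMapAt_trivializationAt (I := 𝓘(ℝ, E)) (𝕜 := ℝ) hx
  have hLv : (trivializationAt E (TangentSpace 𝓘(ℝ, E)) x₀).continuousLinearMapAt ℝ x v =
      tderiv E E (extChartAt 𝓘(ℝ, E) x₀) x v :=
    congrArg (fun L : TangentSpace 𝓘(ℝ, E) x →L[ℝ] E => L v) hL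
  have hb : x ∈ (trivializationAt E (TangentSpace 𝓘(ℝ, E)) x₀).baseSet := by simpa using hx
  have hsymm : (trivializationAt E (TangentSpace 𝓘(ℝ, E)) x₀).symmL ℝ x
      (tderiv E E (extChartAt 𝓘(ℝ, E) x₀) x v) = v := by
    rw [← hLv]
    exact Trivialization.symmL_continuousLinearMapAt _ hb v
  constructor
  · rw [← hLv, ← hnorm x v]
    exact (ContinuousLinearMap.le_opNorm _ _).trans
      (mul_le_mul_of_nonneg_right (h1.le.trans (le_max_left _ _)) (norm_nonneg _))
  · rw [← hnorm x v]
    refine (congrArg norm hsymm).symm.le.trans ((ContinuousLinearMap.le_opNorm _ _).trans ?_)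
    gcongr
    exact h2.le.trans (le_max_right _ _)

/-- The derivatives of isometries are bounded, uniformly in the isometry. -/
theorem exists_bound_tderiv_isometry
    (g : ContMDiffRiemannianMetric 𝓘(ℝ, E) ∞ E (fun x : M => TangentSpace 𝓘(ℝ, E) x)) (x₀ y₀ : M) :
    ∃ C > 0, ∃ U ∈ 𝓝 x₀, ∃ W ∈ 𝓝 y₀, ∀ φ : M → M, ∀ x ∈ U, φ x ∈ W →
      (∀ v : E, (g.inner (φ x) : E →L[ℝ] E →L[ℝ] ℝ) (tderiv E E φ x v) (tderiv E E φ x v) =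
        (g.inner x : E →L[ℝ] E →L[ℝ] ℝ) v v) →
      ∀ v : E, ‖tderiv E E (extChartAt 𝓘(ℝ, E) y₀) (φ x) (tderiv E E φ x v)‖ ≤
        C * ‖tderiv E E (extChartAt 𝓘(ℝ, E) x₀) x v‖ := by
  obtain ⟨C₁, hC₁, h1⟩ := exists_metric_bounds g x₀
  obtain ⟨C₂, hC₂, h2⟩ := exists_metric_bounds g y₀
  refine ⟨C₂ * C₁, by positivity, _, h1, _, h2, fun φ x hx hφx hφ v => ?_⟩
  have e1 := (hφx (tderiv E E φ x v)).1
  rw [hφ] at e1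
  refine e1.trans ?_
  rw [mul_assoc]
  gcongr
  exact (hx v).2

end IsometryBound

theorem exists_ball_of_eventually_prod {ι F : Type*} [PseudoMetricSpace F] {l : Filter ι} {z₀ : F}
    {R : ι → F → Prop} (h : ∀ᶠ q : ι × F in l ×ˢ 𝓝 z₀, R q.1 q.2) :
    ∃ r > 0, ∀ᶠ i in l, ∀ z ∈ Metric.ball z₀ r, R i z := by
  obtain ⟨pa, ha, pb, hb, hab⟩ := Filter.eventually_prod_iff.1 h
  obtain ⟨r, hr, hball⟩ := Metric.eventually_nhds_iff_ball.1 hb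
  exact ⟨r, hr, ha.mono fun i hi z hz => hab hi (hball z hz)⟩

/-! ### Limits of connection-preserving maps that cover isometries. -/

section Limits

variable {EP EM EG : Type*} [NormedAddCommGroup EP] [NormedSpace ℝ EP]
  [NormedAddCommGroup EM] [NormedSpace ℝ EM] [NormedAddCommGroup EG] [NormedSpace ℝ EG]
  {P M G : Type*} [TopologicalSpace P] [ChartedSpace EP P] [IsManifold 𝓘(ℝ, EP) ∞ P]
  [TopologicalSpace M] [ChartedSpace EM M] [IsManifold 𝓘(ℝ, EM) ∞ M]
  [TopologicalSpace G] [ChartedSpace EG G] [Group G] [LieGroup 𝓘(ℝ, EG) ∞ G]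
  {Q : PrincipalBundle (EP := EP) (EM := EM) (EG := EG) P M G}

namespace Connection

variable (A : Connection Q)

/-- The map `ψ` preserves the connection form at `p`. -/
def PreservesAt (ψ : P → P) (p : P) : Prop :=
  ∀ v : EP, A.formAt (ψ p) (tderiv EP EP ψ p v) = A.formAt p v

variable [FiniteDimensional ℝ EP] {A}

/-- The differential of a map that preserves the connection and covers `φ` is determined by `φ`. -/
theorem PreservesAt.hasFDerivAt_chartRep {ψ : P → P} {φ : M → M} {p p₀ p₁ : P} {x₁ : M}
    (hψ : MDifferentiableAt 𝓘(ℝ, EP) 𝓘(ℝ, EP) ψ p) (hA : A.PreservesAt ψ p)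
    (hcov : ∀ q, Q.proj (ψ q) = φ (Q.proj q))
    (hp : p ∈ (extChartAt 𝓘(ℝ, EP) p₀).source) (hψp : ψ p ∈ (extChartAt 𝓘(ℝ, EP) p₁).source)
    (hx : Q.proj (ψ p) ∈ (extChartAt 𝓘(ℝ, EM) x₁).source) :
    HasFDerivAt (chartRep (E := EP) (F := EP) p₀ p₁ ψ)
      (A.localCoframe p₁ x₁ (chartRep (E := EP) (F := EP) p₀ p₁ ψ (extChartAt 𝓘(ℝ, EP) p₀ p)) ∘L
        (fderiv ℝ (chartRep (E := EP) (F := EM) p₀ x₁ fun q => φ (Q.proj q))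
          (extChartAt 𝓘(ℝ, EP) p₀ p)).prod (A.localForm p₀ (extChartAt 𝓘(ℝ, EP) p₀ p)))
      (extChartAt 𝓘(ℝ, EP) p₀ p) := by
  have hd := (MDifferentiableAt.differentiableAt_chartRep hψ hp hψp).hasFDerivAt
  convert hd using 1
  ext u
  obtain ⟨v, rfl⟩ := (tderiv_extChartAt_bijective hp).2 u
  have hcov' : (fun q => φ (Q.proj q)) = fun q => Q.proj (ψ q) := by ext q; exact (hcov q).symm
  have hm : MDifferentiableAt 𝓘(ℝ, EP) 𝓘(ℝ, EM) (fun q => Q.proj (ψ q)) p :=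
    MDifferentiableAt.comp p (Q.mdiff_proj _) hψ
  rw [hcov', ContinuousLinearMap.comp_apply, ContinuousLinearMap.prod_apply,
    fderiv_chartRep_tderiv hψ hp hψp, fderiv_chartRep_tderiv hm hp hx, localForm_tderiv A hp,
    chartRep_extChartAt hp, ← A.tderiv_coframe hψp hx, tderiv_comp (Q.mdiff_proj _) hψ, ← hA v]
  congr 1
  exact (A.eq_coframe (A.frame_apply _ _)).symm

/-- By `PreservesAt.hasFDerivAt_chartRep` the derivative of `ψ` is a smooth function of the point
and of the value of `ψ`, so `ψ` solves a total differential equation and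
`contDiffAt_of_hasFDerivAt_eq` applies. -/
theorem contMDiff_of_preservesAt {ψ : P → P} {φ : M → M}
    (hψ : MDifferentiable 𝓘(ℝ, EP) 𝓘(ℝ, EP) ψ) (hA : ∀ p, A.PreservesAt ψ p)
    (hφ : ContMDiff 𝓘(ℝ, EM) 𝓘(ℝ, EM) ∞ φ) (hcov : ∀ q, Q.proj (ψ q) = φ (Q.proj q)) :
    ContMDiff 𝓘(ℝ, EP) 𝓘(ℝ, EP) ∞ ψ := by
  intro p
  have hp : p ∈ (extChartAt 𝓘(ℝ, EP) p).source := mem_extChartAt_source _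
  have hψp : ψ p ∈ (extChartAt 𝓘(ℝ, EP) (ψ p)).source := mem_extChartAt_source _
  have hx : Q.proj (ψ p) ∈ (extChartAt 𝓘(ℝ, EM) (Q.proj (ψ p))).source := mem_extChartAt_source _
  refine ContDiffAt.contMDiffAt_of_chartRep le_rfl (hψ p).continuousAt hp hψp ?_
  refine contDiffAt_of_hasFDerivAt_eq (R := fun q : EP × EP =>
    A.localCoframe (ψ p) (Q.proj (ψ p)) q.2 ∘L
        (fderiv ℝ (chartRep (E := EP) (F := EM) p (Q.proj (ψ p)) fun q => φ (Q.proj q))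
          q.1).prod (A.localForm p q.1)) ?_ ?_
  · have h1 : ContDiffAt ℝ ∞ (fun q : EP × EP => A.localCoframe (ψ p) (Q.proj (ψ p)) q.2)
        (extChartAt 𝓘(ℝ, EP) p p,
          chartRep (E := EP) (F := EP) p (ψ p) ψ (extChartAt 𝓘(ℝ, EP) p p)) := by
      refine ContDiffAt.comp _ (g := A.localCoframe (ψ p) (Q.proj (ψ p))) ?_ contDiffAt_snd
      rw [chartRep_extChartAt hp]
      exact A.contDiffAt_localCoframe hψp hx
    have h2 := (ContMDiffAt.contDiffAt_chartRep le_rfl ((hφ.comp Q.smooth_proj) p) hp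
      (y₀ := Q.proj (ψ p)) (by rw [Function.comp_apply, ← hcov]; exact hx)).fderiv_right
      (m := ∞) (by simp)
    have h3 := A.contDiffAt_localForm ((extChartAt 𝓘(ℝ, EP) p).map_source hp)
    have h4 := ContDiffAt.comp (𝕜 := ℝ) (n := ∞) (f := Prod.fst) (extChartAt 𝓘(ℝ, EP) p p,
      chartRep (E := EP) (F := EP) p (ψ p) ψ (extChartAt 𝓘(ℝ, EP) p p)) h2 contDiffAt_fst
    have h5 := ContDiffAt.comp (𝕜 := ℝ) (n := ∞) (f := Prod.fst) (extChartAt 𝓘(ℝ, EP) p p,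
      chartRep (E := EP) (F := EP) p (ψ p) ψ (extChartAt 𝓘(ℝ, EP) p p)) h3 contDiffAt_fst
    exact h1.clm_comp ((ContinuousLinearMap.prodₗᵢ (𝕜 := ℝ) (E := EP) (F := EM) (G := EG)
      ℝ).contDiff.contDiffAt.comp _ (h4.prodMk h5))
  · have hO : ∀ᶠ q in 𝓝 p, q ∈ (extChartAt 𝓘(ℝ, EP) p).source ∧
        ψ q ∈ (extChartAt 𝓘(ℝ, EP) (ψ p)).source ∧
        Q.proj (ψ q) ∈ (extChartAt 𝓘(ℝ, EM) (Q.proj (ψ p))).source := by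
      refine ((isOpen_extChartAt_source p).eventually_mem hp).and (((hψ p).continuousAt.eventually_mem
        ((isOpen_extChartAt_source _).mem_nhds hψp)).and ?_)
      exact (Q.smooth_proj.continuous.continuousAt.comp (hψ p).continuousAt).eventually_mem
        ((isOpen_extChartAt_source _).mem_nhds hx)
    have hsym := continuousAt_extChartAt_symm (I := 𝓘(ℝ, EP)) p
    rw [ContinuousAt, extChartAt_to_inv] at hsym
    filter_upwards [hsym.eventually hO,
      (isOpen_extChartAt_target p).mem_nhds (mem_extChartAt_target p)] with z hz hzt
    have h := PreservesAt.hasFDerivAt_chartRep (hψ _) (hA _) hcov hz.1 hz.2.1 hz.2.2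
    rwa [(extChartAt 𝓘(ℝ, EP) p).right_inv hzt] at h

/-- The chain rule multiplies the uniform bound for isometries by a local bound for `dπ`.
Convergence jointly in the index and the point keeps the images in the chart at `x₁` on a ball
independent of `i`. -/
theorem exists_bound_fderiv_chartRep_isometry {ι : Type*} {l : Filter ι}
    (g : ContMDiffRiemannianMetric 𝓘(ℝ, EM) ∞ EM (fun x : M => TangentSpace 𝓘(ℝ, EM) x))
    (Q : PrincipalBundle (EP := EP) (EM := EM) (EG := EG) P M G) {φ : ι → M → M} {x₁ : M} (p₀ : P)
    (hφ : ∀ i, MDifferentiable 𝓘(ℝ, EM) 𝓘(ℝ, EM) (φ i))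
    (hg : ∀ i x (v : EM), (g.inner (φ i x) : EM →L[ℝ] EM →L[ℝ] ℝ) (tderiv EM EM (φ i) x v)
      (tderiv EM EM (φ i) x v) = (g.inner x : EM →L[ℝ] EM →L[ℝ] ℝ) v v)
    (hφl : Filter.Tendsto (fun q : ι × M => φ q.1 q.2) (l ×ˢ 𝓝 (Q.proj p₀)) (𝓝 x₁)) :
    ∃ C : ℝ, ∃ r > 0,
      Metric.ball (extChartAt 𝓘(ℝ, EP) p₀ p₀) r ⊆ (extChartAt 𝓘(ℝ, EP) p₀).target ∧
      ∀ᶠ i in l, ∀ z ∈ Metric.ball (extChartAt 𝓘(ℝ, EP) p₀ p₀) r,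
        φ i (Q.proj ((extChartAt 𝓘(ℝ, EP) p₀).symm z)) ∈ (extChartAt 𝓘(ℝ, EM) x₁).source ∧
        ‖fderiv ℝ (chartRep (E := EP) (F := EM) p₀ x₁ fun q => φ i (Q.proj q)) z‖ ≤ C := by
  obtain ⟨C, hC, U, hU, W, hW, hCb⟩ := exists_bound_tderiv_isometry g (Q.proj p₀) x₁
  set D := fderiv ℝ (chartRep (E := EP) (F := EM) p₀ (Q.proj p₀) Q.proj) with hD
  set z₀ := extChartAt 𝓘(ℝ, EP) p₀ p₀ with hz₀
  have hDc : ContinuousAt D z₀ :=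
    ((ContMDiffAt.contDiffAt_chartRep le_rfl (Q.smooth_proj p₀) (mem_extChartAt_source p₀)
      (mem_extChartAt_source _)).fderiv_right (m := ∞) (by simp)).continuousAt
  have hD1 : ∀ᶠ z in 𝓝 z₀, ‖D z‖ < ‖D z₀‖ + 1 := hDc.norm.eventually_lt_const (by linarith)
  have hsym := continuousAt_extChartAt_symm (I := 𝓘(ℝ, EP)) p₀
  rw [ContinuousAt, extChartAt_to_inv] at hsym
  have hpr : Filter.Tendsto (fun z => Q.proj ((extChartAt 𝓘(ℝ, EP) p₀).symm z)) (𝓝 z₀)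
      (𝓝 (Q.proj p₀)) := Q.smooth_proj.continuous.continuousAt.tendsto.comp hsym
  have hφz := hφl.comp (Filter.tendsto_id.prodMap hpr)
  have h1 : ∀ᶠ q : ι × EP in l ×ˢ 𝓝 z₀,
      φ q.1 (Q.proj ((extChartAt 𝓘(ℝ, EP) p₀).symm q.2)) ∈
        W ∩ (extChartAt 𝓘(ℝ, EM) x₁).source :=
    hφz.eventually_mem (Filter.inter_mem hW
      ((isOpen_extChartAt_source x₁).mem_nhds (mem_extChartAt_source x₁)))
  have h2 : ∀ᶠ z in 𝓝 z₀, Q.proj ((extChartAt 𝓘(ℝ, EP) p₀).symm z) ∈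
      U ∩ (extChartAt 𝓘(ℝ, EM) (Q.proj p₀)).source :=
    hpr.eventually_mem (Filter.inter_mem hU
      ((isOpen_extChartAt_source _).mem_nhds (mem_extChartAt_source _)))
  have h3 : ∀ᶠ z in 𝓝 z₀, z ∈ (extChartAt 𝓘(ℝ, EP) p₀).target :=
    (isOpen_extChartAt_target p₀).eventually_mem (mem_extChartAt_target p₀)
  obtain ⟨r₁, hr₁, hb₁⟩ := exists_ball_of_eventually_prod (R := fun i z =>
    φ i (Q.proj ((extChartAt 𝓘(ℝ, EP) p₀).symm z)) ∈ W ∩ (extChartAt 𝓘(ℝ, EM) x₁).source) h1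
  obtain ⟨r₂, hr₂, hb₂⟩ := Metric.eventually_nhds_iff_ball.1 ((hD1.and h2).and h3)
  refine ⟨C * (‖D z₀‖ + 1), min r₁ r₂, lt_min hr₁ hr₂, fun z hz =>
    (hb₂ z (Metric.ball_subset_ball (min_le_right _ _) hz)).2, ?_⟩
  filter_upwards [hb₁] with i hi z hz
  have hi1 := hi z (Metric.ball_subset_ball (min_le_left _ _) hz)
  obtain ⟨⟨k1, k2⟩, k3⟩ := hb₂ z (Metric.ball_subset_ball (min_le_right _ _) hz)
  refine ⟨hi1.2, ContinuousLinearMap.opNorm_le_bound _ (by positivity) fun u => ?_⟩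
  obtain ⟨p, hp⟩ : ∃ p, p = (extChartAt 𝓘(ℝ, EP) p₀).symm z := ⟨_, rfl⟩
  have hps : p ∈ (extChartAt 𝓘(ℝ, EP) p₀).source := hp ▸ (extChartAt 𝓘(ℝ, EP) p₀).map_target k3
  have hz : z = extChartAt 𝓘(ℝ, EP) p₀ p := by rw [hp, (extChartAt 𝓘(ℝ, EP) p₀).right_inv k3]
  rw [← hp] at hi1 k2
  rw [hz] at k1 ⊢
  obtain ⟨v, rfl⟩ := (tderiv_extChartAt_bijective hps).2 u
  rw [fderiv_chartRep_tderiv (f := fun q => φ i (Q.proj q))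
    (MDifferentiableAt.comp p (hφ i _) (Q.mdiff_proj p)) hps hi1.2,
    tderiv_comp (g := φ i) (f := Q.proj) (hφ i _) (Q.mdiff_proj p)]
  refine (hCb (φ i) _ k2.1 hi1.1 (hg i _) _).trans ?_
  rw [← fderiv_chartRep_tderiv (Q.mdiff_proj p) hps k2.2, mul_assoc]
  gcongr
  exact (ContinuousLinearMap.le_opNorm _ _).trans (by gcongr)

variable [T2Space P] {ι : Type*} {l : Filter ι}
  {g : ContMDiffRiemannianMetric 𝓘(ℝ, EM) ∞ EM (fun x : M => TangentSpace 𝓘(ℝ, EM) x)}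
  {ψ : ι → P → P} {φ : ι → M → M}

/-- Equicontinuity of the lifts. As long as the image stays near `p₁` the differentials of the `ψ i`
are uniformly bounded, so the image of a short segment from `p₀` has small speed and
`norm_extChartAt_sub_le_of_norm_deriv_le` traps it in the chart. -/
theorem tendsto_prod_of_isometry {p₀ p₁ : P}
    (hψ : ∀ i, MDifferentiable 𝓘(ℝ, EP) 𝓘(ℝ, EP) (ψ i)) (hA : ∀ i p, A.PreservesAt (ψ i) p)
    (hcov : ∀ i q, Q.proj (ψ i q) = φ i (Q.proj q))
    (hφ : ∀ i, MDifferentiable 𝓘(ℝ, EM) 𝓘(ℝ, EM) (φ i))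
    (hg : ∀ i x (v : EM), (g.inner (φ i x) : EM →L[ℝ] EM →L[ℝ] ℝ) (tderiv EM EM (φ i) x v)
      (tderiv EM EM (φ i) x v) = (g.inner x : EM →L[ℝ] EM →L[ℝ] ℝ) v v)
    (hφl : Filter.Tendsto (fun q : ι × M => φ q.1 q.2) (l ×ˢ 𝓝 (Q.proj p₀)) (𝓝 (Q.proj p₁)))
    (hψl : Filter.Tendsto (ψ · p₀) l (𝓝 p₁)) :
    Filter.Tendsto (fun q : ι × P => ψ q.1 q.2) (l ×ˢ 𝓝 p₀) (𝓝 p₁) := by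
  obtain ⟨C₁, r, hr, hrt, hb⟩ := exists_bound_fderiv_chartRep_isometry g Q p₀ hφ hg hφl
  set z₀ := extChartAt 𝓘(ℝ, EP) p₀ p₀ with hz₀
  set κ := extChartAt 𝓘(ℝ, EP) p₁ with hκ
  have hS : ContinuousAt (A.localCoframe p₁ (Q.proj p₁)) (κ p₁) :=
    (A.contDiffAt_localCoframe (mem_extChartAt_source p₁) (mem_extChartAt_source _)).continuousAt
  have hB : ContinuousAt (A.localForm p₀) z₀ :=
    (A.contDiffAt_localForm (mem_extChartAt_target p₀)).continuousAt
  obtain ⟨C₂, hC₂⟩ : ∃ C₂, C₂ = ‖A.localCoframe p₁ (Q.proj p₁) (κ p₁)‖ + 1 := ⟨_, rfl⟩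
  obtain ⟨C₃, hC₃⟩ : ∃ C₃, C₃ = ‖A.localForm p₀ z₀‖ + 1 := ⟨_, rfl⟩
  have hC₂0 : 0 < C₂ := by rw [hC₂]; positivity
  have hC₃0 : 0 < C₃ := by rw [hC₃]; positivity
  obtain ⟨r', hr', hB'⟩ := Metric.eventually_nhds_iff_ball.1
    (hB.norm.eventually_lt_const (show _ < C₃ by rw [hC₃]; linarith))
  rw [Filter.tendsto_iff_forall_eventually_mem]
  intro O hO
  have hsym := continuousAt_extChartAt_symm (I := 𝓘(ℝ, EP)) p₁
  rw [ContinuousAt, extChartAt_to_inv] at hsym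
  obtain ⟨ρ₀, hρ₀, hball⟩ := Metric.eventually_nhds_iff_ball.1
    (((hS.norm.eventually_lt_const (show _ < C₂ by rw [hC₂]; linarith)).and
      (hsym.eventually_mem hO)).and
      ((isOpen_extChartAt_target p₁).eventually_mem (mem_extChartAt_target p₁)))
  obtain ⟨ρ, hρ, hρρ⟩ : ∃ ρ > 0, ρ < ρ₀ := ⟨ρ₀ / 2, by positivity, by linarith⟩
  -- Bound for the differential of every `ψ i` in the charts: `C₂` for the coframe near `p₁`, `|C₁|
  -- + C₃` for the differential of `φ i ∘ π` paired with the connection form.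
  set Kc : ℝ := C₂ * (|C₁| + C₃) with hKc
  have hKc0 : 0 < Kc := by positivity
  set δ : ℝ := min (min r r') (ρ / 2 / Kc) with hδ
  have hδ0 : 0 < δ := by positivity
  have hnear : ∀ᶠ i in l, ψ i p₀ ∈ κ.source ∧ dist (κ (ψ i p₀)) (κ p₁) < ρ / 2 :=
    (hψl.eventually_mem ((isOpen_extChartAt_source p₁).mem_nhds (mem_extChartAt_source p₁))).and
      (((continuousAt_extChartAt p₁).tendsto.comp hψl).eventually_mem
        (Metric.ball_mem_nhds _ (by positivity)))
  have hV : ∀ᶠ p in 𝓝 p₀, p ∈ (extChartAt 𝓘(ℝ, EP) p₀).source ∧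
      extChartAt 𝓘(ℝ, EP) p₀ p ∈ Metric.ball z₀ δ :=
    ((isOpen_extChartAt_source p₀).eventually_mem (mem_extChartAt_source p₀)).and
      ((continuousAt_extChartAt p₀).eventually_mem (Metric.ball_mem_nhds _ hδ0))
  refine Filter.eventually_prod_iff.2 ⟨_, hb.and hnear, _, hV, ?_⟩
  rintro i ⟨hi, hi0, hi1⟩ p ⟨hp, hpδ⟩
  change ψ i p ∈ O
  set z := extChartAt 𝓘(ℝ, EP) p₀ p with hz
  set c : ℝ → P := fun t => ψ i ((extChartAt 𝓘(ℝ, EP) p₀).symm (z₀ + t • (z - z₀))) with hc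
  have hzt : ∀ t ∈ Set.Icc (0 : ℝ) 1, z₀ + t • (z - z₀) ∈ Metric.ball z₀ δ := by
    intro t ht
    rw [Metric.mem_ball, dist_eq_norm] at hpδ ⊢
    rw [add_sub_cancel_left, norm_smul, Real.norm_of_nonneg ht.1]
    nlinarith [norm_nonneg (z - z₀), ht.2]
  have hδr : δ ≤ r := (min_le_left _ _).trans (min_le_left _ _)
  have hδr' : δ ≤ r' := (min_le_left _ _).trans (min_le_right _ _)
  have hline : ∀ t : ℝ, HasDerivAt (fun t : ℝ => z₀ + t • (z - z₀)) (z - z₀) t := fun t => by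
    simpa using ((hasDerivAt_id t).smul_const (z - z₀)).const_add z₀
  have hKz : Kc * ‖z - z₀‖ < ρ / 2 := by
    have : ‖z - z₀‖ < ρ / 2 / Kc := by
      rw [← dist_eq_norm]; exact (Metric.mem_ball.1 hpδ).trans_le (min_le_right _ _)
    rwa [lt_div_iff₀ hKc0, mul_comm] at this
  have hc0 : c 0 = ψ i p₀ := by simp [hc, hz₀]
  have hc1 : c 1 = ψ i p := by
    simp only [hc, one_smul, add_sub_cancel]
    rw [hz, (extChartAt 𝓘(ℝ, EP) p₀).left_inv hp]
  have key := norm_extChartAt_sub_le_of_norm_deriv_le (F := EP) (c := c) (y₀ := p₁) (ρ := ρ)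
    (K := Kc * ‖z - z₀‖) ?_ ?_ (by rw [hc0]; exact hi0) (by rw [hc0]; exact hi1) hKz
    (by positivity) ?_
  · rw [hc1, hc0] at key
    have hd : dist (κ (ψ i p)) (κ p₁) < ρ₀ := by
      have := dist_triangle (κ (ψ i p)) (κ (ψ i p₀)) (κ p₁)
      linarith [key.2]
    have := (hball _ (Metric.mem_ball.2 hd)).1.2
    rwa [κ.left_inv key.1] at this
  · intro t ht
    have h1 : ContinuousAt (extChartAt 𝓘(ℝ, EP) p₀).symm (z₀ + t • (z - z₀)) :=
      continuousAt_extChartAt_symm'' (hrt (Metric.ball_subset_ball hδr (hzt t ht)))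
    exact (hψ i).continuous.continuousAt.comp
      (ContinuousAt.comp (f := fun t : ℝ => z₀ + t • (z - z₀)) h1 (hline t).continuousAt)
  · exact fun w hw => (hball w (Metric.mem_ball.2 ((Metric.mem_closedBall.1 hw).trans_lt hρρ))).2
  · intro t ht hts htd
    have hztr := hzt t ht
    obtain ⟨k1, k2⟩ := hi _ (Metric.ball_subset_ball hδr hztr)
    have htt := hrt (Metric.ball_subset_ball hδr hztr)
    have hder := PreservesAt.hasFDerivAt_chartRep (p₁ := p₁) (x₁ := Q.proj p₁) (hψ i _) (hA i _)
      (hcov i) ((extChartAt 𝓘(ℝ, EP) p₀).map_target htt) hts (by rw [hcov]; exact k1)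
    rw [(extChartAt 𝓘(ℝ, EP) p₀).right_inv htt] at hder
    have hcd := HasFDerivAt.comp_hasDerivAt (f := fun t : ℝ => z₀ + t • (z - z₀)) t hder (hline t)
    refine ⟨_, hcd, ?_⟩
    refine (ContinuousLinearMap.le_opNorm _ _).trans ?_
    gcongr
    refine (ContinuousLinearMap.opNorm_comp_le _ _).trans ?_
    have e1 := (hball _ (Metric.mem_ball.2 (htd.trans hρρ))).1.1
    have e2 := hB' _ (Metric.ball_subset_ball hδr' hztr)
    rw [hKc]
    gcongr
    · exact e1.le
    · rw [ContinuousLinearMap.opNorm_prod, Prod.norm_def]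
      refine max_le ?_ ?_
      · exact k2.trans ((le_abs_self _).trans (by linarith))
      · exact e2.le.trans (by linarith [abs_nonneg C₁])

/-- A pointwise limit of maps that preserve the connection and cover a convergent family of
isometries is smooth and preserves the connection. -/
theorem contMDiff_and_preservesAt_of_tendsto [l.NeBot] [RegularSpace P] {ψ₀ : P → P} {φ₀ : M → M}
    (hψ : ∀ i, MDifferentiable 𝓘(ℝ, EP) 𝓘(ℝ, EP) (ψ i)) (hA : ∀ i p, A.PreservesAt (ψ i) p)
    (hcov : ∀ i q, Q.proj (ψ i q) = φ i (Q.proj q))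
    (hφ : ∀ i, MDifferentiable 𝓘(ℝ, EM) 𝓘(ℝ, EM) (φ i))
    (hg : ∀ i x (v : EM), (g.inner (φ i x) : EM →L[ℝ] EM →L[ℝ] ℝ) (tderiv EM EM (φ i) x v)
      (tderiv EM EM (φ i) x v) = (g.inner x : EM →L[ℝ] EM →L[ℝ] ℝ) v v)
    (hφl : ∀ x, Filter.Tendsto (fun q : ι × M => φ q.1 q.2) (l ×ˢ 𝓝 x) (𝓝 (φ₀ x)))
    (hψl : ∀ p, Filter.Tendsto (ψ · p) l (𝓝 (ψ₀ p)))
    (hφ₀ : ContMDiff 𝓘(ℝ, EM) 𝓘(ℝ, EM) ∞ φ₀) (hcov₀ : ∀ p, Q.proj (ψ₀ p) = φ₀ (Q.proj p)) :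
    ContMDiff 𝓘(ℝ, EP) 𝓘(ℝ, EP) ∞ ψ₀ ∧ ∀ p, A.PreservesAt ψ₀ p := by
  have hjoint : ∀ p, Filter.Tendsto (fun q : ι × P => ψ q.1 q.2) (l ×ˢ 𝓝 p) (𝓝 (ψ₀ p)) :=
    fun p => tendsto_prod_of_isometry hψ hA hcov hφ hg (by rw [hcov₀]; exact hφl _) (hψl p)
  have hcont : Continuous ψ₀ := by
    rw [continuous_iff_continuousAt]
    intro p
    -- Closed neighbourhoods suffice by regularity, and membership in them passes from the `ψ i q`
    -- to the limit `ψ₀ q`.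
    refine (closed_nhds_basis (ψ₀ p)).tendsto_right_iff.2 ?_
    rintro K ⟨hK, hKc⟩
    obtain ⟨pa, ha, pb, hb, hab⟩ := Filter.eventually_prod_iff.1 ((hjoint p).eventually_mem hK)
    filter_upwards [hb] with q hq
    exact hKc.mem_of_tendsto (hψl q) (ha.mono fun i hi => hab hi hq)
  have hmain : ∀ p₀, MDifferentiableAt 𝓘(ℝ, EP) 𝓘(ℝ, EP) ψ₀ p₀ ∧ A.PreservesAt ψ₀ p₀ := by
    intro p₀
    set p₁ := ψ₀ p₀ with hp₁
    set x₁ := Q.proj p₁ with hx₁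
    set z₀ := extChartAt 𝓘(ℝ, EP) p₀ p₀ with hz₀
    have hφl₁ : Filter.Tendsto (fun q : ι × M => φ q.1 q.2) (l ×ˢ 𝓝 (Q.proj p₀)) (𝓝 x₁) := by
      rw [hx₁, hp₁, hcov₀]; exact hφl _
    obtain ⟨C₁, r, hr, hrt, hb⟩ := exists_bound_fderiv_chartRep_isometry g Q p₀ hφ hg hφl₁
    have hsym := continuousAt_extChartAt_symm (I := 𝓘(ℝ, EP)) p₀
    rw [ContinuousAt, extChartAt_to_inv] at hsym
    have hjz : Filter.Tendsto (fun q : ι × EP => ψ q.1 ((extChartAt 𝓘(ℝ, EP) p₀).symm q.2))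
        (l ×ˢ 𝓝 z₀) (𝓝 p₁) := (hjoint p₀).comp (Filter.tendsto_id.prodMap hsym)
    have hsrc₁ : (extChartAt 𝓘(ℝ, EP) p₁).source ∈ 𝓝 p₁ :=
      (isOpen_extChartAt_source p₁).mem_nhds (mem_extChartAt_source p₁)
    obtain ⟨r₁, hr₁, hb₁⟩ := exists_ball_of_eventually_prod (R := fun i z =>
      ψ i ((extChartAt 𝓘(ℝ, EP) p₀).symm z) ∈ (extChartAt 𝓘(ℝ, EP) p₁).source)
      (hjz.eventually_mem hsrc₁)
    have hψ₀z : ∀ᶠ z in 𝓝 z₀, ψ₀ ((extChartAt 𝓘(ℝ, EP) p₀).symm z) ∈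
        (extChartAt 𝓘(ℝ, EP) p₁).source ∧
        Q.proj (ψ₀ ((extChartAt 𝓘(ℝ, EP) p₀).symm z)) ∈ (extChartAt 𝓘(ℝ, EM) x₁).source := by
      have h1 : Filter.Tendsto (fun z => ψ₀ ((extChartAt 𝓘(ℝ, EP) p₀).symm z)) (𝓝 z₀) (𝓝 p₁) :=
        hcont.continuousAt.tendsto.comp hsym
      exact (h1.eventually_mem hsrc₁).and
        ((Q.smooth_proj.continuous.continuousAt.tendsto.comp h1).eventually_mem
          ((isOpen_extChartAt_source x₁).mem_nhds (mem_extChartAt_source x₁)))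
    obtain ⟨r₂, hr₂, hb₂⟩ := Metric.eventually_nhds_iff_ball.1 hψ₀z
    obtain ⟨R, hR, hRr, hR1, hR2⟩ : ∃ R > 0, R ≤ r ∧ R ≤ r₁ ∧ R ≤ r₂ :=
      ⟨min r (min r₁ r₂), by positivity, min_le_left _ _,
        (min_le_right _ _).trans (min_le_left _ _), (min_le_right _ _).trans (min_le_right _ _)⟩
    have hm₀ : MDifferentiableAt 𝓘(ℝ, EP) 𝓘(ℝ, EM) (fun q => φ₀ (Q.proj q)) p₀ :=
      MDifferentiableAt.comp p₀ (hφ₀.mdifferentiableAt (by simp)) (Q.mdiff_proj p₀)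
    have hx₀ : φ₀ (Q.proj p₀) ∈ (extChartAt 𝓘(ℝ, EM) x₁).source := by
      rw [← hcov₀]; exact mem_extChartAt_source _
    have key := hasFDerivAt_of_tendsto_of_equicontinuous (l := l) (z₀ := z₀) (r := R) (C := C₁)
      (f := fun i => chartRep (E := EP) (F := EP) p₀ p₁ (ψ i))
      (a := fun i => chartRep (E := EP) (F := EM) p₀ x₁ fun q => φ i (Q.proj q))
      (a' := fun i => fderiv ℝ (chartRep (E := EP) (F := EM) p₀ x₁ fun q => φ i (Q.proj q)))
      (f₀ := chartRep (E := EP) (F := EP) p₀ p₁ ψ₀)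
      (a₀ := chartRep (E := EP) (F := EM) p₀ x₁ fun q => φ₀ (Q.proj q))
      (S := A.localCoframe p₁ x₁) (B := A.localForm p₀) hR ?_ ?_ ?_ ?_ ?_ ?_ ?_ ?_
      (MDifferentiableAt.differentiableAt_chartRep hm₀ (mem_extChartAt_source p₀)
        hx₀).hasFDerivAt
    · have hmd : MDifferentiableAt 𝓘(ℝ, EP) 𝓘(ℝ, EP) ψ₀ p₀ :=
        DifferentiableAt.mdifferentiableAt_of_chartRep (y₀ := p₁) hcont.continuousAt
          (mem_extChartAt_source p₀) (mem_extChartAt_source p₁) key.differentiableAt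
      refine ⟨hmd, fun v => ?_⟩
      have e1 := fderiv_chartRep_tderiv (y₀ := p₁) hmd (mem_extChartAt_source p₀)
        (mem_extChartAt_source p₁) v
      rw [key.fderiv, chartRep_extChartAt (mem_extChartAt_source p₀)] at e1
      -- The limit derivative is `localCoframe` of a pair whose second entry is the form at `p₀`;
      -- the Lie algebra component of `localFrame` returns that entry.
      have e2 := congrArg (fun u => (A.localFrame p₁ x₁ (extChartAt 𝓘(ℝ, EP) p₁ p₁) u).2) e1
      simp only [ContinuousLinearMap.comp_apply] at e2
      rw [localCoframe, (A.localFrame_isInvertible (mem_extChartAt_source p₁)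
        (mem_extChartAt_source x₁)).self_apply_inverse] at e2
      have e3 := A.localForm_tderiv (mem_extChartAt_source (I := 𝓘(ℝ, EP)) p₀) v
      have e4 := A.localForm_tderiv (mem_extChartAt_source (I := 𝓘(ℝ, EP)) p₁)
        (tderiv EP EP ψ₀ p₀ v)
      exact e4.symm.trans (e2.symm.trans e3)
    · filter_upwards [hb, hb₁] with i hi hi1 z hz
      have hzt := hrt (Metric.ball_subset_ball hRr hz)
      have h := PreservesAt.hasFDerivAt_chartRep (p₁ := p₁) (x₁ := x₁) (hψ i _) (hA i _)
        (hcov i) ((extChartAt 𝓘(ℝ, EP) p₀).map_target hzt)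
        (hi1 z (Metric.ball_subset_ball hR1 hz))
        (by rw [hcov]; exact (hi z (Metric.ball_subset_ball hRr hz)).1)
      rwa [(extChartAt 𝓘(ℝ, EP) p₀).right_inv hzt] at h
    · filter_upwards [hb] with i hi z hz
      have hzt := hrt (Metric.ball_subset_ball hRr hz)
      have h := MDifferentiableAt.differentiableAt_chartRep (x₀ := p₀) (y₀ := x₁)
        (f := fun q => φ i (Q.proj q)) (x := (extChartAt 𝓘(ℝ, EP) p₀).symm z)
        (MDifferentiableAt.comp _ (hφ i _) (Q.mdiff_proj _))
        ((extChartAt 𝓘(ℝ, EP) p₀).map_target hzt) (hi z (Metric.ball_subset_ball hRr hz)).1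
      rw [(extChartAt 𝓘(ℝ, EP) p₀).right_inv hzt] at h
      exact h.hasFDerivAt
    · filter_upwards [hb] with i hi z hz
      exact (hi z (Metric.ball_subset_ball hRr hz)).2
    · rw [chartRep_extChartAt (mem_extChartAt_source p₀)]
      exact (A.contDiffAt_localCoframe (mem_extChartAt_source p₁)
        (mem_extChartAt_source x₁)).continuousAt
    · exact (A.contDiffAt_localForm (mem_extChartAt_target p₀)).continuousAt
    · intro z hz
      have h := (hb₂ z (Metric.ball_subset_ball hR2 hz)).1
      exact (continuousAt_extChartAt' (I := 𝓘(ℝ, EP)) (by simpa using h)).tendsto.comp (hψl _)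
    · intro z hz
      have h := (hb₂ z (Metric.ball_subset_ball hR2 hz)).2
      rw [hcov₀] at h
      refine (continuousAt_extChartAt' (I := 𝓘(ℝ, EM)) (by simpa using h)).tendsto.comp ?_
      exact (hφl _).comp (Filter.tendsto_id.prodMk
        (tendsto_const_nhds (x := Q.proj ((extChartAt 𝓘(ℝ, EP) p₀).symm z))))
    · intro ε hε
      have h1 := (continuousAt_extChartAt (I := 𝓘(ℝ, EP)) p₁).tendsto.comp hjz
      obtain ⟨δ, hδ, h2⟩ := exists_ball_of_eventually_prod (R := fun i z =>
        extChartAt 𝓘(ℝ, EP) p₁ (ψ i ((extChartAt 𝓘(ℝ, EP) p₀).symm z)) ∈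
          Metric.ball (extChartAt 𝓘(ℝ, EP) p₁ p₁) (ε / 2))
        (h1.eventually_mem (Metric.ball_mem_nhds _ (by positivity)))
      refine ⟨δ, hδ, h2.mono fun i hi z hz => ?_⟩
      have e1 := Metric.mem_ball.1 (hi z hz)
      have e2 := Metric.mem_ball.1 (hi z₀ (Metric.mem_ball_self hδ))
      rw [dist_comm] at e2
      have e3 := add_lt_add e1 e2
      rw [add_halves] at e3
      exact (dist_triangle _ _ _).trans_lt e3
  exact ⟨contMDiff_of_preservesAt (fun p => (hmain p).1) (fun p => (hmain p).2) hφ₀ hcov₀,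
    fun p => (hmain p).2⟩

end Connection

end Limits

/-! ### Lie derivatives of one-forms along flows -/

section LieDerivative

variable {E V : Type*} [NormedAddCommGroup E] [NormedSpace ℝ E] [NormedAddCommGroup V]
  [NormedSpace ℝ V]

/-- Cartan's formula in coordinates at `s = 0`, for a form that vanishes on the generator. The mixed
derivative of `f` is symmetric, and differentiating `α (∂ₛ f) = 0` in the direction `w` expresses
the term containing it through the derivative of `α`. -/
theorem hasDerivAt_pullback_apply {f : ℝ × E → E} {α : E → E →L[ℝ] V} {z₀ : E}
    (hf : ContDiffAt ℝ ∞ f (0, z₀)) (hf0 : f (0, z₀) = z₀) (hα : DifferentiableAt ℝ α z₀)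
    (hid : fderiv ℝ f (0, z₀) ∘L ContinuousLinearMap.inr ℝ ℝ E = ContinuousLinearMap.id ℝ E)
    (hfα : ∀ᶠ z in 𝓝 z₀, α z (fderiv ℝ f (0, z) (1, 0)) = 0) (w : E) :
    HasDerivAt (fun s : ℝ => α (f (s, z₀)) (fderiv ℝ f (s, z₀) (0, w)))
      (fderiv ℝ α z₀ (fderiv ℝ f (0, z₀) (1, 0)) w -
        fderiv ℝ α z₀ w (fderiv ℝ f (0, z₀) (1, 0))) 0 := by
  have hH : DifferentiableAt ℝ (fderiv ℝ f) (0, z₀) :=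
    (hf.fderiv_right (m := ∞) (by simp)).differentiableAt (by simp)
  set D := fderiv ℝ (fderiv ℝ f) (0, z₀) with hD
  set v := fderiv ℝ f (0, z₀) (1, 0) with hv
  have hsymm : D (1, 0) (0, w) = D (0, w) (1, 0) :=
    (hf.isSymmSndFDerivAt
      (by rw [minSmoothness_of_isRCLikeNormedField]; exact ENat.LEInfty.out)) _ _
  have hs : HasDerivAt (fun s : ℝ => (s, z₀)) ((1 : ℝ), (0 : E)) 0 :=
    (hasDerivAt_id (0 : ℝ)).prodMk (hasDerivAt_const _ _)
  have h1 : HasDerivAt (fun s : ℝ => f (s, z₀)) v 0 :=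
    (hf.differentiableAt (by simp)).hasFDerivAt.comp_hasDerivAt 0 hs
  have h2 : HasDerivAt (fun s : ℝ => fderiv ℝ f (s, z₀)) (D (1, 0)) 0 :=
    HasFDerivAt.comp_hasDerivAt (f := fun s : ℝ => (s, z₀)) 0 hH.hasFDerivAt hs
  have h3 : HasDerivAt (fun s : ℝ => α (f (s, z₀))) (fderiv ℝ α z₀ v) 0 := by
    refine HasFDerivAt.comp_hasDerivAt (f := fun s : ℝ => f (s, z₀)) 0 ?_ h1
    rw [hf0]; exact hα.hasFDerivAt
  have h4 : HasDerivAt (fun s : ℝ => fderiv ℝ f (s, z₀) (0, w)) (D (1, 0) (0, w)) 0 := by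
    simpa using h2.clm_apply (hasDerivAt_const (0 : ℝ) ((0 : ℝ), w))
  have h5 := h3.clm_apply h4
  have hw0 : fderiv ℝ f (0, z₀) (0, w) = w := congrArg (fun L : E →L[ℝ] E => L w) hid
  rw [hf0, hw0] at h5
  have hz : HasFDerivAt (fun z : E => ((0 : ℝ), z)) (ContinuousLinearMap.inr ℝ ℝ E) z₀ :=
    (ContinuousLinearMap.inr ℝ ℝ E).hasFDerivAt
  have h6 : HasFDerivAt (fun z : E => fderiv ℝ f (0, z)) (D ∘L ContinuousLinearMap.inr ℝ ℝ E) z₀ :=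
    HasFDerivAt.comp (f := fun z : E => ((0 : ℝ), z)) z₀ hH.hasFDerivAt hz
  have h7 := hα.hasFDerivAt.clm_apply (h6.clm_apply (hasFDerivAt_const ((1 : ℝ), (0 : E)) z₀))
  have h8 : HasFDerivAt (fun z => α z (fderiv ℝ f (0, z) (1, 0))) (0 : E →L[ℝ] V) z₀ :=
    (hasFDerivAt_const (0 : V) z₀).congr_of_eventuallyEq hfα
  have h9 := congrArg (fun L : E →L[ℝ] V => L w) (h7.unique h8)
  simp at h9
  convert h5 using 1
  rw [hsymm, sub_eq_iff_eq_add, add_assoc, add_comm (α z₀ _), ← hv] at *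
  rw [h9]; simp

end LieDerivative

/-! ### Naturality of flows, joint smoothness in time and point, and forms along flows. -/

section Flows

variable {E : Type*} [NormedAddCommGroup E] [NormedSpace ℝ E]
  {N : Type*} [TopologicalSpace N] [ChartedSpace E N] [IsManifold 𝓘(ℝ, E) ∞ N]
  {F : Type*} [NormedAddCommGroup F] [NormedSpace ℝ F]
  {N' : Type*} [TopologicalSpace N'] [ChartedSpace F N'] [IsManifold 𝓘(ℝ, F) ∞ N']
  {X : ∀ x : N, TangentSpace 𝓘(ℝ, E) x} {X' : ∀ x : N', TangentSpace 𝓘(ℝ, F) x}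

theorem IsMIntegralCurve.map {f : N → N'} (hf : MDifferentiable 𝓘(ℝ, E) 𝓘(ℝ, F) f)
    (hX : ∀ x, tderiv E F f x (X x) = X' (f x)) {γ : ℝ → N} (hγ : IsMIntegralCurve γ X) :
    IsMIntegralCurve (fun t => f (γ t)) X' := by
  intro t
  have h := HasMFDerivAt.comp t (hf (γ t)).hasMFDerivAt (hγ t)
  refine h.congr_mfderiv ?_
  refine ContinuousLinearMap.ext_ring ?_
  have h1 : X' (f (γ t)) = tderiv E F f (γ t) (X (γ t)) := (hX _).symm
  exact ((one_smul ℝ (X' (f (γ t)))).trans (h1.trans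
    (congrArg (tderiv E F f (γ t)) (one_smul ℝ (X (γ t))).symm))).symm

variable [FiniteDimensional ℝ E] [T2Space N] [CompactSpace N]
  [FiniteDimensional ℝ F] [T2Space N'] [CompactSpace N']

/-- Uniqueness of integral curves. Equivariance of horizontal flows, their projection to `M` and
their behaviour under automorphisms are all instances. -/
theorem flow_map (hX : SmoothVectorField X) (hX' : SmoothVectorField X') {f : N → N'}
    (hf : MDifferentiable 𝓘(ℝ, E) 𝓘(ℝ, F) f) (h : ∀ x, tderiv E F f x (X x) = X' (f x))
    (t : ℝ) (x : N) : f (flow hX t x) = flow hX' t (f x) := by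
  have := eq_flow hX' (IsMIntegralCurve.map hf h (isMIntegralCurve_flow hX x)) t
  simpa only [flow_zero] using this

theorem smoothFamily_smul (hX : SmoothVectorField X) :
    SmoothFamily (fun (s : ℝ) => s • X) := by
  rintro ⟨s, x⟩
  have h1 := ContMDiffAt.comp (s, x) (f := Prod.snd) (hX x) (contMDiffAt_snd (I := 𝓘(ℝ, ℝ)))
  have h2 := (contMDiffAt_tangentBundle_iff (x₀ := x) (by simp) (mem_extChartAt_source x)).1 h1
  refine (contMDiffAt_tangentBundle_iff (x₀ := x) (by simp) (mem_extChartAt_source x)).2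
    ⟨contMDiffAt_snd, ?_⟩
  refine (contMDiffAt_fst.smul h2.2).congr_of_eventuallyEq (Filter.Eventually.of_forall ?_)
  intro q
  exact map_smul (tderiv E E (extChartAt 𝓘(ℝ, E) x) q.2) q.1 (X q.2)

/-- Time becomes a parameter: the flow at time `s` is the time-one flow of `s • X`. -/
theorem contMDiff_flow_joint (hX : SmoothVectorField X) :
    ContMDiff (𝓘(ℝ, ℝ).prod 𝓘(ℝ, E)) 𝓘(ℝ, E) ∞ (fun q : ℝ × N => flow hX q.1 q.2) := by
  refine ((smoothFamily_smul hX).contMDiff_flow 1).congr fun q => ?_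
  rw [flow_smul hX, one_mul]

theorem contMDiff_flow (hX : SmoothVectorField X) (t : ℝ) :
    ContMDiff 𝓘(ℝ, E) 𝓘(ℝ, E) ∞ (flow hX t) :=
  ContMDiff.comp (g := fun q : ℝ × N => flow hX q.1 q.2) (contMDiff_flow_joint hX)
    (contMDiff_const.prodMk contMDiff_id)

theorem tderiv_flow_zero (hX : SmoothVectorField X) (x : N) (w : E) :
    tderiv E E (flow hX 0) x w = w := by
  have : flow hX 0 = fun x => x := by ext x; exact flow_zero hX x
  rw [this, tderiv_id]

theorem tderiv_flow_add (hX : SmoothVectorField X) (s t : ℝ) (x : N) (w : E) :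
    tderiv E E (flow hX (s + t)) x w =
      tderiv E E (flow hX s) (flow hX t x) (tderiv E E (flow hX t) x w) := by
  have : flow hX (s + t) = fun x => flow hX s (flow hX t x) := by ext x; exact flow_add hX s t x
  rw [this]
  exact tderiv_comp ((contMDiff_flow hX s).mdifferentiableAt (by simp))
    ((contMDiff_flow hX t).mdifferentiableAt (by simp)) w

/-- The derivative along the flow of `X` of a one-form that vanishes on `X`. -/
theorem hasDerivAt_form_flow {V : Type*} [NormedAddCommGroup V] [NormedSpace ℝ V]
    {α : ∀ x : N, TangentSpace 𝓘(ℝ, E) x →L[ℝ] V} (hα : SmoothOneForm α)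
    (hX : SmoothVectorField X) (h0 : ∀ x, α x (X x) = 0) (x₀ : N) (w : E) :
    HasDerivAt (fun s : ℝ => (α (flow hX s x₀) : E →L[ℝ] V) (tderiv E E (flow hX s) x₀ w))
      (extDerivOneForm α x₀ (X x₀) w) 0 := by
  set κ := extChartAt 𝓘(ℝ, E) x₀ with hκ
  set z₀ := κ x₀ with hz₀
  -- The flow read in the chart; what follows verifies the hypotheses of `hasDerivAt_pullback_apply`
  -- for it.
  set f : ℝ × E → E := fun q => κ (flow hX q.1 (κ.symm q.2)) with hf
  have hsrc : x₀ ∈ κ.source := mem_extChartAt_source x₀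
  have hfd : ContDiffAt ℝ ∞ f (0, z₀) := by
    rw [← contMDiffAt_iff_contDiffAt]
    have h1 : ContMDiffAt 𝓘(ℝ, ℝ × E) (𝓘(ℝ, ℝ).prod 𝓘(ℝ, E)) ∞
        (fun q : ℝ × E => (q.1, κ.symm q.2)) (0, z₀) :=
      (contMDiffAt_iff_contDiffAt.2 contDiffAt_fst).prodMk
        (ContMDiffAt.comp (0, z₀) (contMDiffAt_extChartAt_symm (mem_extChartAt_target x₀))
          (contMDiffAt_iff_contDiffAt.2 contDiffAt_snd))
    have h2 := ContMDiffAt.comp (0, z₀) (g := fun q : ℝ × N => flow hX q.1 q.2)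
      (contMDiff_flow_joint hX).contMDiffAt h1
    refine ContMDiffAt.comp (0, z₀) (g := κ) ?_ h2
    have : flow hX 0 (κ.symm z₀) = x₀ := by rw [flow_zero, hz₀, κ.left_inv hsrc]
    change ContMDiffAt 𝓘(ℝ, E) 𝓘(ℝ, E) ∞ κ (flow hX 0 (κ.symm z₀))
    rw [this]
    exact contMDiffAt_extChartAt
  have hf0 : ∀ z ∈ κ.target, f (0, z) = z := fun z hz => by
    simp only [hf, flow_zero, κ.right_inv hz]
  have hid : fderiv ℝ f (0, z₀) ∘L ContinuousLinearMap.inr ℝ ℝ E =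
      ContinuousLinearMap.id ℝ E := by
    have h1 : HasFDerivAt (fun z : E => f (0, z))
        (fderiv ℝ f (0, z₀) ∘L ContinuousLinearMap.inr ℝ ℝ E) z₀ :=
      HasFDerivAt.comp (f := fun z : E => ((0 : ℝ), z)) z₀
        (hfd.differentiableAt (by simp)).hasFDerivAt (ContinuousLinearMap.inr ℝ ℝ E).hasFDerivAt
    refine h1.unique ((hasFDerivAt_id z₀).congr_of_eventuallyEq ?_)
    filter_upwards [(isOpen_extChartAt_target x₀).mem_nhds (mem_extChartAt_target x₀)] with z hz
    exact hf0 z hz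
  have hev : ∀ᶠ q in 𝓝 ((0 : ℝ), z₀), DifferentiableAt ℝ f q := by
    have h1 := (hfd.of_le (show (1 : WithTop ℕ∞) ≤ ∞ by simp)).eventually (by simp)
    exact h1.mono fun q hq => hq.differentiableAt (by simp)
  have hev1 : ∀ᶠ z in 𝓝 z₀, DifferentiableAt ℝ f (0, z) :=
    (Continuous.prodMk_right (0 : ℝ)).continuousAt.eventually hev
  have hev2 : ∀ᶠ s in 𝓝 (0 : ℝ), DifferentiableAt ℝ f (s, z₀) :=
    (Continuous.prodMk_left z₀).continuousAt.eventually hev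
  have hX0 : ∀ z ∈ κ.target, DifferentiableAt ℝ f (0, z) →
      fderiv ℝ f (0, z) (1, 0) = tderiv E E κ (κ.symm z) (X (κ.symm z)) := by
    intro z hz hd
    have h1 : HasDerivAt (fun s : ℝ => f (s, z)) (fderiv ℝ f (0, z) (1, 0)) 0 :=
      HasFDerivAt.comp_hasDerivAt (f := fun s : ℝ => (s, z)) 0 hd.hasFDerivAt
        ((hasDerivAt_id (0 : ℝ)).prodMk (hasDerivAt_const _ _))
    have hmd : MDifferentiableAt 𝓘(ℝ, E) 𝓘(ℝ, E) κ (flow hX 0 (κ.symm z)) := by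
      rw [flow_zero]
      exact mdifferentiableAt_extChartAt_of_mem (κ.map_target hz)
    have h2 := HasMFDerivAt.comp (0 : ℝ) hmd.hasMFDerivAt
      (isMIntegralCurve_flow hX (κ.symm z) 0)
    have h3 : HasFDerivAt (fun s : ℝ => f (s, z)) (tderiv E E κ (flow hX 0 (κ.symm z)) ∘L
        ((1 : ℝ →L[ℝ] ℝ).smulRight (X (flow hX 0 (κ.symm z)) : E))) 0 :=
      hasMFDerivAt_iff_hasFDerivAt.1 h2
    rw [h1.unique h3.hasDerivAt]
    have h6 : ∀ y, y = κ.symm z → tderiv E E κ y ((1 : ℝ) • (X y : E)) =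
      tderiv E E κ (κ.symm z) (X (κ.symm z)) := by rintro y rfl; rw [one_smul]
    exact h6 _ (flow_zero hX _)
  have key := hasDerivAt_pullback_apply (α := localOneForm α x₀) hfd
    (hf0 z₀ (mem_extChartAt_target x₀))
    ((hα.contDiffAt_localOneForm (mem_extChartAt_target x₀)).differentiableAt (by simp)) hid ?_
    (tderiv E E κ x₀ w)
  · have hval : fderiv ℝ f (0, z₀) (1, 0) = tderiv E E κ x₀ (X x₀) := by
      rw [hX0 z₀ (mem_extChartAt_target x₀) (hfd.differentiableAt (by simp))]
      have h6 : ∀ y, y = x₀ → tderiv E E κ y (X y) = tderiv E E κ x₀ (X x₀) := by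
        rintro y rfl; rfl
      exact h6 _ (κ.left_inv hsrc)
    rw [hval] at key
    refine key.congr_of_eventuallyEq ?_
    have hcs : ContinuousAt (fun s : ℝ => flow hX s x₀) 0 :=
      (isMIntegralCurve_flow hX x₀).continuous.continuousAt
    have hfs : ∀ᶠ s in 𝓝 (0 : ℝ), flow hX s x₀ ∈ κ.source :=
      hcs.eventually_mem ((isOpen_extChartAt_source x₀).mem_nhds (by
        rw [flow_zero]; exact hsrc))
    filter_upwards [hfs, hev2] with s hs hd
    have h1 : HasFDerivAt (fun z : E => f (s, z))
        (fderiv ℝ f (s, z₀) ∘L ContinuousLinearMap.inr ℝ ℝ E) z₀ := by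
      refine HasFDerivAt.comp (f := fun z : E => (s, z)) z₀ hd.hasFDerivAt ?_
      exact (hasFDerivAt_const s z₀).prodMk (hasFDerivAt_id z₀)
    have h2 := fderiv_chartRep_tderiv (y₀ := x₀) (x₀ := x₀) (f := flow hX s) (x := x₀)
      ((contMDiff_flow hX s).mdifferentiableAt (by simp)) hsrc hs w
    have h3 : fderiv ℝ (chartRep (E := E) (F := E) x₀ x₀ (flow hX s)) z₀ =
        fderiv ℝ f (s, z₀) ∘L ContinuousLinearMap.inr ℝ ℝ E := h1.fderiv
    rw [← hκ, ← hz₀, h3] at h2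
    have h4 : f (s, z₀) = κ (flow hX s x₀) := by simp only [hf, hz₀, κ.left_inv hsrc]
    have h5 : fderiv ℝ f (s, z₀) (0, tderiv E E κ x₀ w) =
      tderiv E E κ (flow hX s x₀) (tderiv E E (flow hX s) x₀ w) := h2
    rw [h4, h5, localOneForm_tderiv_extChartAt α hs]
  · filter_upwards [hev1, (isOpen_extChartAt_target x₀).mem_nhds (mem_extChartAt_target x₀)]
      with z hd hz
    rw [hX0 z hz hd]
    have h1 := localOneForm_tderiv_extChartAt α (κ.map_target hz) (X (κ.symm z))
    rw [κ.right_inv hz] at h1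
    exact h1.trans (h0 _)

end Flows

/-! ### Flows of horizontal lifts -/

section HorizontalFlows

variable {EP EM EG : Type*} [NormedAddCommGroup EP] [NormedSpace ℝ EP]
  [NormedAddCommGroup EM] [NormedSpace ℝ EM] [NormedAddCommGroup EG] [NormedSpace ℝ EG]
  {P M G : Type*} [TopologicalSpace P] [ChartedSpace EP P] [IsManifold 𝓘(ℝ, EP) ∞ P]
  [TopologicalSpace M] [ChartedSpace EM M] [IsManifold 𝓘(ℝ, EM) ∞ M]
  [TopologicalSpace G] [ChartedSpace EG G] [Group G] [LieGroup 𝓘(ℝ, EG) ∞ G]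
  {Q : PrincipalBundle (EP := EP) (EM := EM) (EG := EG) P M G}
  [FiniteDimensional ℝ EP] [T2Space P] [CompactSpace P]

theorem extDerivOneForm_add_smul {E : Type*} [NormedAddCommGroup E] [NormedSpace ℝ E]
    {N : Type*} [TopologicalSpace N] [ChartedSpace E N] [IsManifold 𝓘(ℝ, E) ∞ N]
    {V : Type*} [NormedAddCommGroup V] [NormedSpace ℝ V]
    (α : ∀ x : N, TangentSpace 𝓘(ℝ, E) x →L[ℝ] V) (x : N) (u v w : TangentSpace 𝓘(ℝ, E) x)
    (a b : ℝ) :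
    extDerivOneForm α x u (a • v + b • w) =
      a • extDerivOneForm α x u v + b • extDerivOneForm α x u w := by
  have key : ∀ (D : E →L[ℝ] E →L[ℝ] V) (L : E →L[ℝ] E) (u v w : E),
      D (L u) (L (a • v + b • w)) - D (L (a • v + b • w)) (L u) =
        a • (D (L u) (L v) - D (L v) (L u)) + b • (D (L u) (L w) - D (L w) (L u)) := by
    intro D L u v w
    simp only [map_add, map_smul, add_apply, smul_apply]
    module
  exact key _ (mfderiv 𝓘(ℝ, E) 𝓘(ℝ, E) (extChartAt 𝓘(ℝ, E) x) x) u v w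

namespace PrincipalBundle

/-- An equivariant map carries fundamental vectors to fundamental vectors. -/
theorem tderiv_fund_of_equivariant {ψ : P → P} {p : P}
    (hψ : MDifferentiableAt 𝓘(ℝ, EP) 𝓘(ℝ, EP) ψ p)
    (heq : ∀ g, ψ (Q.act p g) = Q.act (ψ p) g) (a : EG) :
    tderiv EP EP ψ p (Q.fund p a) = Q.fund (ψ p) a := by
  have h := tderiv_comp (g := ψ) (f := fun g : G => Q.act p g) (x := 1)
    (by rw [Q.act_one]; exact hψ) (Q.mdiff_act_right p 1) a
  simp only [heq, Q.act_one] at h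
  exact h.symm

end PrincipalBundle

namespace Connection

variable (A : Connection Q) {X : ∀ x : M, TangentSpace 𝓘(ℝ, EM) x}

/-- The flow of the horizontal lift of a vector field. -/
def hflow (hX : SmoothVectorField X) (t : ℝ) (p : P) : P :=
  flow (A.smoothVectorField_hlift hX) t p

variable (hX : SmoothVectorField X)

theorem hflow_zero (p : P) : A.hflow hX 0 p = p := flow_zero _ p

theorem hflow_add (s t : ℝ) (p : P) : A.hflow hX (s + t) p = A.hflow hX s (A.hflow hX t p) :=
  flow_add _ s t p

theorem contMDiff_hflow (t : ℝ) : ContMDiff 𝓘(ℝ, EP) 𝓘(ℝ, EP) ∞ (A.hflow hX t) :=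
  contMDiff_flow (A.smoothVectorField_hlift hX) t

theorem mdiff_hflow (t : ℝ) (p : P) : MDifferentiableAt 𝓘(ℝ, EP) 𝓘(ℝ, EP) (A.hflow hX t) p :=
  (A.contMDiff_hflow hX t).mdifferentiableAt (by simp)

theorem hflow_act (t : ℝ) (p : P) (g : G) :
    A.hflow hX t (Q.act p g) = Q.act (A.hflow hX t p) g := by
  refine (flow_map (A.smoothVectorField_hlift hX) (A.smoothVectorField_hlift hX)
    (f := fun q => Q.act q g) (Q.mdiff_act_left g) (fun q => ?_) t p).symm
  refine (A.tderiv_act_hlift q g (X (Q.proj q))).trans ?_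
  have : ∀ y, y = Q.proj q → A.hlift (Q.act q g) (X (Q.proj q)) = A.hlift (Q.act q g) (X y) := by
    rintro y rfl; rfl
  exact this _ (Q.proj_act q g)

theorem proj_hflow [FiniteDimensional ℝ EM] [T2Space M] [CompactSpace M] (t : ℝ) (p : P) :
    Q.proj (A.hflow hX t p) = flow hX t (Q.proj p) :=
  flow_map (A.smoothVectorField_hlift hX) hX Q.mdiff_proj
    (fun q => A.tderiv_proj_hlift q (X (Q.proj q))) t p

/-- The vertical part of `w` is carried to fundamental vectors with the same generator, so its
contribution is constant. The horizontal part contributes the contraction of `dA` with the lift of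
`X`, which is zero by `hF`. -/
theorem hasDerivAt_formAt_hflow
    (hF : ∀ p u, extDerivOneForm (V := EG) A.form p (A.hlift p (X (Q.proj p))) (A.hlift p u) = 0)
    (p : P) (w : EP) :
    HasDerivAt (fun s => A.formAt (A.hflow hX s p) (tderiv EP EP (A.hflow hX s) p w)) 0 0 := by
  have h1 := hasDerivAt_form_flow (V := EG) (α := A.form) A.smooth_form
    (A.smoothVectorField_hlift hX) (fun q => A.formAt_hlift q (X (Q.proj q))) p
    (A.hlift p (tderiv EP EM Q.proj p w))
  have h2 : HasDerivAt (fun s => A.formAt (A.hflow hX s p) (tderiv EP EP (A.hflow hX s) p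
      (A.hlift p (tderiv EP EM Q.proj p w)))) 0 0 := by
    rw [← hF p (tderiv EP EM Q.proj p w)]; exact h1
  refine (h2.add_const (A.formAt p w)).congr_of_eventuallyEq (Filter.Eventually.of_forall ?_)
  intro s
  have h3 := A.exists_decomposition p w
  have h4 : A.formAt (A.hflow hX s p) (tderiv EP EP (A.hflow hX s) p
      (Q.fund p (A.formAt p w))) = A.formAt p w := by
    rw [PrincipalBundle.tderiv_fund_of_equivariant (A.mdiff_hflow hX s p)
      (A.hflow_act hX s p), formAt_fund]
  change A.formAt (A.hflow hX s p) (tderiv EP EP (A.hflow hX s) p w) = _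
  conv_lhs => rw [h3, map_add, map_add, h4]

/-- If `ι_{X^h} F = 0` then the flow of `X^h` preserves the connection. -/
theorem preservesAt_hflow
    (hF : ∀ p u, extDerivOneForm (V := EG) A.form p (A.hlift p (X (Q.proj p))) (A.hlift p u) = 0)
    (t : ℝ) (p : P) : A.PreservesAt (A.hflow hX t) p := by
  intro w
  set c : ℝ → EG := fun s => A.formAt (A.hflow hX s p) (tderiv EP EP (A.hflow hX s) p w) with hc
  -- By the group law, the derivative at time `s` is the derivative at time `0` starting from the
  -- transported point and vector.
  have hd : ∀ s, HasDerivAt c 0 s := by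
    intro s
    have h := A.hasDerivAt_formAt_hflow hX hF (A.hflow hX s p) (tderiv EP EP (A.hflow hX s) p w)
    have h2 : HasDerivAt (fun h : ℝ => c (h + s)) 0 0 := by
      refine h.congr_of_eventuallyEq (Filter.Eventually.of_forall fun r => ?_)
      have e1 := tderiv_flow_add (A.smoothVectorField_hlift hX) r s p w
      have e2 := A.hflow_add hX r s p
      simp only [hc]
      rw [e2]
      exact congrArg _ e1
    have h3 := HasDerivAt.comp_add_const (f := fun h : ℝ => c (h + s)) s (-s)
      (by rw [add_neg_cancel]; exact h2)
    simpa using h3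
  have hconst := is_const_of_deriv_eq_zero (fun s => (hd s).differentiableAt)
    (fun s => (hd s).deriv) t 0
  have h0 : c 0 = A.formAt p w := by
    have e1 := tderiv_flow_zero (A.smoothVectorField_hlift hX) p w
    simp only [hc]
    rw [A.hflow_zero hX p]
    exact congrArg _ e1
  exact hconst.trans h0

end Connection

end HorizontalFlows

/-! ### Adapted frames of contact metric structures -/

section AdaptedFrames

/-- Only permutations fixing `0` contribute. This leaves the 24 permutations of `Fin 4`, few enough
for evaluation. -/
theorem sum_perm_ite_zero (m : Matrix (Fin 5) (Fin 5) ℤ) :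
    ∑ σ : Equiv.Perm (Fin 5), (Equiv.Perm.sign σ : ℤ) *
      ((if σ 0 = 0 then 1 else 0 : ℤ) * m (σ 1) (σ 2) * m (σ 3) (σ 4)) =
    ∑ σ : Equiv.Perm (Fin 4), (Equiv.Perm.sign σ : ℤ) *
      (m (σ 0).succ (σ 1).succ * m (σ 2).succ (σ 3).succ) := by
  rw [← Equiv.Perm.decomposeFin.symm.sum_comp, Fintype.sum_prod_type, Finset.sum_eq_single 0]
  · refine Finset.sum_congr rfl fun e _ => ?_
    have h (i : Fin 4) : Equiv.Perm.decomposeFin.symm (0, e) i.succ = (e i).succ := by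
      rw [Equiv.Perm.decomposeFin_symm_apply_succ, Equiv.swap_self, Equiv.refl_apply]
    have h1 := h 0
    have h2 := h 1
    simp only [Fin.succ_zero_eq_one, Fin.succ_one_eq_two] at h1 h2
    rw [h1, h2, show (3 : Fin 5) = Fin.succ 2 from rfl, show (4 : Fin 5) = Fin.succ 3 from rfl,
      h 2, h 3, Equiv.Perm.decomposeFin_symm_apply_zero, Equiv.Perm.decomposeFin.symm_sign]
    simp
  · intro p _ hp
    exact Finset.sum_eq_zero fun e _ => by simp [Equiv.Perm.decomposeFin_symm_apply_zero, hp]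
  · simp

/-- Eight permutations contribute, each `+1`: the two arguments may be swapped in either factor `ω`,
and the two factors may be exchanged. -/
theorem sum_perm_adapted_eq (η : Fin 5 → ℝ) (om : Fin 5 → Fin 5 → ℝ)
    (hη : ∀ i, η i = ((if i = 0 then 1 else 0 : ℤ) : ℝ))
    (hom : ∀ i j, om i j = ((!![0, 0, 0, 0, 0; 0, 0, -1, 0, 0; 0, 1, 0, 0, 0; 0, 0, 0, 0, -1;
      0, 0, 0, 1, 0] : Matrix (Fin 5) (Fin 5) ℤ) i j : ℝ)) :
    ∑ σ : Equiv.Perm (Fin 5), ((Equiv.Perm.sign σ : ℤ) : ℝ) *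
      (η (σ 0) * om (σ 1) (σ 2) * om (σ 3) (σ 4)) = 8 := by
  have h : ∑ σ : Equiv.Perm (Fin 5), (Equiv.Perm.sign σ : ℤ) *
      ((if σ 0 = 0 then 1 else 0 : ℤ) * (!![0, 0, 0, 0, 0; 0, 0, -1, 0, 0; 0, 1, 0, 0, 0;
        0, 0, 0, 0, -1; 0, 0, 0, 1, 0] : Matrix (Fin 5) (Fin 5) ℤ) (σ 1) (σ 2) *
        (!![0, 0, 0, 0, 0; 0, 0, -1, 0, 0; 0, 1, 0, 0, 0;
        0, 0, 0, 0, -1; 0, 0, 0, 1, 0] : Matrix (Fin 5) (Fin 5) ℤ) (σ 3) (σ 4)) = 8 := by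
    rw [sum_perm_ite_zero]
    decide +kernel
  have h' := congrArg (Int.cast : ℤ → ℝ) h
  rw [Int.cast_sum] at h'
  simp only [hη, hom]
  exact_mod_cast h'

variable {g : E5 →L[ℝ] E5 →L[ℝ] ℝ} {ξ : E5} {η : E5 →L[ℝ] ℝ} {Φ : E5 →L[ℝ] E5}

/-- The frame is `(ξ, v, Φ v, w, Φ w)`, where `w` is a unit vector in the common kernel of `η`, `g
v` and `g (Φ v)`: three linear forms on a five-dimensional space have a common zero. The axioms give
`Φ ξ = 0`, `η ∘ Φ = 0` and skew-symmetry of `Φ`, and these determine all the products. -/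
theorem exists_adapted_frame (hsymm : ∀ u v, g u v = g v u) (hpos : ∀ u, u ≠ 0 → 0 < g u u)
    (hηξ : η ξ = 1) (hΦ : ∀ u, Φ (Φ u) = -u + η u • ξ)
    (hg : ∀ u v, g (Φ u) (Φ v) = g u v - η u * η v) {v : E5} (hv : η v = 0) (hv1 : g v v = 1) :
    ∃ e : Fin 5 → E5, e 0 = ξ ∧ e 1 = v ∧ (∀ i, η (e i) = ((if i = 0 then 1 else 0 : ℤ) : ℝ)) ∧
      (∀ i j, g (e i) (e j) = if i = j then 1 else 0) ∧
      ∀ i j, g (e i) (Φ (e j)) = ((!![0, 0, 0, 0, 0; 0, 0, -1, 0, 0; 0, 1, 0, 0, 0; 0, 0, 0, 0, -1;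
        0, 0, 0, 1, 0] : Matrix (Fin 5) (Fin 5) ℤ) i j : ℝ) := by
  have hξ0 : ξ ≠ 0 := by rintro rfl; simp at hηξ
  -- From `Φ (Φ ξ) = 0` the formula for `Φ²` at `Φ ξ` yields `Φ ξ = η (Φ ξ) • ξ`; applying `Φ` once
  -- more makes the square of this coefficient vanish.
  have hΦξ : Φ ξ = 0 := by
    have h1 : Φ (Φ ξ) = 0 := by rw [hΦ, hηξ]; simp
    have h2 : Φ ξ = η (Φ ξ) • ξ := by
      have := hΦ (Φ ξ)
      rw [h1, map_zero] at this
      rw [eq_comm, neg_add_eq_zero] at this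
      exact this
    have h3 : η (Φ ξ) • η (Φ ξ) • ξ = 0 := by
      rw [← h2, ← map_smul, ← h2]; exact h1
    rcases smul_eq_zero.1 h3 with h | h
    · rw [h2, h, zero_smul]
    · rw [h2, h]
  have hgξ : ∀ u, g u ξ = η u := fun u => by
    have := hg u ξ
    rw [hΦξ, map_zero, hηξ, mul_one] at this
    linarith
  have hηΦ : ∀ u, η (Φ u) = 0 := fun u => by
    have h1 := hΦ (Φ u)
    rw [hΦ u, map_add, map_smul, hΦξ, smul_zero, add_zero, map_neg] at h1
    have h2 : η (Φ u) • ξ = 0 := by simpa using h1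
    exact (smul_eq_zero.1 h2).resolve_right hξ0
  have hskew : ∀ u v, g (Φ u) v = -g u (Φ v) := fun u v => by
    have h1 := hg (Φ u) v
    rw [hΦ u, hηΦ, zero_mul, sub_zero] at h1
    rw [← h1, map_add, map_smul, map_neg, add_apply, smul_apply, neg_apply, hsymm ξ, hgξ, hηΦ]
    simp
  have hΦself : ∀ u, g u (Φ u) = 0 := fun u => by
    have h1 := hskew u u
    rw [hsymm] at h1
    linarith
  obtain ⟨w₀, hw₀, hw1, hw2, hw3⟩ : ∃ w : E5, w ≠ 0 ∧ η w = 0 ∧ g v w = 0 ∧ g (Φ v) w = 0 := by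
    let L : E5 →ₗ[ℝ] (Fin 3 → ℝ) := LinearMap.pi ![η.toLinearMap, (g v).toLinearMap,
      (g (Φ v)).toLinearMap]
    have hk : LinearMap.ker L ≠ ⊥ := LinearMap.ker_ne_bot_of_finrank_lt (by simp)
    obtain ⟨w, hw, hw0⟩ := (Submodule.ne_bot_iff _).1 hk
    have hw' := LinearMap.mem_ker.1 hw
    exact ⟨w, hw0, congrFun hw' 0, congrFun hw' 1, congrFun hw' 2⟩
  obtain ⟨w, hww, hηw, hvw, hΦvw⟩ : ∃ w : E5, g w w = 1 ∧ η w = 0 ∧ g v w = 0 ∧ g (Φ v) w = 0 := by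
    have hp := hpos w₀ hw₀
    refine ⟨(√(g w₀ w₀))⁻¹ • w₀, ?_, by simp [hw1], by simp [hw2], by simp [hw3]⟩
    rw [map_smul, map_smul, smul_apply, smul_eq_mul, smul_eq_mul, ← mul_assoc, ← mul_inv,
      Real.mul_self_sqrt hp.le, inv_mul_cancel₀ hp.ne']
  have hvΦw : g v (Φ w) = 0 := by have := hskew v w; linarith
  have hΦΦ : ∀ u, η u = 0 → Φ (Φ u) = -u := fun u hu => by rw [hΦ, hu, zero_smul, add_zero]
  have a1 := hΦΦ v hv
  have a2 := hΦΦ w hηw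
  have b1 : g w v = 0 := by rw [hsymm]; exact hvw
  have b2 : g w (Φ v) = 0 := by rw [hsymm]; exact hΦvw
  have b3 : g (Φ w) v = 0 := by rw [hsymm]; exact hvΦw
  have b4 : g (Φ v) v = 0 := by rw [hsymm]; exact hΦself v
  have b5 : g (Φ w) w = 0 := by rw [hsymm]; exact hΦself w
  have hξg : ∀ u, g ξ u = η u := fun u => by rw [hsymm]; exact hgξ u
  refine ⟨![ξ, v, Φ v, w, Φ w], rfl, rfl, ?_, ?_, ?_⟩
  · intro i
    fin_cases i <;> simp [hηξ, hv, hηΦ, hηw]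
  · intro i j
    fin_cases i <;> fin_cases j <;>
      simp [hηξ, hv, hηΦ, hηw, hgξ, hξg, hv1, hww, hg, hvw, hΦvw, hvΦw, b1, b2, b3, b4, b5, hΦself]
  · intro i j
    fin_cases i <;> fin_cases j <;>
      simp [hv, hηΦ, hηw, hξg, hv1, hww, hg, hvw, hΦvw, hvΦw, b1, b2, b3, b4, b5, hΦself,
        a1, a2, hΦξ]

/-- Subtract the `ξ` component, which leaves a vector of `ker η`, and rescale that vector to unit
length. -/
theorem eq_zero_of_forall_unit {V : Type*} [AddCommGroup V] [Module ℝ V] {κ : E5 → V}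
    (hlin : ∀ (a b : ℝ) (v w : E5), κ (a • v + b • w) = a • κ v + b • κ w)
    (hpos : ∀ u, u ≠ 0 → 0 < g u u) (hηξ : η ξ = 1)
    (hunit : ∀ v, η v = 0 → g v v = 1 → κ v = 0) (hξ : κ ξ = 0) (u : E5) : κ u = 0 := by
  have hhor : ∀ v : E5, η v = 0 → κ v = 0 := by
    intro v hv
    by_cases hv0 : v = 0
    · simpa [hv0] using hlin 0 0 v v
    · have hp : 0 < g v v := hpos v hv0
      have h1 := hunit ((√(g v v))⁻¹ • v) (by rw [map_smul, hv, smul_zero]) (by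
        rw [map_smul, map_smul, smul_apply, smul_eq_mul, smul_eq_mul, ← mul_assoc, ← mul_inv,
          Real.mul_self_sqrt hp.le, inv_mul_cancel₀ hp.ne'])
      have h2 := hlin (√(g v v)) 0 ((√(g v v))⁻¹ • v) v
      rw [h1, smul_zero, zero_smul, zero_smul, add_zero, add_zero, smul_smul,
        mul_inv_cancel₀ (Real.sqrt_pos.2 hp).ne', one_smul] at h2
      exact h2
  have h1 := hhor (u - η u • ξ) (by rw [map_sub, map_smul, hηξ]; simp)
  have h3 := hlin 1 (η u) (u - η u • ξ) ξ
  rw [h1, hξ, smul_zero, smul_zero, add_zero, one_smul, sub_add_cancel] at h3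
  exact h3

/-- Adapted frames are automatically positive: the volume form takes the value `1 / 4 * 8 = 2` on
them. -/
theorem ContactMetricStructure.exists_orientedOrthonormal {M : Type*} [TopologicalSpace M]
    [ChartedSpace E5 M] [IsManifold (𝓡 5) ∞ M] (C : ContactMetricStructure M) (x : M) {v : E5}
    (hv : (C.form x : E5 →L[ℝ] ℝ) v = 0)
    (hv1 : (C.metric.inner x : E5 →L[ℝ] E5 →L[ℝ] ℝ) v v = 1) :
    ∃ e : Fin 5 → TangentSpace (𝓡 5) x, C.IsOrientedOrthonormal x e ∧ e 0 = C.reeb x ∧ e 1 = v ∧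
      ∀ i, i ≠ 0 → C.form x (e i) = 0 := by
  obtain ⟨e, h0, h1, h2, h3, h4⟩ := exists_adapted_frame
    (g := (C.metric.inner x : E5 →L[ℝ] E5 →L[ℝ] ℝ)) (ξ := C.reeb x)
    (η := (C.form x : E5 →L[ℝ] ℝ)) (Φ := (C.endo x : E5 →L[ℝ] E5))
    (C.metric.symm x) (C.metric.pos x) (C.form_reeb x) (C.endo_endo x) (C.metric_endo x) hv hv1
  refine ⟨e, ⟨h3, ?_⟩, h0, h1, fun i hi => ?_⟩
  · have h := sum_perm_adapted_eq (fun i => C.form x (e i)) (fun i j => C.omega x (e i) (e j)) h2 h4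
    have hvol : C.volumeForm x e = 1 / 4 * 8 := congrArg (fun r : ℝ => 1 / 4 * r) h
    rw [hvol]
    norm_num
  · refine (h2 i).trans ?_
    rw [if_neg hi, Int.cast_zero]

end AdaptedFrames

/-! ### The Reeb field annihilates the curvature of a contact instanton. -/

section Instantons

variable {EP EG : Type*} [NormedAddCommGroup EP] [NormedSpace ℝ EP]
  [NormedAddCommGroup EG] [NormedSpace ℝ EG]
  {P M G : Type*} [TopologicalSpace P] [ChartedSpace EP P] [IsManifold 𝓘(ℝ, EP) ∞ P]
  [TopologicalSpace M] [ChartedSpace E5 M] [IsManifold (𝓡 5) ∞ M]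
  [TopologicalSpace G] [ChartedSpace EG G] [Group G] [LieGroup 𝓘(ℝ, EG) ∞ G]
  {Q : PrincipalBundle (EP := EP) (EM := E5) (EG := EG) P M G} [FiniteDimensional ℝ EP]

theorem GroupLieAlgebra.zero_bracket_zero {EG G : Type*} [NormedAddCommGroup EG]
    [NormedSpace ℝ EG] [TopologicalSpace G] [ChartedSpace EG G] [Group G] :
    ⁅(0 : GroupLieAlgebra 𝓘(ℝ, EG) G), (0 : GroupLieAlgebra 𝓘(ℝ, EG) G)⁆ = 0 := by
  rw [GroupLieAlgebra.bracket_def, VectorField.mlieBracket_self]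
  rfl

/-- The connection form vanishes on horizontal lifts, so the bracket term drops out of the
curvature. -/
theorem Connection.baseCurvature_eq (A : Connection Q) (p : P) (u v : E5) :
    A.baseCurvature p u v =
      extDerivOneForm (V := EG) A.form p (A.hlift p u) (A.hlift p v) := by
  have h1 := A.horizontalLift_eq_hlift p u
  have h2 := A.horizontalLift_eq_hlift p v
  have h3 : A.form p (A.horizontalLift p u) = 0 := by rw [h1]; exact A.formAt_hlift p u
  have h4 : A.form p (A.horizontalLift p v) = 0 := by rw [h2]; exact A.formAt_hlift p v
  have h5 : (⁅A.form p (A.horizontalLift p u), A.form p (A.horizontalLift p v)⁆ :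
      GroupLieAlgebra 𝓘(ℝ, EG) G) = 0 := by
    rw [h3, h4]; exact GroupLieAlgebra.zero_bracket_zero
  have h6 : ∀ a b : EG, b = 0 → a + b = a := by rintro a b rfl; exact add_zero a
  refine (h6 (extDerivOneForm (V := EG) A.form p (A.horizontalLift p u)
    (A.horizontalLift p v)) _ h5).trans ?_
  rw [h1, h2]

/-- The curvature of a contact instanton vanishes on the Reeb vector field. -/
theorem IsContactInstanton.extDerivOneForm_reeb {C : ContactMetricStructure M} {A : Connection Q}
    (hA : IsContactInstanton C A) (p : P) (u : E5) :
    extDerivOneForm (V := EG) A.form p (A.hlift p (C.reeb (Q.proj p))) (A.hlift p u) = 0 := by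
  have hunit : ∀ v : E5, (C.form (Q.proj p) : E5 →L[ℝ] ℝ) v = 0 →
      (C.metric.inner (Q.proj p) : E5 →L[ℝ] E5 →L[ℝ] ℝ) v v = 1 →
      extDerivOneForm (V := EG) A.form p (A.hlift p (C.reeb (Q.proj p))) (A.hlift p v) = 0 := by
    intro v hv hv1
    obtain ⟨e, he, he0, he1, hη⟩ := C.exists_orientedOrthonormal (Q.proj p) hv hv1
    -- Every term of `η ∧ F` on `(e 2, e 3, e 4)` has a factor `η (e i) = 0`. By the instanton
    -- equation this value is, up to sign, `F (e 0) (e 1) = F(ξ, v)`.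
    have hw : C.wedgeForm (V := EG) (Q.proj p) (A.baseCurvature p) (e 2) (e 3) (e 4) = 0 := by
      have h : ∀ (a b c : ℝ) (x y z : EG), a = 0 → b = 0 → c = 0 → a • x + b • y + c • z = 0 := by
        rintro _ _ _ x y z rfl rfl rfl; simp
      exact h _ _ _ _ _ _ (hη 2 (by decide)) (hη 3 (by decide)) (hη 4 (by decide))
    have hc : A.baseCurvature p (e 0) (e 1) = (0 : EG) := by
      rcases hA with hA | hA
      · exact (hA p e he).symm.trans hw
      · refine (hA p e he).symm.trans ?_
        change -C.wedgeForm (V := EG) (Q.proj p) (A.baseCurvature p) (e 2) (e 3) (e 4) = 0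
        rw [hw, neg_zero]
    rw [he0, he1] at hc
    exact (A.baseCurvature_eq p _ _).symm.trans hc
  have hlin : ∀ (a b : ℝ) (v w : E5),
      extDerivOneForm (V := EG) A.form p (A.hlift p (C.reeb (Q.proj p)))
        (A.hlift p (a • v + b • w)) =
      a • extDerivOneForm (V := EG) A.form p (A.hlift p (C.reeb (Q.proj p))) (A.hlift p v) +
      b • extDerivOneForm (V := EG) A.form p (A.hlift p (C.reeb (Q.proj p))) (A.hlift p w) := by
    intro a b v w
    have h : A.hlift p (a • v + b • w) = a • A.hlift p v + b • A.hlift p w := by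
      simp only [Connection.hlift]
      rw [← map_smul, ← map_smul, ← map_add]
      simp
    rw [h]
    exact extDerivOneForm_add_smul (V := EG) A.form p _ _ _ a b
  exact eq_zero_of_forall_unit (g := (C.metric.inner (Q.proj p) : E5 →L[ℝ] E5 →L[ℝ] ℝ))
    (η := (C.form (Q.proj p) : E5 →L[ℝ] ℝ)) (ξ := C.reeb (Q.proj p)) hlin
    (C.metric.pos (Q.proj p)) (C.form_reeb (Q.proj p)) hunit (sub_self _) u

end Instantons

/-! ### Lifting isometries to automorphisms of the connection -/

section Lifts

theorem continuous_homeo_apply {X : Type*} [TopologicalSpace X] [LocallyCompactSpace X] :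
    Continuous (fun q : (X ≃ₜ X) × X => q.1 q.2) := by
  have h : Continuous (fun φ : X ≃ₜ X => (φ : C(X, X))) := continuous_induced_dom
  exact (ContinuousEval.continuous_eval (F := C(X, X)) (X := X) (Y := X)).comp
    ((h.comp continuous_fst).prodMk continuous_snd)

variable {EP EM EG : Type*} [NormedAddCommGroup EP] [NormedSpace ℝ EP]
  [NormedAddCommGroup EM] [NormedSpace ℝ EM] [NormedAddCommGroup EG] [NormedSpace ℝ EG]
  {P M G : Type*} [TopologicalSpace P] [ChartedSpace EP P] [IsManifold 𝓘(ℝ, EP) ∞ P]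
  [TopologicalSpace M] [ChartedSpace EM M] [IsManifold 𝓘(ℝ, EM) ∞ M]
  [TopologicalSpace G] [ChartedSpace EG G] [Group G] [LieGroup 𝓘(ℝ, EG) ∞ G]
  {Q : PrincipalBundle (EP := EP) (EM := EM) (EG := EG) P M G} {A : Connection Q}

namespace Connection

/-- Two automorphisms of an irreducible connection that cover the same map are equal, when the
structure group has trivial centre. -/
theorem IsIrreducible.eq_of_covers (hirr : A.IsIrreducible) (hZ : Subgroup.center G = ⊥)
    {ψ ψ' : P ≃ₜ P} (hψ : ψ ∈ A.aut) (hψ' : ψ' ∈ A.aut) {φ : M → M} (hφ : Function.Injective φ)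
    (h : ∀ p, Q.proj (ψ p) = φ (Q.proj p)) (h' : ∀ p, Q.proj (ψ' p) = φ (Q.proj p)) :
    ψ = ψ' := by
  have h1 : ψ⁻¹ * ψ' ∈ A.aut := A.aut.mul_mem (A.aut.inv_mem hψ) hψ'
  have h2 : ∀ p, Q.proj ((ψ⁻¹ * ψ') p) = Q.proj p := fun p => by
    apply hφ
    rw [← h]
    change Q.proj (ψ (ψ.symm (ψ' p))) = _
    rw [ψ.apply_symm_apply, h']
  obtain ⟨z, hz, hz'⟩ := (hirr (ψ⁻¹ * ψ')).1 ⟨h1, h2⟩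
  rw [hZ, Subgroup.mem_bot] at hz
  ext p
  have h3 := hz' p
  rw [hz, Q.act_one] at h3
  have h4 : ψ (ψ.symm (ψ' p)) = ψ p := congrArg ψ h3
  rw [ψ.apply_symm_apply] at h4
  exact h4.symm

variable [FiniteDimensional ℝ EP] [T2Space P] [CompactSpace P] [T2Space M] [CompactSpace M]
  {g : ContMDiffRiemannianMetric 𝓘(ℝ, EM) ∞ EM (fun x : M => TangentSpace 𝓘(ℝ, EM) x)}

/-- The lifts of a convergent family of isometries converge along ultrafilters. -/
theorem exists_limit_of_lifts {ι : Type*} (U : Ultrafilter ι) {ψ : ι → P ≃ₜ P} {φ : ι → M ≃ₜ M}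
    {φ₀ : M ≃ₜ M} (hψ : ∀ i, ψ i ∈ A.aut) (hφ : ∀ i, φ i ∈ isom g) (hφ₀ : φ₀ ∈ isom g)
    (hcov : ∀ i p, Q.proj (ψ i p) = φ i (Q.proj p)) (hlim : Filter.Tendsto φ U (𝓝 φ₀)) :
    ∃ ψ₀ ∈ A.aut, (∀ p, Q.proj (ψ₀ p) = φ₀ (Q.proj p)) ∧
      ∀ p, Filter.Tendsto (fun q : ι × P => ψ q.1 q.2) ((U : Filter ι) ×ˢ 𝓝 p) (𝓝 (ψ₀ p)) := by
  have hev := continuous_homeo_apply (X := M)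
  have htend : ∀ {φ : ι → M ≃ₜ M} {φ₀ : M ≃ₜ M}, Filter.Tendsto φ U (𝓝 φ₀) → ∀ x,
      Filter.Tendsto (fun q : ι × M => φ q.1 q.2) ((U : Filter ι) ×ˢ 𝓝 x) (𝓝 (φ₀ x)) := by
    intro φ φ₀ h x
    have h1 := (hev.tendsto (φ₀, x))
    rw [nhds_prod_eq] at h1
    exact h1.comp (h.prodMap Filter.tendsto_id)
  have hpt : ∀ {φ : ι → M ≃ₜ M} {φ₀ : M ≃ₜ M}, Filter.Tendsto φ U (𝓝 φ₀) → ∀ x,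
      Filter.Tendsto (fun i => φ i x) U (𝓝 (φ₀ x)) := fun h x =>
    (htend h x).comp (Filter.tendsto_id.prodMk tendsto_const_nhds)
  have hlim' : Filter.Tendsto (fun i => (φ i)⁻¹) U (𝓝 φ₀⁻¹) := hlim.inv
  -- Pointwise limits exist because `P` is compact. The statement is for arbitrary families because
  -- it is used for the inverses as well.
  have main : ∀ {ψ : ι → P ≃ₜ P} {φ : ι → M ≃ₜ M} {φ₀ : M ≃ₜ M}, (∀ i, ψ i ∈ A.aut) →
      (∀ i, φ i ∈ isom g) → φ₀ ∈ isom g → (∀ i p, Q.proj (ψ i p) = φ i (Q.proj p)) →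
      Filter.Tendsto φ U (𝓝 φ₀) → ∃ ψ₀ : P → P, (∀ p, Q.proj (ψ₀ p) = φ₀ (Q.proj p)) ∧
        (ContMDiff 𝓘(ℝ, EP) 𝓘(ℝ, EP) ∞ ψ₀ ∧ ∀ p, A.PreservesAt ψ₀ p) ∧
        ∀ p, Filter.Tendsto (fun q : ι × P => ψ q.1 q.2) ((U : Filter ι) ×ˢ 𝓝 p)
          (𝓝 (ψ₀ p)) := by
    intro ψ φ φ₀ hψ hφ hφ₀ hcov hlim
    have hex : ∀ p, ∃ q, Filter.Tendsto (fun i => ψ i p) U (𝓝 q) := fun p => by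
      obtain ⟨q, -, hq⟩ := isCompact_univ.ultrafilter_le_nhds (U.map fun i => ψ i p) (by simp)
      exact ⟨q, hq⟩
    choose ψ₀ hψ₀ using hex
    have hc₀ : ∀ p, Q.proj (ψ₀ p) = φ₀ (Q.proj p) := fun p => by
      have h1 := (Q.smooth_proj.continuous.tendsto (ψ₀ p)).comp (hψ₀ p)
      refine tendsto_nhds_unique h1 ((hpt hlim (Q.proj p)).congr fun i => (hcov i p).symm)
    have hmd : ∀ i, MDifferentiable 𝓘(ℝ, EP) 𝓘(ℝ, EP) (ψ i) := fun i =>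
      (hψ i).1.mdifferentiable (by simp)
    have hpa : ∀ i p, A.PreservesAt (ψ i) p := fun i p => (hψ i).2.2.2 p
    have hmd' : ∀ i, MDifferentiable 𝓘(ℝ, EM) 𝓘(ℝ, EM) (φ i) := fun i =>
      (hφ i).1.mdifferentiable (by simp)
    refine ⟨ψ₀, hc₀, ?_, fun p => ?_⟩
    · exact contMDiff_and_preservesAt_of_tendsto (l := (U : Filter ι)) (g := g) hmd hpa
        hcov hmd' (fun i x v => (hφ i).2.2 x v v) (htend hlim) hψ₀ hφ₀.1 hc₀
    · exact tendsto_prod_of_isometry (l := (U : Filter ι)) (g := g) hmd hpa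
        hcov hmd' (fun i x v => (hφ i).2.2 x v v) (by rw [hc₀]; exact htend hlim _) (hψ₀ p)
  have hcov' : ∀ i p, Q.proj ((ψ i)⁻¹ p) = (φ i)⁻¹ (Q.proj p) := fun i p => by
    apply (φ i).injective
    rw [← hcov]
    change Q.proj (ψ i ((ψ i).symm p)) = φ i ((φ i).symm (Q.proj p))
    rw [(ψ i).apply_symm_apply, (φ i).apply_symm_apply]
  obtain ⟨ψ₀, hc₀, ⟨hs₀, hp₀⟩, ht₀⟩ := main hψ hφ hφ₀ hcov hlim
  obtain ⟨ψ₁, hc₁, ⟨hs₁, hp₁⟩, ht₁⟩ := main (fun i => A.aut.inv_mem (hψ i))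
    (fun i => (isom g).inv_mem (hφ i)) ((isom g).inv_mem hφ₀) hcov' hlim'
  have hpt₀ : ∀ p, Filter.Tendsto (fun i => ψ i p) U (𝓝 (ψ₀ p)) := fun p =>
    (ht₀ p).comp (Filter.tendsto_id.prodMk tendsto_const_nhds)
  have hpt₁ : ∀ p, Filter.Tendsto (fun i => (ψ i)⁻¹ p) U (𝓝 (ψ₁ p)) := fun p =>
    (ht₁ p).comp (Filter.tendsto_id.prodMk tendsto_const_nhds)
  -- Convergence jointly in the index and the point allows passage to the limit in the composite of
  -- `(ψ i)⁻¹` and `ψ i`.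
  have hl : ∀ p, ψ₁ (ψ₀ p) = p := fun p => by
    have h1 := (ht₁ (ψ₀ p)).comp (Filter.tendsto_id.prodMk (hpt₀ p))
    refine tendsto_nhds_unique h1 (tendsto_const_nhds.congr fun i => ?_)
    exact ((ψ i).symm_apply_apply p).symm
  have hr : ∀ p, ψ₀ (ψ₁ p) = p := fun p => by
    have h1 := (ht₀ (ψ₁ p)).comp (Filter.tendsto_id.prodMk (hpt₁ p))
    refine tendsto_nhds_unique h1 (tendsto_const_nhds.congr fun i => ?_)
    exact ((ψ i).apply_symm_apply p).symm
  let Ψ : P ≃ₜ P := ⟨⟨ψ₀, ψ₁, hl, hr⟩, hs₀.continuous, hs₁.continuous⟩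
  refine ⟨Ψ, ⟨hs₀, hs₁, fun p a => ?_, fun p w => hp₀ p w⟩, hc₀, ht₀⟩
  have h1 : Filter.Tendsto (fun i => Q.act (ψ i p) a) U (𝓝 (Q.act (ψ₀ p) a)) :=
    ((Q.contMDiff_act_left a).continuous.tendsto _).comp (hpt₀ p)
  exact tendsto_nhds_unique (hpt₀ (Q.act p a)) (h1.congr fun i => ((hψ i).2.2.1 p a).symm)

/-- The flow of the horizontal lift of `X`, as an automorphism of the connection. -/
theorem exists_lift_flow [FiniteDimensional ℝ EM] {X : ∀ x : M, TangentSpace 𝓘(ℝ, EM) x}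
    (hX : SmoothVectorField X)
    (hF : ∀ p u, extDerivOneForm (V := EG) A.form p (A.hlift p (X (Q.proj p))) (A.hlift p u) = 0)
    (t : ℝ) : ∃ ψ ∈ A.aut, ∀ p, Q.proj (ψ p) = flow hX t (Q.proj p) := by
  let Ψ : P ≃ₜ P := ⟨⟨A.hflow hX t, A.hflow hX (-t),
    fun p => by rw [← hflow_add, neg_add_cancel, hflow_zero],
    fun p => by rw [← hflow_add, add_neg_cancel, hflow_zero]⟩,
    (A.contMDiff_hflow hX t).continuous, (A.contMDiff_hflow hX (-t)).continuous⟩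
  exact ⟨Ψ, ⟨A.contMDiff_hflow hX t, A.contMDiff_hflow hX (-t), A.hflow_act hX t,
    fun p w => A.preservesAt_hflow hX hF t p w⟩, A.proj_hflow hX t⟩

/-- An element of the closure is a limit of elements of the flow along an ultrafilter; chosen lifts
of the latter converge to a lift of the former by `exists_limit_of_lifts`. -/
theorem exists_lift_flowClosure [FiniteDimensional ℝ EM] {X : ∀ x : M, TangentSpace 𝓘(ℝ, EM) x}
    (hX : SmoothVectorField X)
    (hF : ∀ p u, extDerivOneForm (V := EG) A.form p (A.hlift p (X (Q.proj p))) (A.hlift p u) = 0)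
    (φ : flowClosure g X) : ∃ ψ ∈ A.aut, ∀ p, Q.proj (ψ p) = φ.1.1 (Q.proj p) := by
  have hflow : ∀ φ : flowSubgroup g X, ∃ ψ ∈ A.aut, ∀ p, Q.proj (ψ p) = φ.1.1 (Q.proj p) := by
    rintro ⟨φ, t, ht⟩
    obtain ⟨ψ, hψ, hc⟩ := exists_lift_flow (A := A) hX hF t
    refine ⟨ψ, hψ, fun p => (hc p).trans ?_⟩
    have := ht _ (isMIntegralCurve_flow hX (Q.proj p))
    rw [flow_zero] at this
    exact this.symm
  choose ψ hψ hc using hflow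
  have hcl : φ.1 ∈ closure (flowSubgroup g X : Set (isom g)) := φ.2
  have hne : (Filter.comap (fun i : flowSubgroup g X => i.1) (𝓝 φ.1)).NeBot :=
    mem_closure_iff_comap_neBot.1 hcl
  have hU := Ultrafilter.of_le (Filter.comap (fun i : flowSubgroup g X => i.1)
    (𝓝 φ.1))
  obtain ⟨ψ₀, h1, h2, -⟩ := exists_limit_of_lifts (A := A) (g := g)
    (Ultrafilter.of (Filter.comap (fun i : flowSubgroup g X => i.1) (𝓝 φ.1)))
    (ψ := fun i => ψ i) (φ := fun i => i.1.1) (φ₀ := φ.1.1) (fun i => hψ i) (fun i => i.1.2) φ.1.2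
    (fun i => hc i)
    ((continuous_subtype_val.tendsto φ.1).comp (Filter.tendsto_comap.mono_left hU))
  exact ⟨ψ₀, h1, h2⟩

/-- The action of the closure of the flow of `X` lifts to a continuous action by automorphisms of
the connection. -/
theorem IsIrreducible.exists_lift_action [FiniteDimensional ℝ EM]
    {X : ∀ x : M, TangentSpace 𝓘(ℝ, EM) x} (hirr : A.IsIrreducible)
    (hZ : Subgroup.center G = ⊥) (hX : SmoothVectorField X)
    (hF : ∀ p u, extDerivOneForm (V := EG) A.form p (A.hlift p (X (Q.proj p))) (A.hlift p u) = 0) :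
    ∃ ρ : flowClosure g X →* A.aut,
      (∀ (t : flowClosure g X) (p : P), Q.proj ((ρ t).1 p) = t.1.1 (Q.proj p)) ∧
      Continuous (fun q : flowClosure g X × P => (ρ q.1).1 q.2) := by
  choose ψ hψ hc using exists_lift_flowClosure (A := A) (g := g) hX hF
  -- The lift of `s * t` and the product of the lifts cover the same isometry, so uniqueness of
  -- lifts gives multiplicativity.
  let ρ : flowClosure g X →* A.aut := MonoidHom.mk' (fun t => ⟨ψ t, hψ t⟩) (fun s t => by
    apply Subtype.ext
    refine hirr.eq_of_covers hZ (hψ (s * t)) (A.aut.mul_mem (hψ s) (hψ t))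
      (s * t).1.1.injective (hc (s * t)) (fun p => ?_)
    change Q.proj (ψ s (ψ t p)) = s.1.1 (t.1.1 (Q.proj p))
    rw [hc, hc])
  refine ⟨ρ, hc, continuous_iff_ultrafilter.2 ?_⟩
  rintro ⟨t, p⟩ U hU
  -- Along an ultrafilter converging to `(t, p)` the lifts converge to some automorphism covering
  -- `t`; by uniqueness it is `ψ t`.
  rw [nhds_prod_eq] at hU
  have hU1 : Filter.Tendsto Prod.fst (U : Filter (flowClosure g X × P)) (𝓝 t) :=
    Filter.tendsto_fst.mono_left hU
  have hU2 : Filter.Tendsto Prod.snd (U : Filter (flowClosure g X × P)) (𝓝 p) :=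
    Filter.tendsto_snd.mono_left hU
  obtain ⟨ψ₀, h1, h2, h3⟩ := exists_limit_of_lifts (A := A) (g := g) U
    (ψ := fun i => ψ i.1) (φ := fun i => i.1.1.1) (φ₀ := t.1.1) (fun i => hψ i.1)
    (fun i => i.1.1.2) t.1.2 (fun i => hc i.1)
    (((continuous_subtype_val.comp continuous_subtype_val).tendsto t).comp hU1)
  have h4 : ψ₀ = ψ t := hirr.eq_of_covers hZ h1 (hψ t) t.1.1.injective h2 (hc t)
  rw [h4] at h3
  exact (h3 p).comp (Filter.tendsto_id.prodMk hU2)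

end Connection

end Lifts

/-! ### Families of vector fields and of diffeomorphisms -/

section Families

variable {E : Type*} [NormedAddCommGroup E] [NormedSpace ℝ E]
  {N : Type*} [TopologicalSpace N] [ChartedSpace E N] [IsManifold 𝓘(ℝ, E) ∞ N]

/-- Vector fields whose flows are translations in the chart at `x₀`, near `x₀`. -/
theorem exists_local_translations [FiniteDimensional ℝ E] [T2Space N] [CompactSpace N] (x₀ : N) :
    ∃ (V : E → ∀ x : N, TangentSpace 𝓘(ℝ, E) x) (hV : SmoothFamily V),
      (∀ᶠ x in 𝓝 x₀, flow (hV.smoothVectorField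
        (extChartAt 𝓘(ℝ, E) x₀ x - extChartAt 𝓘(ℝ, E) x₀ x₀)) 1 x₀ = x) ∧
      ∀ u : E, ∃ v, V v x₀ = u := by
  set κ := extChartAt 𝓘(ℝ, E) x₀ with hκ
  obtain ⟨f⟩ : Nonempty (SmoothBumpFunction 𝓘(ℝ, E) x₀) := inferInstance
  -- The field with constant coordinates `v`, cut off by a bump function: where the bump is `1`, the
  -- flow is a translation in the chart.
  let V : E → ∀ x : N, TangentSpace 𝓘(ℝ, E) x := fun v x => (f x • tderiv E E κ.symm (κ x) v : E)
  have hcoord : ∀ v, ∀ x ∈ κ.source, tangentCoord x₀ ⟨x, V v x⟩ = f x • v := by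
    intro v x hx
    have h1 := mfderiv_extChartAt_mfderiv_extChartAt_symm (κ.map_source hx) v
    have h2 : ∀ y, y = x → tderiv E E κ y (tderiv E E κ.symm (κ x) v) =
        tderiv E E κ x (tderiv E E κ.symm (κ x) v) := by rintro y rfl; rfl
    have h3 : tderiv E E κ x (tderiv E E κ.symm (κ x) v) = v :=
      (h2 _ (κ.left_inv hx)).symm.trans h1
    refine (map_smul (tderiv E E κ x) (f x) (tderiv E E κ.symm (κ x) v)).trans ?_
    rw [h3]
  have hV : SmoothFamily V := by
    rintro ⟨v, x⟩
    by_cases hx : x ∈ κ.source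
    · refine (contMDiffAt_tangentBundle_iff (x₀ := x₀) (by simp) hx).2 ⟨contMDiffAt_snd, ?_⟩
      have h1 : ContMDiffAt (𝓘(ℝ, E).prod 𝓘(ℝ, E)) 𝓘(ℝ, E) ∞
          (fun q : E × N => f q.2 • q.1) (v, x) :=
        ContMDiffAt.smul (ContMDiffAt.comp (v, x) (g := f) f.contMDiff.contMDiffAt
          contMDiffAt_snd) contMDiffAt_fst
      refine h1.congr_of_eventuallyEq ?_
      filter_upwards [continuous_snd.continuousAt.preimage_mem_nhds
        ((isOpen_extChartAt_source x₀).mem_nhds hx)] with q hq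
      exact hcoord q.1 q.2 hq
    · refine (contMDiffAt_tangentBundle_iff (x₀ := x) (by simp) (mem_extChartAt_source x)).2
        ⟨contMDiffAt_snd, ?_⟩
      refine (contMDiffAt_const (c := (0 : E))).congr_of_eventuallyEq ?_
      have hx' : x ∈ (tsupport f)ᶜ := fun h => hx (f.tsupport_subset_extChartAt_source h)
      filter_upwards [continuous_snd.continuousAt.preimage_mem_nhds
        ((isClosed_tsupport f).isOpen_compl.mem_nhds hx')] with q hq
      have h0 : f q.2 = 0 := image_eq_zero_of_notMem_tsupport hq
      have h1 : V q.1 q.2 = (0 : E) := by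
        change (f q.2 • tderiv E E κ.symm (κ q.2) q.1 : E) = 0
        rw [h0, zero_smul]
      refine (congrArg (tderiv E E (extChartAt 𝓘(ℝ, E) x) q.2) h1).trans (map_zero _)
  have hball : ∀ z, dist z (κ x₀) ≤ f.rIn → z ∈ κ.target ∧ f (κ.symm z) = 1 := by
    intro z hz
    have h1 : z ∈ κ.target := f.closedBall_subset
      ⟨Metric.mem_closedBall.2 (hz.trans f.rIn_lt_rOut.le), by simp⟩
    refine ⟨h1, f.one_of_dist_le (by simpa [hκ] using κ.map_target h1) ?_⟩
    have e : extChartAt 𝓘(ℝ, E) x₀ (κ.symm z) = z := κ.right_inv h1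
    rw [e]; exact hz
  refine ⟨V, hV, ?_, fun u => ?_⟩
  · have hnear : ∀ᶠ x in 𝓝 x₀, x ∈ κ.source ∧ κ x ∈ Metric.ball (κ x₀) (f.rIn / 2) :=
      ((isOpen_extChartAt_source x₀).eventually_mem (mem_extChartAt_source x₀)).and
        ((continuousAt_extChartAt x₀).eventually_mem
          (Metric.ball_mem_nhds _ (by have := f.rIn_pos; positivity)))
    filter_upwards [hnear] with x hx
    -- The open interval must contain the time `1`; doubling the segment is the reason for the
    -- radius `rIn / 2` above.
    have hc : ∀ t ∈ Set.Ioo (-2 : ℝ) 2, dist (κ x₀ + t • (κ x - κ x₀)) (κ x₀) ≤ f.rIn := by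
      intro t ht
      have h1 := Metric.mem_ball.1 hx.2
      rw [dist_eq_norm] at h1
      rw [dist_eq_norm, add_sub_cancel_left, norm_smul, Real.norm_eq_abs]
      have h2 : |t| < 2 := abs_lt.2 ht
      nlinarith [norm_nonneg (κ x - κ x₀), abs_nonneg t]
    have hcurve := isMIntegralCurveOn_extChartAt_symm (X := V (κ x - κ x₀)) (x₀ := x₀)
      (c := fun t : ℝ => κ x₀ + t • (κ x - κ x₀)) (s := Set.Ioo (-2 : ℝ) 2)
      (fun t ht => (hball _ (hc t ht)).1) (fun t ht => by
        have h1 := hball _ (hc t ht)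
        rw [hcoord _ _ (κ.map_target h1.1), h1.2, one_smul]
        simpa using ((hasDerivAt_id t).smul_const (κ x - κ x₀)).const_add (κ x₀))
    have h := eq_flow_of_mem_Ioo (hV.smoothVectorField (κ x - κ x₀)) (by norm_num) hcurve
      (t := 1) (by norm_num)
    simp only [one_smul, add_sub_cancel, zero_smul, add_zero] at h
    rw [κ.left_inv hx.1, κ.left_inv (mem_extChartAt_source x₀)] at h
    exact h.symm
  · refine ⟨tderiv E E κ x₀ u, ?_⟩
    change (f x₀ • tderiv E E κ.symm (κ x₀) (tderiv E E κ x₀ u) : E) = u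
    rw [f.eq_one, one_smul]
    exact mfderiv_extChartAt_symm_mfderiv_extChartAt (mem_extChartAt_source x₀) u

variable {Y : Type*} [NormedAddCommGroup Y] [NormedSpace ℝ Y]
  {Z : Type*} [NormedAddCommGroup Z] [NormedSpace ℝ Z]

/-- The push-forward of a vector field under a homeomorphism. -/
def pushforward (φ : N ≃ₜ N) (X : ∀ x : N, TangentSpace 𝓘(ℝ, E) x) (x : N) :
    TangentSpace 𝓘(ℝ, E) x := (tderiv E E φ (φ.symm x) (X (φ.symm x)) : E)

theorem smoothFamily_pushforward {φ : Y → N ≃ₜ N}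
    (hφ : ContMDiff (𝓘(ℝ, Y).prod 𝓘(ℝ, E)) 𝓘(ℝ, E) ∞ (fun q : Y × N => φ q.1 q.2))
    (hφ' : ContMDiff (𝓘(ℝ, Y).prod 𝓘(ℝ, E)) 𝓘(ℝ, E) ∞ (fun q : Y × N => (φ q.1).symm q.2))
    {V : Z → ∀ x : N, TangentSpace 𝓘(ℝ, E) x} (hV : SmoothFamily V) :
    SmoothFamily (fun q : Y × Z => pushforward (φ q.1) (V q.2)) := by
  intro q₀
  have hp : ContMDiff (𝓘(ℝ, Y × Z).prod 𝓘(ℝ, E)) 𝓘(ℝ, Y) ∞ (fun n : (Y × Z) × N => n.1.1) :=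
    (contMDiff_iff_contDiff.2 contDiff_fst).comp contMDiff_fst
  have hp2 : ContMDiff (𝓘(ℝ, Y × Z).prod 𝓘(ℝ, E)) 𝓘(ℝ, Z) ∞ (fun n : (Y × Z) × N => n.1.2) :=
    (contMDiff_iff_contDiff.2 contDiff_snd).comp contMDiff_fst
  have hg : ContMDiff (𝓘(ℝ, Y × Z).prod 𝓘(ℝ, E)) 𝓘(ℝ, E) ∞
      (fun n : (Y × Z) × N => (φ n.1.1).symm n.2) :=
    ContMDiff.comp (g := fun q : Y × N => (φ q.1).symm q.2)
      (f := fun n : (Y × Z) × N => (n.1.1, n.2)) hφ' (hp.prodMk contMDiff_snd)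
  have hf : ContMDiff ((𝓘(ℝ, Y × Z).prod 𝓘(ℝ, E)).prod 𝓘(ℝ, E)) 𝓘(ℝ, E) ∞
      (Function.uncurry fun (n : (Y × Z) × N) (x : N) => φ n.1.1 x) :=
    ContMDiff.comp (g := fun q : Y × N => φ q.1 q.2)
      (f := fun n : ((Y × Z) × N) × N => (n.1.1.1, n.2)) hφ
      ((hp.comp contMDiff_fst).prodMk contMDiff_snd)
  have h1 := ContMDiffAt.mfderiv (x₀ := q₀) (fun (n : (Y × Z) × N) (x : N) => φ n.1.1 x)
    (fun n : (Y × Z) × N => (φ n.1.1).symm n.2) hf.contMDiffAt hg.contMDiffAt (m := ∞) (by simp)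
  have h2 : ContMDiffAt (𝓘(ℝ, Y × Z).prod 𝓘(ℝ, E)) 𝓘(ℝ, E).tangent ∞
      (fun n : (Y × Z) × N => (⟨(φ n.1.1).symm n.2, V n.1.2 ((φ n.1.1).symm n.2)⟩ :
        TangentBundle 𝓘(ℝ, E) N)) q₀ :=
    ContMDiffAt.comp q₀ (g := fun q : Z × N => (⟨q.2, V q.1 q.2⟩ : TangentBundle 𝓘(ℝ, E) N))
      (f := fun n : (Y × Z) × N => (n.1.2, (φ n.1.1).symm n.2)) hV.contMDiffAt
      (hp2.prodMk hg).contMDiffAt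
  have h3 := ContMDiffAt.clm_apply_of_inCoordinates (F₁ := E) (F₂ := E)
    (E₁ := fun x : N => TangentSpace 𝓘(ℝ, E) x) (E₂ := fun x : N => TangentSpace 𝓘(ℝ, E) x)
    (b₁ := fun n : (Y × Z) × N => (φ n.1.1).symm n.2)
    (b₂ := fun n : (Y × Z) × N => φ n.1.1 ((φ n.1.1).symm n.2))
    (ϕ := fun n => mfderiv 𝓘(ℝ, E) 𝓘(ℝ, E) (φ n.1.1) ((φ n.1.1).symm n.2))
    (v := fun n => V n.1.2 ((φ n.1.1).symm n.2)) h1 h2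
    (by simp only [Homeomorph.apply_symm_apply]; exact contMDiffAt_snd)
  refine h3.congr_of_eventuallyEq (Filter.Eventually.of_forall fun n => ?_)
  have h4 : ∀ (x x' : N) (w : E), x = x' →
      (⟨x, w⟩ : TangentBundle 𝓘(ℝ, E) N) = ⟨x', w⟩ := by rintro x _ w rfl; rfl
  exact h4 _ _ _ ((φ n.1.1).apply_symm_apply n.2).symm

/-- The inverses of a smooth family of diffeomorphisms form a smooth family. -/
theorem contMDiff_family_symm [FiniteDimensional ℝ E] [FiniteDimensional ℝ Y] {φ : Y → N ≃ₜ N}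
    (hφ : ContMDiff (𝓘(ℝ, Y).prod 𝓘(ℝ, E)) 𝓘(ℝ, E) ∞ (fun q : Y × N => φ q.1 q.2))
    (hsymm : ∀ y, ContMDiff 𝓘(ℝ, E) 𝓘(ℝ, E) ∞ (φ y).symm)
    (hc : Continuous (fun q : Y × N => (φ q.1).symm q.2)) :
    ContMDiff (𝓘(ℝ, Y).prod 𝓘(ℝ, E)) 𝓘(ℝ, E) ∞ (fun q : Y × N => (φ q.1).symm q.2) := by
  rintro ⟨y₀, x₀⟩
  set x₁ := (φ y₀).symm x₀ with hx₁
  set κ₀ := extChartAt 𝓘(ℝ, E) x₀ with hκ₀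
  set κ₁ := extChartAt 𝓘(ℝ, E) x₁ with hκ₁
  have hs₀ : x₀ ∈ κ₀.source := mem_extChartAt_source x₀
  have hs₁ : x₁ ∈ κ₁.source := mem_extChartAt_source x₁
  have hφx₁ : φ y₀ x₁ = x₀ := (φ y₀).apply_symm_apply x₀
  set h : Y × E → E := fun q => κ₀ (φ q.1 (κ₁.symm q.2)) with hh
  set f : Y × E → Y × E := fun q => (q.1, h q) with hf
  set c : Y × E → Y × E := fun q => (q.1, κ₁ ((φ q.1).symm (κ₀.symm q.2))) with hcdef
  have hc0 : c (y₀, κ₀ x₀) = (y₀, κ₁ x₁) := by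
    simp only [hcdef, κ₀.left_inv hs₀, hx₁]
  have hhd : ContDiffAt ℝ ∞ h (y₀, κ₁ x₁) := by
    rw [← contMDiffAt_iff_contDiffAt]
    have h1 : ContMDiffAt 𝓘(ℝ, Y × E) (𝓘(ℝ, Y).prod 𝓘(ℝ, E)) ∞
        (fun q : Y × E => (q.1, κ₁.symm q.2)) (y₀, κ₁ x₁) :=
      (contMDiffAt_iff_contDiffAt.2 contDiffAt_fst).prodMk
        (ContMDiffAt.comp (y₀, κ₁ x₁) (contMDiffAt_extChartAt_symm (mem_extChartAt_target x₁))
          (contMDiffAt_iff_contDiffAt.2 contDiffAt_snd))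
    have h2 := ContMDiffAt.comp (y₀, κ₁ x₁) (g := fun q : Y × N => φ q.1 q.2) hφ.contMDiffAt h1
    refine ContMDiffAt.comp (y₀, κ₁ x₁) (g := κ₀) ?_ h2
    change ContMDiffAt 𝓘(ℝ, E) 𝓘(ℝ, E) ∞ κ₀ (φ y₀ (κ₁.symm (κ₁ x₁)))
    rw [κ₁.left_inv hs₁, hφx₁]
    exact contMDiffAt_extChartAt
  -- Near the base point `f ∘ c` is the identity, and `f` is an immersion because `φ y₀` has a
  -- differentiable inverse. The continuous map `c` is therefore smooth.
  have hcc : ContDiffAt ℝ ∞ c (y₀, κ₀ x₀) := by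
    refine contDiffAt_of_comp_immersion (f := f) (by simp) ?_ ?_ ?_ ?_
    · rw [hc0]; exact contDiffAt_fst.prodMk hhd
    · rw [hc0]
      have hd : HasFDerivAt f ((ContinuousLinearMap.fst ℝ Y E).prod (fderiv ℝ h (y₀, κ₁ x₁)))
          (y₀, κ₁ x₁) :=
        hasFDerivAt_fst.prodMk (hhd.differentiableAt (by simp)).hasFDerivAt
      rw [hd.fderiv, injective_iff_map_eq_zero]
      rintro ⟨a, b⟩ hab
      rw [ContinuousLinearMap.prod_apply, Prod.mk_eq_zero] at hab
      obtain ⟨ha, hb⟩ := hab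
      have ha : a = 0 := ha
      subst ha
      have h1 : HasFDerivAt (fun z : E => h (y₀, z))
          (fderiv ℝ h (y₀, κ₁ x₁) ∘L ContinuousLinearMap.inr ℝ Y E) (κ₁ x₁) := by
        refine HasFDerivAt.comp (f := fun z : E => (y₀, z)) (κ₁ x₁)
          (hhd.differentiableAt (by simp)).hasFDerivAt ?_
        exact (hasFDerivAt_const y₀ _).prodMk (hasFDerivAt_id _)
      have hmd : MDifferentiableAt 𝓘(ℝ, E) 𝓘(ℝ, E) (φ y₀) x₁ :=
        (ContMDiff.comp (g := fun q : Y × N => φ q.1 q.2) hφ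
          (contMDiff_const.prodMk contMDiff_id) : ContMDiff 𝓘(ℝ, E) 𝓘(ℝ, E) ∞
          (fun x => φ y₀ x)).mdifferentiableAt (by simp)
      obtain ⟨v, rfl⟩ := (tderiv_extChartAt_bijective hs₁).2 b
      have hy : φ y₀ x₁ ∈ (extChartAt 𝓘(ℝ, E) x₀).source := by rw [hφx₁]; exact hs₀
      have h2 := fderiv_chartRep_tderiv (x₀ := x₁) (y₀ := x₀) hmd hs₁ hy v
      have h3 : fderiv ℝ (chartRep (E := E) (F := E) x₁ x₀ (φ y₀)) (κ₁ x₁) =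
        fderiv ℝ h (y₀, κ₁ x₁) ∘L ContinuousLinearMap.inr ℝ Y E := h1.fderiv
      rw [← hκ₁, h3] at h2
      have h4 : tderiv E E (φ y₀) x₁ v = 0 :=
        (tderiv_extChartAt_bijective hy).1 ((h2.symm.trans hb).trans (map_zero _).symm)
      have h5 := tderiv_comp (g := (φ y₀).symm) (f := φ y₀) (x := x₁)
        ((hsymm y₀).mdifferentiableAt (by simp)) hmd v
      simp only [Homeomorph.symm_apply_apply] at h5
      rw [tderiv_id, h4, map_zero] at h5
      rw [h5, map_zero]; rfl
    · refine continuousAt_fst.prodMk ?_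
      have h1 : ContinuousAt (fun q : Y × E => (q.1, κ₀.symm q.2)) (y₀, κ₀ x₀) :=
        continuousAt_fst.prodMk (ContinuousAt.comp (f := Prod.snd) (g := κ₀.symm)
          (continuousAt_extChartAt_symm x₀) continuousAt_snd)
      have h2 := ContinuousAt.comp (f := fun q : Y × E => (q.1, κ₀.symm q.2))
        (x := (y₀, κ₀ x₀)) hc.continuousAt h1
      refine ContinuousAt.comp (g := κ₁) ?_ h2
      change ContinuousAt κ₁ ((φ y₀).symm (κ₀.symm (κ₀ x₀)))
      rw [κ₀.left_inv hs₀]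
      exact continuousAt_extChartAt x₁
    · refine contDiffAt_id.congr_of_eventuallyEq ?_
      have h1 : ContinuousAt (fun q : Y × E => (φ q.1).symm (κ₀.symm q.2)) (y₀, κ₀ x₀) :=
        ContinuousAt.comp (f := fun q : Y × E => (q.1, κ₀.symm q.2)) hc.continuousAt
          (continuousAt_fst.prodMk (ContinuousAt.comp (f := Prod.snd) (g := κ₀.symm)
            (continuousAt_extChartAt_symm x₀) continuousAt_snd))
      have h2 : κ₁.source ∈ 𝓝 ((φ y₀).symm (κ₀.symm (κ₀ x₀))) := by
        rw [κ₀.left_inv hs₀]; exact (isOpen_extChartAt_source x₁).mem_nhds hs₁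
      have h3 : κ₀.target ∈ 𝓝 (κ₀ x₀) :=
        (isOpen_extChartAt_target x₀).mem_nhds (mem_extChartAt_target x₀)
      have h4 : ContinuousAt (Prod.snd : Y × E → E) (y₀, κ₀ x₀) := continuousAt_snd
      filter_upwards [h1.preimage_mem_nhds h2, h4.preimage_mem_nhds h3] with q hq1 hq2
      refine Prod.ext rfl ?_
      change κ₀ (φ q.1 (κ₁.symm (κ₁ ((φ q.1).symm (κ₀.symm q.2))))) = q.2
      rw [κ₁.left_inv hq1, Homeomorph.apply_symm_apply, κ₀.right_inv hq2]
  have hcs : ContMDiffAt (𝓘(ℝ, Y).prod 𝓘(ℝ, E)) 𝓘(ℝ, E) ∞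
      (fun q : Y × N => κ₁.symm (c (q.1, κ₀ q.2)).2) (y₀, x₀) := by
    have h1 : ContMDiffAt (𝓘(ℝ, Y).prod 𝓘(ℝ, E)) 𝓘(ℝ, Y × E) ∞
        (fun q : Y × N => (q.1, κ₀ q.2)) (y₀, x₀) :=
      contMDiffAt_fst.prodMk_space
        (ContMDiffAt.comp (y₀, x₀) (g := κ₀) contMDiffAt_extChartAt contMDiffAt_snd)
    have h2 := ContMDiffAt.comp (y₀, x₀) (g := fun q => (c q).2)
      (contDiffAt_snd.comp _ hcc).contMDiffAt h1
    refine ContMDiffAt.comp (y₀, x₀) (g := κ₁.symm) ?_ h2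
    change ContMDiffAt 𝓘(ℝ, E) 𝓘(ℝ, E) ∞ κ₁.symm (c (y₀, κ₀ x₀)).2
    rw [hc0]
    exact contMDiffAt_extChartAt_symm (mem_extChartAt_target x₁)
  refine hcs.congr_of_eventuallyEq ?_
  filter_upwards [hc.continuousAt.preimage_mem_nhds
    ((isOpen_extChartAt_source x₁).mem_nhds hs₁), continuousAt_snd.preimage_mem_nhds
      ((isOpen_extChartAt_source x₀).mem_nhds hs₀)] with q hq1 hq2
  change _ = κ₁.symm (κ₁ ((φ q.1).symm (κ₀.symm (κ₀ q.2))))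
  rw [κ₀.left_inv hq2, κ₁.left_inv hq1]

end Families

/-! ### The group generated by the horizontal flows -/

theorem tderiv_flow_curve {E : Type*} [NormedAddCommGroup E] [NormedSpace ℝ E]
    [FiniteDimensional ℝ E] {N : Type*} [TopologicalSpace N] [ChartedSpace E N]
    [IsManifold 𝓘(ℝ, E) ∞ N] [T2Space N] [CompactSpace N]
    {X : ∀ x : N, TangentSpace 𝓘(ℝ, E) x} (hX : SmoothVectorField X) (x : N) :
    MDifferentiableAt 𝓘(ℝ, ℝ) 𝓘(ℝ, E) (fun t => flow hX t x) 0 ∧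
      tderiv ℝ E (fun t => flow hX t x) 0 1 = X x := by
  have h := isMIntegralCurve_flow hX x 0
  refine ⟨HasMFDerivAt.mdifferentiableAt h, ?_⟩
  have h1 := congrArg (fun L : ℝ →L[ℝ] E => L 1) (HasMFDerivAt.tderiv_eq h)
  have e : ∀ w : E, ((1 : ℝ →L[ℝ] ℝ).smulRight w) (1 : ℝ) = w := by intro w; simp
  have e' : ∀ y, y = x → (X y : E) = X x := by rintro y rfl; rfl
  exact h1.trans ((e _).trans (e' _ (flow_zero hX x)))

section Transport

variable {EP EM EG : Type*} [NormedAddCommGroup EP] [NormedSpace ℝ EP]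
  [NormedAddCommGroup EM] [NormedSpace ℝ EM] [NormedAddCommGroup EG] [NormedSpace ℝ EG]
  {P M G : Type*} [TopologicalSpace P] [ChartedSpace EP P] [IsManifold 𝓘(ℝ, EP) ∞ P]
  [TopologicalSpace M] [ChartedSpace EM M] [IsManifold 𝓘(ℝ, EM) ∞ M]
  [TopologicalSpace G] [ChartedSpace EG G] [Group G] [LieGroup 𝓘(ℝ, EG) ∞ G]
  {Q : PrincipalBundle (EP := EP) (EM := EM) (EG := EG) P M G}

/-- Near a point `q₀`, a local section `s` of the bundle divides the points of `P` smoothly. -/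
theorem PrincipalBundle.exists_smooth_division {s : M → P} {q₀ : P}
    (hs : ContMDiffAt 𝓘(ℝ, EM) 𝓘(ℝ, EP) ∞ s (Q.proj q₀))
    (hsec : ∀ᶠ x in 𝓝 (Q.proj q₀), Q.proj (s x) = x) :
    ∃ k : P → G, ContMDiffAt 𝓘(ℝ, EP) 𝓘(ℝ, EG) ∞ k q₀ ∧
      ∀ᶠ p in 𝓝 q₀, Q.act (s (Q.proj p)) (k p) = p := by
  obtain ⟨e, he, he1, -, he2⟩ := Q.exists_trivialization (Q.proj q₀)
  have hs0 : Q.proj (s (Q.proj q₀)) = Q.proj q₀ := hsec.self_of_nhds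
  refine ⟨fun p => (e (s (Q.proj p))).2⁻¹ * (e p).2, ?_, ?_⟩
  · have h1 : ContMDiffAt 𝓘(ℝ, EP) 𝓘(ℝ, EP) ∞ (fun p => s (Q.proj p)) q₀ :=
      ContMDiffAt.comp q₀ hs Q.smooth_proj.contMDiffAt
    have h2 : ContMDiffAt 𝓘(ℝ, EP) 𝓘(ℝ, EG) ∞ (fun p => (e (s (Q.proj p))).2) q₀ :=
      ContMDiffAt.comp q₀ (g := fun q => (e q).2) (f := fun p => s (Q.proj p))
        (he1 _ (e.mem_source.2 (by rw [hs0]; exact he))) h1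
    exact h2.inv.mul (he1 q₀ (e.mem_source.2 he))
  · have hc : ContinuousAt Q.proj q₀ := Q.smooth_proj.continuous.continuousAt
    filter_upwards [hc.eventually hsec, hc.eventually_mem (e.open_baseSet.mem_nhds he)] with p h1 h2
    have hsp : s (Q.proj p) ∈ e.source := e.mem_source.2 (by rw [h1]; exact h2)
    have hap : Q.act (s (Q.proj p)) ((e (s (Q.proj p))).2⁻¹ * (e p).2) ∈ e.source :=
      e.mem_source.2 (by rw [Q.proj_act, h1]; exact h2)
    have hp : p ∈ e.source := e.mem_source.2 h2
    refine e.injOn hap hp (Prod.ext ?_ ?_)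
    · exact (e.coe_fst hap).trans (((Q.proj_act _ _).trans h1).trans (e.coe_fst hp).symm)
    · exact (he2 _ hsp _).trans (mul_inv_cancel_left _ _)

namespace Connection

variable [FiniteDimensional ℝ EP] [T2Space P] [CompactSpace P] (A : Connection Q)

/-- The horizontal flow as a permutation of the total space. -/
def hflowPerm {X : ∀ x : M, TangentSpace 𝓘(ℝ, EM) x} (hX : SmoothVectorField X) (t : ℝ) :
    Equiv.Perm P where
  toFun := A.hflow hX t
  invFun := A.hflow hX (-t)
  left_inv p := by rw [← hflow_add, neg_add_cancel, hflow_zero]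
  right_inv p := by rw [← hflow_add, add_neg_cancel, hflow_zero]

/-- The group of permutations of the total space generated by the horizontal flows. -/
def transportGroup : Subgroup (Equiv.Perm P) :=
  Subgroup.closure {θ | ∃ (X : ∀ x : M, TangentSpace 𝓘(ℝ, EM) x) (hX : SmoothVectorField X) (t : ℝ),
    A.hflowPerm hX t = θ}

variable {A}

theorem hflowPerm_mem {X : ∀ x : M, TangentSpace 𝓘(ℝ, EM) x} (hX : SmoothVectorField X) (t : ℝ) :
    A.hflowPerm hX t ∈ A.transportGroup := Subgroup.subset_closure ⟨X, hX, t, rfl⟩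

/-- The inverse of a generator is the generator at the opposite time, so carrying `R θ` and `R θ⁻¹`
together removes the case of inverses. -/
theorem transportGroup_induction {R : Equiv.Perm P → Prop}
    (gen : ∀ (X : ∀ x : M, TangentSpace 𝓘(ℝ, EM) x) (hX : SmoothVectorField X) (t : ℝ),
      R (A.hflowPerm hX t))
    (one : R 1) (mul : ∀ a b, R a → R b → R (a * b)) {θ : Equiv.Perm P}
    (hθ : θ ∈ A.transportGroup) : R θ := by
  suffices h : R θ ∧ R θ⁻¹ from h.1
  induction hθ using Subgroup.closure_induction with
  | mem x hx =>
    obtain ⟨X, hX, t, rfl⟩ := hx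
    refine ⟨gen X hX t, ?_⟩
    have : (A.hflowPerm hX t)⁻¹ = A.hflowPerm hX (-t) := by
      ext p; rfl
    rw [this]; exact gen X hX (-t)
  | one => exact ⟨one, by rwa [inv_one]⟩
  | mul a b _ _ ha hb => exact ⟨mul a b ha.1 hb.1, by rw [mul_inv_rev]; exact mul _ _ hb.2 ha.2⟩
  | inv a _ ha => exact ⟨ha.2, by rw [inv_inv]; exact ha.1⟩

theorem transport_act {θ : Equiv.Perm P} (hθ : θ ∈ A.transportGroup) :
    ∀ (p : P) (g : G), θ (Q.act p g) = Q.act (θ p) g := by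
  refine transportGroup_induction (R := fun θ => ∀ (p : P) (g : G), θ (Q.act p g) = Q.act (θ p) g)
    (fun X hX t p g => A.hflow_act hX t p g) (fun _ _ => rfl) (fun a b ha hb p g => ?_) hθ
  rw [Equiv.Perm.mul_apply, Equiv.Perm.mul_apply, hb, ha]

theorem contMDiff_transport {θ : Equiv.Perm P} (hθ : θ ∈ A.transportGroup) :
    ContMDiff 𝓘(ℝ, EP) 𝓘(ℝ, EP) ∞ θ :=
  transportGroup_induction (R := fun θ => ContMDiff 𝓘(ℝ, EP) 𝓘(ℝ, EP) ∞ θ)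
    (fun _ hX t => A.contMDiff_hflow hX t) contMDiff_id (fun _ _ ha hb => ha.comp hb) hθ

variable [FiniteDimensional ℝ EM] [T2Space M] [CompactSpace M]

/-- Over a connected base the horizontal flows act transitively up to the structure group. -/
theorem exists_transport_act [ConnectedSpace M] (A : Connection Q) (p₀ p : P) :
    ∃ θ ∈ A.transportGroup, ∃ k : G, Q.act (θ p₀) k = p := by
  suffices h : {x : M | ∃ θ ∈ A.transportGroup, Q.proj (θ p₀) = x} = Set.univ by
    obtain ⟨θ, hθ, hx⟩ : Q.proj p ∈ {x : M | ∃ θ ∈ A.transportGroup, Q.proj (θ p₀) = x} :=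
      h ▸ Set.mem_univ _
    exact ⟨θ, hθ, Q.exists_act_eq hx⟩
  set S := {x : M | ∃ θ ∈ A.transportGroup, Q.proj (θ p₀) = x} with hS
  -- Points near `x₀` are reached from it by a time-one flow and return by the flow at time `-1`;
  -- hence the set of reachable base points is open and closed.
  have key : ∀ x₀, ∀ᶠ x in 𝓝 x₀, (x ∈ S ↔ x₀ ∈ S) := by
    intro x₀
    obtain ⟨V, hV, h1, -⟩ := exists_local_translations (E := EM) x₀
    filter_upwards [h1] with x hx
    generalize hV.smoothVectorField
      (extChartAt 𝓘(ℝ, EM) x₀ x - extChartAt 𝓘(ℝ, EM) x₀ x₀) = hX at hx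
    constructor
    · rintro ⟨θ, hθ, hθx⟩
      refine ⟨_, mul_mem (hflowPerm_mem hX (-1)) hθ, ?_⟩
      change Q.proj (A.hflow hX (-1) (θ p₀)) = x₀
      rw [proj_hflow, hθx, ← congrArg (flow hX (-1)) hx, ← flow_add, neg_add_cancel, flow_zero]
    · rintro ⟨θ, hθ, hθx⟩
      refine ⟨_, mul_mem (hflowPerm_mem hX 1) hθ, ?_⟩
      change Q.proj (A.hflow hX 1 (θ p₀)) = x
      rw [proj_hflow, hθx, hx]
  have hopen : IsOpen S := isOpen_iff_eventually.2 fun x₀ hx₀ => by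
    filter_upwards [key x₀] with x hx using hx.2 hx₀
  have hclosed : IsClosed S := by
    rw [← isOpen_compl_iff]
    exact isOpen_iff_eventually.2 fun x₀ hx₀ => by
      filter_upwards [key x₀] with x hx using fun h => hx₀ (hx.1 h)
  exact IsClopen.eq_univ ⟨hclosed, hopen⟩ ⟨Q.proj p₀, 1, one_mem _, rfl⟩

/-- Horizontal transport of `p₁` gives a local smooth section. -/
theorem exists_transport_section (A : Connection Q) (p₁ : P) :
    ∃ (V : EM → ∀ x : M, TangentSpace 𝓘(ℝ, EM) x) (hV : SmoothFamily V) (κ : M → EM),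
      ContMDiffAt 𝓘(ℝ, EM) 𝓘(ℝ, EM) ∞ κ (Q.proj p₁) ∧
      ContMDiffAt 𝓘(ℝ, EM) 𝓘(ℝ, EP) ∞
        (fun x => A.hflow (hV.smoothVectorField (κ x)) 1 p₁) (Q.proj p₁) ∧
      ∀ᶠ x in 𝓝 (Q.proj p₁), Q.proj (A.hflow (hV.smoothVectorField (κ x)) 1 p₁) = x := by
  obtain ⟨V, hV, h1, -⟩ := exists_local_translations (E := EM) (Q.proj p₁)
  have hκ : ContMDiffAt 𝓘(ℝ, EM) 𝓘(ℝ, EM) ∞ (fun x => extChartAt 𝓘(ℝ, EM) (Q.proj p₁) x -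
      extChartAt 𝓘(ℝ, EM) (Q.proj p₁) (Q.proj p₁)) (Q.proj p₁) :=
    contMDiffAt_extChartAt.sub contMDiffAt_const
  refine ⟨V, hV, _, hκ, ?_, ?_⟩
  · exact ContMDiffAt.comp (Q.proj p₁) ((A.smoothFamily_hlift hV).contMDiff_flow 1).contMDiffAt
      (hκ.prodMk contMDiffAt_const)
  · filter_upwards [h1] with x hx
    rw [proj_hflow, hx]

/-- Every horizontal vector is the velocity of a horizontal flow. Differentiating the commutation
relation at time `0` shows that its image is horizontal, and equivariance handles the vertical
vectors. -/
theorem preservesAt_of_commute {Ψ : P → P} (hΨ : MDifferentiable 𝓘(ℝ, EP) 𝓘(ℝ, EP) Ψ)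
    (hact : ∀ p g, Ψ (Q.act p g) = Q.act (Ψ p) g)
    (hflow : ∀ (X : ∀ x : M, TangentSpace 𝓘(ℝ, EM) x) (hX : SmoothVectorField X) (t : ℝ) (p : P),
      Ψ (A.hflow hX t p) = A.hflow hX t (Ψ p)) (p : P) : A.PreservesAt Ψ p := by
  intro v
  obtain ⟨V, hV, -, h2⟩ := exists_local_translations (E := EM) (Q.proj p)
  obtain ⟨v₀, hv₀⟩ := h2 (tderiv EP EM Q.proj p v)
  set hX := hV.smoothVectorField v₀
  set hL := A.smoothVectorField_hlift hX
  have key : A.formAt (Ψ p) (tderiv EP EP Ψ p (A.hlift p (tderiv EP EM Q.proj p v))) = 0 := by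
    have e1 := tderiv_comp (x := (0 : ℝ)) (hΨ _) (tderiv_flow_curve hL p).1 (1 : ℝ)
    have e2 : (fun t => Ψ (flow hL t p)) = fun t => flow hL t (Ψ p) :=
      funext fun t => hflow _ hX t p
    have e3 : ∀ y, y = p → tderiv EP EP Ψ y = tderiv EP EP Ψ p := by rintro y rfl; rfl
    rw [e2, e3 _ (flow_zero hL p), (tderiv_flow_curve hL p).2, (tderiv_flow_curve hL (Ψ p)).2] at e1
    rw [← hv₀]
    exact (congrArg (A.formAt (Ψ p)) e1).symm.trans (A.formAt_hlift _ _)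
  conv_lhs => rw [A.exists_decomposition p v]
  rw [map_add, map_add, key, zero_add,
    PrincipalBundle.tderiv_fund_of_equivariant (hΨ p) (hact p), formAt_fund]

/-! ### The centralizer of the holonomy group of an irreducible connection. -/

section Centralizer

variable [ConnectedSpace M] {p₀ : P} {z : G}

/-- Every point has the form `θ p₀ · k`. Two such expressions differ by a holonomy element at `p₀`,
which commutes with `z`, so multiplying `k` by `z` on the left is well defined. -/
theorem exists_gauge_of_commute
    (hz : ∀ θ ∈ A.transportGroup, ∀ h, θ p₀ = Q.act p₀ h → z * h = h * z) :
    ∃ Ψ : P → P, ∀ θ ∈ A.transportGroup, ∀ k, Ψ (Q.act (θ p₀) k) = Q.act (θ p₀) (z * k) := by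
  choose θ hθ k hk using A.exists_transport_act p₀
  refine ⟨fun p => Q.act (θ p p₀) (z * k p), fun τ hτ l => ?_⟩
  set p := Q.act (τ p₀) l
  have h1 : ((θ p)⁻¹ * τ) p₀ = Q.act p₀ (k p * l⁻¹) := by
    apply (θ p).injective
    rw [transport_act (hθ p), Q.act_mul, hk p, Equiv.Perm.mul_apply, Equiv.Perm.inv_def, Equiv.apply_symm_apply,
      ← Q.act_mul, mul_inv_cancel, Q.act_one]
  have h2 := hz _ (mul_mem (inv_mem (hθ p)) hτ) _ h1
  have h3 : τ p₀ = Q.act (θ p p₀) (k p * l⁻¹) := by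
    rw [← transport_act (hθ p), ← h1, Equiv.Perm.mul_apply, Equiv.Perm.inv_def, Equiv.apply_symm_apply]
  change Q.act (θ p p₀) (z * k p) = _
  rw [h3, ← Q.act_mul, ← mul_assoc, ← h2]
  group

/-- Locally `p = s(π p) · k(p)`, with `s` a smooth section made of horizontal transports of `p₀` and
`k` smooth; there `Ψ p = s(π p) · (z k(p))`. -/
theorem contMDiff_gauge {Ψ : P → P}
    (hΨ : ∀ θ ∈ A.transportGroup, ∀ k, Ψ (Q.act (θ p₀) k) = Q.act (θ p₀) (z * k)) :
    ContMDiff 𝓘(ℝ, EP) 𝓘(ℝ, EP) ∞ Ψ := by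
  intro q₀
  obtain ⟨θ, hθ, k₀, hk₀⟩ := A.exists_transport_act p₀ q₀
  have hx : Q.proj (θ p₀) = Q.proj q₀ := by rw [← hk₀, Q.proj_act]
  obtain ⟨V, hV, κ, -, hs, hsec⟩ := A.exists_transport_section (θ p₀)
  rw [hx] at hs hsec
  obtain ⟨k, hk, hkp⟩ := PrincipalBundle.exists_smooth_division hs hsec
  have h1 : ContMDiffAt 𝓘(ℝ, EP) 𝓘(ℝ, EP) ∞ (fun p => Q.act
      (A.hflow (hV.smoothVectorField (κ (Q.proj p))) 1 (θ p₀)) (z * k p)) q₀ :=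
    ContMDiffAt.comp q₀ (g := fun q : P × G => Q.act q.1 q.2)
      (f := fun p => (A.hflow (hV.smoothVectorField (κ (Q.proj p))) 1 (θ p₀), z * k p))
      Q.smooth_act.contMDiffAt
      ((ContMDiffAt.comp q₀ hs Q.smooth_proj.contMDiffAt).prodMk (contMDiffAt_const.mul hk))
  refine h1.congr_of_eventuallyEq ?_
  filter_upwards [hkp] with p hp
  have h2 := hΨ _ (mul_mem (hflowPerm_mem (hV.smoothVectorField (κ (Q.proj p))) 1) hθ) (k p)
  conv_lhs => rw [← hp]
  exact h2

/-- For an irreducible connection on a bundle whose structure group has trivial centre, the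
centralizer of the holonomy group is trivial. -/
theorem IsIrreducible.eq_one_of_commute (hirr : A.IsIrreducible) (hZ : Subgroup.center G = ⊥)
    (hz : ∀ θ ∈ A.transportGroup, ∀ h, θ p₀ = Q.act p₀ h → z * h = h * z) : z = 1 := by
  obtain ⟨Ψ, hΨ⟩ := exists_gauge_of_commute hz
  -- `z⁻¹` supplies the inverse of `Ψ`. The resulting gauge transformation commutes with horizontal
  -- flows, so it preserves the connection and is the identity by irreducibility; at `p₀` this says
  -- `z = 1`.
  obtain ⟨Ψ', hΨ'⟩ := exists_gauge_of_commute (z := z⁻¹) (A := A) (p₀ := p₀) fun θ hθ h hh => by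
    have := hz θ hθ h hh
    rw [inv_mul_eq_iff_eq_mul, ← mul_assoc, this, mul_inv_cancel_right]
  have hsurj := A.exists_transport_act p₀
  have hcont := contMDiff_gauge hΨ
  have hcont' := contMDiff_gauge hΨ'
  let ψ : P ≃ₜ P :=
    { toFun := Ψ
      invFun := Ψ'
      left_inv := fun p => by
        obtain ⟨θ, hθ, k, rfl⟩ := hsurj p
        rw [hΨ θ hθ, hΨ' θ hθ, inv_mul_cancel_left]
      right_inv := fun p => by
        obtain ⟨θ, hθ, k, rfl⟩ := hsurj p
        rw [hΨ' θ hθ, hΨ θ hθ, mul_inv_cancel_left]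
      continuous_toFun := hcont.continuous
      continuous_invFun := hcont'.continuous }
  have hact : ∀ p g, Ψ (Q.act p g) = Q.act (Ψ p) g := by
    intro p g
    obtain ⟨θ, hθ, k, rfl⟩ := hsurj p
    rw [← Q.act_mul, hΨ θ hθ, hΨ θ hθ, ← Q.act_mul, mul_assoc]
  have hproj : ∀ p, Q.proj (Ψ p) = Q.proj p := by
    intro p
    obtain ⟨θ, hθ, k, rfl⟩ := hsurj p
    rw [hΨ θ hθ, Q.proj_act, Q.proj_act]
  have hcomm : ∀ (X : ∀ x : M, TangentSpace 𝓘(ℝ, EM) x) (hX : SmoothVectorField X) (t : ℝ) (p : P),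
      Ψ (A.hflow hX t p) = A.hflow hX t (Ψ p) := by
    intro X hX t p
    obtain ⟨θ, hθ, k, rfl⟩ := hsurj p
    rw [hΨ θ hθ, A.hflow_act, A.hflow_act]
    exact hΨ _ (mul_mem (hflowPerm_mem hX t) hθ) k
  have hpres := preservesAt_of_commute (hcont.mdifferentiable (by simp)) hact hcomm
  have hmem : ψ ∈ A.aut := ⟨hcont, hcont', hact, hpres⟩
  obtain ⟨c, hc, hcp⟩ := (hirr ψ).1 ⟨hmem, hproj⟩
  rw [hZ, Subgroup.mem_bot] at hc
  have h1 : Q.act p₀ z = Q.act p₀ 1 := by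
    have h2 := hΨ 1 (one_mem _) 1
    have h3 : Ψ p₀ = p₀ := by
      have := hcp p₀
      rwa [hc, Q.act_one] at this
    rw [Equiv.Perm.one_apply, Q.act_one, mul_one, h3] at h2
    rw [← h2, Q.act_one]
  exact Q.eq_of_act_eq h1

theorem smoothVectorField_fund (A : Connection Q) (X : EG) :
    SmoothVectorField (fun p => Q.fund p X : ∀ p : P, TangentSpace 𝓘(ℝ, EP) p) := by
  intro p
  have hw : ContMDiffAt 𝓘(ℝ, EP) 𝓘(ℝ, EM).tangent ∞
      (fun q => (⟨Q.proj q, (0 : EM)⟩ : TangentBundle 𝓘(ℝ, EM) M)) p := by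
    refine (contMDiffAt_tangentBundle_iff (x₀ := Q.proj p) (by simp)
      (mem_extChartAt_source _)).2 ⟨Q.smooth_proj.contMDiffAt, ?_⟩
    refine (contMDiffAt_const (c := (0 : EM))).congr_of_eventuallyEq
      (Filter.Eventually.of_forall fun q => ?_)
    exact map_zero (tderiv EM EM (extChartAt 𝓘(ℝ, EM) (Q.proj p)) (Q.proj q))
  have h := A.contMDiffAt_coframe (f := fun q : P => q) contMDiffAt_id hw
    (contMDiffAt_const (c := X)) (fun _ => rfl)
  refine h.congr_of_eventuallyEq (Filter.Eventually.of_forall fun q => ?_)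
  have h1 : Q.fund q X = A.coframe q (0, X) := A.eq_coframe (A.frame_fund q X)
  exact congrArg (fun v : EP => (⟨q, v⟩ : TangentBundle 𝓘(ℝ, EP) P)) h1

theorem proj_flow_fund (A : Connection Q) (X : EG) (t : ℝ) (p : P) :
    Q.proj (flow (A.smoothVectorField_fund X) t p) = Q.proj p := by
  have h0 : SmoothVectorField (fun _ => (0 : EM) : ∀ x : M, TangentSpace 𝓘(ℝ, EM) x) := by
    intro x
    refine (contMDiffAt_tangentBundle_iff (x₀ := x) (by simp)
      (mem_extChartAt_source _)).2 ⟨contMDiffAt_id, ?_⟩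
    refine (contMDiffAt_const (c := (0 : EM))).congr_of_eventuallyEq
      (Filter.Eventually.of_forall fun q => ?_)
    exact map_zero (tderiv EM EM (extChartAt 𝓘(ℝ, EM) x) q)
  have h1 := flow_map (A.smoothVectorField_fund X) h0 (f := Q.proj) Q.mdiff_proj
    (fun q => Q.tderiv_proj_fund q X) t p
  have h2 := eq_flow h0 (isMIntegralCurve_const (x := Q.proj p) rfl) t
  exact h1.trans h2.symm

/-- For an irreducible connection on a bundle whose structure group has trivial centre, the
holonomy group has no fixed vectors in the Lie algebra. -/
theorem IsIrreducible.eq_zero_of_fixed (hirr : A.IsIrreducible) (hZ : Subgroup.center G = ⊥)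
    {X : EG} (hX : ∀ θ ∈ A.transportGroup, ∀ h, θ p₀ = Q.act p₀ h →
      tderiv EG EG (fun k : G => h⁻¹ * k * h⁻¹⁻¹) 1 X = X) : X = 0 := by
  set hF := A.smoothVectorField_fund X
  have hfix : ∀ t, flow hF t p₀ = p₀ := by
    intro t
    obtain ⟨z, hz⟩ := Q.exists_act_eq (A.proj_flow_fund X t p₀).symm
    -- The flow of the fundamental field moves `p₀` to `p₀ z`. It commutes with `θ` by equivariance,
    -- and with right translation by `h` because `h` fixes `X`; comparing at `θ p₀ = p₀ h` gives `z
    -- h = h z`.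
    have hz1 : z = 1 := by
      refine hirr.eq_one_of_commute hZ (p₀ := p₀) fun θ hθ h hh => ?_
      have hθd : MDifferentiable 𝓘(ℝ, EP) 𝓘(ℝ, EP) θ :=
        (contMDiff_transport hθ).mdifferentiable (by simp)
      have h1 := flow_map hF hF hθd (fun q => PrincipalBundle.tderiv_fund_of_equivariant (hθd q)
        (transport_act hθ q) X) t p₀
      have h2 := flow_map hF hF (f := fun q => Q.act q h) (Q.mdiff_act_left h) (fun q => by
        refine (Q.tderiv_act_fund q h X).trans ?_
        rw [hX θ hθ h hh]) t p₀
      rw [← hz, transport_act hθ, hh] at h1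
      rw [← hz, ← h1, ← Q.act_mul, ← Q.act_mul] at h2
      exact Q.eq_of_act_eq h2
    rw [← hz, hz1, Q.act_one]
  have h1 := (tderiv_flow_curve hF p₀).2
  rw [show (fun t => flow hF t p₀) = fun _ => p₀ from funext hfix, tderiv_const] at h1
  have h4 : (0 : EP) = Q.fund p₀ X := h1
  rw [← A.formAt_fund p₀ X, ← h4, map_zero]

end Centralizer

end Connection

end Transport

/-! ### Smoothness of families of automorphisms of an irreducible connection -/

section AutomorphismFamilies

variable {EP EM EG : Type*} [NormedAddCommGroup EP] [NormedSpace ℝ EP]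
  [NormedAddCommGroup EM] [NormedSpace ℝ EM] [NormedAddCommGroup EG] [NormedSpace ℝ EG]
  {P M G : Type*} [TopologicalSpace P] [ChartedSpace EP P] [IsManifold 𝓘(ℝ, EP) ∞ P]
  [TopologicalSpace M] [ChartedSpace EM M] [IsManifold 𝓘(ℝ, EM) ∞ M]
  [TopologicalSpace G] [ChartedSpace EG G] [Group G] [LieGroup 𝓘(ℝ, EG) ∞ G]
  {Q : PrincipalBundle (EP := EP) (EM := EM) (EG := EG) P M G}
  [FiniteDimensional ℝ EP] [T2Space P] [CompactSpace P] {A : Connection Q}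

namespace Connection

/-- An automorphism covering `φ` maps horizontal lifts of `X` to horizontal lifts of the
push-forward, so `flow_map` applies. -/
theorem map_hflow_of_mem_aut {ψ : P ≃ₜ P} (hψ : ψ ∈ A.aut) {φ : M ≃ₜ M}
    (hφ : MDifferentiable 𝓘(ℝ, EM) 𝓘(ℝ, EM) φ) (hcov : ∀ p, Q.proj (ψ p) = φ (Q.proj p))
    {X : ∀ x : M, TangentSpace 𝓘(ℝ, EM) x} (hX : SmoothVectorField X)
    (hX' : SmoothVectorField (pushforward φ X)) (t : ℝ) (p : P) :
    ψ (A.hflow hX t p) = A.hflow hX' t (ψ p) := by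
  have hψd : MDifferentiable 𝓘(ℝ, EP) 𝓘(ℝ, EP) ψ := hψ.1.mdifferentiable (by simp)
  refine flow_map (A.smoothVectorField_hlift hX) (A.smoothVectorField_hlift hX') hψd
    (fun q => ?_) t p
  refine A.eq_hlift ?_ ?_
  · have h1 := tderiv_comp (Q.mdiff_proj (ψ q)) (hψd q) (A.hlift q (X (Q.proj q)))
    have h2 := tderiv_comp (hφ (Q.proj q)) (Q.mdiff_proj q) (A.hlift q (X (Q.proj q)))
    rw [show (fun y => Q.proj (ψ y)) = fun y => φ (Q.proj y) from funext hcov] at h1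
    have h3 := congrArg (tderiv EM EM φ (Q.proj q)) (A.tderiv_proj_hlift q (X (Q.proj q)))
    have h4 : ∀ x, x = Q.proj q → tderiv EM EM φ (Q.proj q) (X (Q.proj q)) =
        tderiv EM EM φ x (X x) := by rintro x rfl; rfl
    refine h1.symm.trans (h2.trans (h3.trans (h4 _ ?_)))
    rw [hcov, Homeomorph.symm_apply_apply]
  · exact (hψ.2.2.2 q _).trans (A.formAt_hlift q _)

variable [FiniteDimensional ℝ EM] [T2Space M] [CompactSpace M]
  {Y : Type*} [NormedAddCommGroup Y] [NormedSpace ℝ Y] [FiniteDimensional ℝ Y]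
  {Z : Type*} [NormedAddCommGroup Z] [NormedSpace ℝ Z] [FiniteDimensional ℝ Z]
  {ψ : Y → P ≃ₜ P} {φ : Y → M ≃ₜ M}

theorem mdifferentiable_of_family
    (hφ : ContMDiff (𝓘(ℝ, Y).prod 𝓘(ℝ, EM)) 𝓘(ℝ, EM) ∞ (fun q : Y × M => φ q.1 q.2)) (y : Y) :
    MDifferentiable 𝓘(ℝ, EM) 𝓘(ℝ, EM) (φ y) :=
  ContMDiff.mdifferentiable (n := ∞) (ContMDiff.comp (g := fun q : Y × M => φ q.1 q.2) hφ
    (contMDiff_const.prodMk contMDiff_id)) (by simp)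

/-- The conjugate is the horizontal flow of the pushed-forward family, an expression in which `ψ` no
longer occurs. This gives smoothness in the parameter without assuming any for `ψ`. -/
theorem contMDiff_conj_hflow (hψ : ∀ y, ψ y ∈ A.aut)
    (hcov : ∀ y p, Q.proj (ψ y p) = φ y (Q.proj p))
    (hφ : ContMDiff (𝓘(ℝ, Y).prod 𝓘(ℝ, EM)) 𝓘(ℝ, EM) ∞ (fun q : Y × M => φ q.1 q.2))
    (hφ' : ContMDiff (𝓘(ℝ, Y).prod 𝓘(ℝ, EM)) 𝓘(ℝ, EM) ∞ (fun q : Y × M => (φ q.1).symm q.2))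
    {V : Z → ∀ x : M, TangentSpace 𝓘(ℝ, EM) x} (hV : SmoothFamily V) (t : ℝ) :
    ContMDiff (𝓘(ℝ, Y × Z).prod 𝓘(ℝ, EP)) 𝓘(ℝ, EP) ∞ (fun q : (Y × Z) × P =>
      ψ q.1.1 (A.hflow (hV.smoothVectorField q.1.2) t ((ψ q.1.1).symm q.2))) := by
  have : CompleteSpace (Y × Z) := FiniteDimensional.complete ℝ _
  have hW := smoothFamily_pushforward hφ hφ' hV
  refine ((A.smoothFamily_hlift hW).contMDiff_flow t).congr fun q => ?_
  rw [map_hflow_of_mem_aut (hψ q.1.1) (mdifferentiable_of_family hφ q.1.1) (hcov q.1.1)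
    (hV.smoothVectorField q.1.2) (hW.smoothVectorField q.1), Homeomorph.apply_symm_apply]
  rfl

theorem contMDiff_conj_transport (hψ : ∀ y, ψ y ∈ A.aut)
    (hcov : ∀ y p, Q.proj (ψ y p) = φ y (Q.proj p))
    (hφ : ContMDiff (𝓘(ℝ, Y).prod 𝓘(ℝ, EM)) 𝓘(ℝ, EM) ∞ (fun q : Y × M => φ q.1 q.2))
    (hφ' : ContMDiff (𝓘(ℝ, Y).prod 𝓘(ℝ, EM)) 𝓘(ℝ, EM) ∞ (fun q : Y × M => (φ q.1).symm q.2))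
    {θ : Equiv.Perm P} (hθ : θ ∈ A.transportGroup) :
    ContMDiff (𝓘(ℝ, Y).prod 𝓘(ℝ, EP)) 𝓘(ℝ, EP) ∞
      (fun q : Y × P => ψ q.1 (θ ((ψ q.1).symm q.2))) := by
  refine transportGroup_induction (R := fun θ => ContMDiff (𝓘(ℝ, Y).prod 𝓘(ℝ, EP)) 𝓘(ℝ, EP) ∞
      (fun q : Y × P => ψ q.1 (θ ((ψ q.1).symm q.2)))) (fun X hX t => ?_) ?_ ?_ hθ
  · have hV : SmoothFamily (fun _ : ℝ => X) :=
      ContMDiff.comp (g := fun x => (⟨x, X x⟩ : TangentBundle 𝓘(ℝ, EM) M)) hX contMDiff_snd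
    have hp : ContMDiff (𝓘(ℝ, Y).prod 𝓘(ℝ, EP)) 𝓘(ℝ, Y × ℝ) ∞
        (fun q : Y × P => (q.1, (0 : ℝ))) := contMDiff_fst.prodMk_space contMDiff_const
    exact ContMDiff.comp (contMDiff_conj_hflow hψ hcov hφ hφ' hV t) (hp.prodMk contMDiff_snd)
  · refine contMDiff_snd.congr fun q => ?_
    rw [Equiv.Perm.one_apply, Homeomorph.apply_symm_apply]
  · intro a b ha hb
    refine (ContMDiff.comp ha (contMDiff_fst.prodMk hb)).congr fun q => ?_
    simp only [Function.comp_apply, Homeomorph.symm_apply_apply, Equiv.Perm.mul_apply]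

variable [FiniteDimensional ℝ EG] [ConnectedSpace M]

/-- Finitely many elements of the holonomy group suffice to detect the absence of fixed vectors. -/
theorem IsIrreducible.exists_finset_holonomy (hirr : A.IsIrreducible)
    (hZ : Subgroup.center G = ⊥) (p₀ : P) :
    ∃ t : Finset {i : Equiv.Perm P × G // i.1 ∈ A.transportGroup ∧ i.1 p₀ = Q.act p₀ i.2},
      ∀ X : EG, (∀ i ∈ t,
        tderiv EG EG (fun k : G => i.1.2⁻¹ * k * i.1.2⁻¹⁻¹) 1 X = X) → X = 0 := by
  let W : {i : Equiv.Perm P × G // i.1 ∈ A.transportGroup ∧ i.1 p₀ = Q.act p₀ i.2} →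
      Submodule ℝ EG := fun i =>
    LinearMap.eqLocus (tderiv EG EG (fun k : G => i.1.2⁻¹ * k * i.1.2⁻¹⁻¹) 1 : EG →ₗ[ℝ] EG)
      LinearMap.id
  -- In finite dimension some finite intersection of the fixed spaces is contained in all of them.
  obtain ⟨t, ht⟩ := Finset.exists_inf_le W
  refine ⟨t, fun X hX => hirr.eq_zero_of_fixed hZ (p₀ := p₀) fun θ hθ h hh => ?_⟩
  have h1 : X ∈ t.inf W := by
    rw [Submodule.mem_finsetInf]
    exact hX
  exact ht ⟨(θ, h), hθ, hh⟩ h1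

/-- The point `q = ψ y p₀` satisfies `π(q) = φ y (π p₀)` and `Θ i (y, q) = q hᵢ` for finitely many
holonomy elements `hᵢ`, equations smooth in `(y, q)` by `contMDiff_conj_transport`. A solution of
the equations linearized in `q` is vertical, generated by a vector fixed under every `Ad(hᵢ⁻¹)`,
hence zero. So the equations, together with `y`, define an immersion `f`, and
`contDiffAt_of_comp_immersion` applies to the continuous orbit. -/
theorem IsIrreducible.contMDiff_orbit (hirr : A.IsIrreducible) (hZ : Subgroup.center G = ⊥)
    (hψ : ∀ y, ψ y ∈ A.aut) (hcov : ∀ y p, Q.proj (ψ y p) = φ y (Q.proj p))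
    (hφ : ContMDiff (𝓘(ℝ, Y).prod 𝓘(ℝ, EM)) 𝓘(ℝ, EM) ∞ (fun q : Y × M => φ q.1 q.2))
    (hφ' : ContMDiff (𝓘(ℝ, Y).prod 𝓘(ℝ, EM)) 𝓘(ℝ, EM) ∞ (fun q : Y × M => (φ q.1).symm q.2))
    {p₀ : P} (hcont : Continuous fun y => ψ y p₀) :
    ContMDiff 𝓘(ℝ, Y) 𝓘(ℝ, EP) ∞ fun y => ψ y p₀ := by
  intro y₀
  obtain ⟨t, ht⟩ := hirr.exists_finset_holonomy hZ p₀
  set q₀ := ψ y₀ p₀ with hq₀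
  set κ := extChartAt 𝓘(ℝ, EP) q₀ with hκ
  have hs : q₀ ∈ κ.source := mem_extChartAt_source q₀
  let Θ : t → Y × P → P := fun i q => ψ q.1 (i.1.1.1 ((ψ q.1).symm q.2))
  have hΘ : ∀ i, ContMDiff (𝓘(ℝ, Y).prod 𝓘(ℝ, EP)) 𝓘(ℝ, EP) ∞ (Θ i) := fun i =>
    contMDiff_conj_transport hψ hcov hφ hφ' i.1.2.1
  have hΘp : ∀ i y, Θ i (y, ψ y p₀) = Q.act (ψ y p₀) i.1.1.2 := by
    intro i y
    change ψ y (i.1.1.1 ((ψ y).symm (ψ y p₀))) = _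
    rw [Homeomorph.symm_apply_apply, i.1.2.2, (hψ y).2.2.1]
  let κ' : t → PartialEquiv P EP := fun i => extChartAt 𝓘(ℝ, EP) (Q.act q₀ i.1.1.2)
  let f : Y × EP → Y × EM × (t → EP) := fun q => (q.1,
    chartRep (E := EP) (F := EM) q₀ (Q.proj q₀) Q.proj q.2, fun i => κ' i (Θ i (q.1, κ.symm q.2)) -
      chartRep (E := EP) (F := EP) q₀ (Q.act q₀ i.1.1.2) (fun p => Q.act p i.1.1.2) q.2)
  let c : Y → Y × EP := fun y => (y, κ (ψ y p₀))
  have hproj : ContDiffAt ℝ ∞ (chartRep (E := EP) (F := EM) q₀ (Q.proj q₀) Q.proj) (κ q₀) :=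
    ContMDiffAt.contDiffAt_chartRep le_rfl Q.smooth_proj.contMDiffAt hs (mem_extChartAt_source _)
  have hact : ∀ i : t, ContDiffAt ℝ ∞ (chartRep (E := EP) (F := EP) q₀ (Q.act q₀ i.1.1.2)
      (fun p => Q.act p i.1.1.2)) (κ q₀) := fun i =>
    ContMDiffAt.contDiffAt_chartRep le_rfl (Q.contMDiff_act_left _).contMDiffAt hs
      (mem_extChartAt_source _)
  have hΘd : ∀ i, ContDiffAt ℝ ∞ (fun q : Y × EP => κ' i (Θ i (q.1, κ.symm q.2)))
      (y₀, κ q₀) := by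
    intro i
    rw [← contMDiffAt_iff_contDiffAt]
    have h1 : ContMDiffAt 𝓘(ℝ, Y × EP) (𝓘(ℝ, Y).prod 𝓘(ℝ, EP)) ∞
        (fun q : Y × EP => (q.1, κ.symm q.2)) (y₀, κ q₀) :=
      (contMDiffAt_iff_contDiffAt.2 contDiffAt_fst).prodMk
        (ContMDiffAt.comp (y₀, κ q₀) (contMDiffAt_extChartAt_symm (mem_extChartAt_target q₀))
          (contMDiffAt_iff_contDiffAt.2 contDiffAt_snd))
    have h2 := ContMDiffAt.comp (y₀, κ q₀) (g := Θ i) (hΘ i).contMDiffAt h1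
    refine ContMDiffAt.comp (y₀, κ q₀) (g := κ' i) ?_ h2
    change ContMDiffAt 𝓘(ℝ, EP) 𝓘(ℝ, EP) ∞ (κ' i) (Θ i (y₀, κ.symm (κ q₀)))
    rw [κ.left_inv hs, hΘp i y₀]
    exact contMDiffAt_extChartAt
  have hfd : ContDiffAt ℝ ∞ f (y₀, κ q₀) := by
    refine contDiffAt_fst.prodMk (ContDiffAt.prodMk ?_ (contDiffAt_pi.2 fun i => ?_))
    · exact ContDiffAt.comp (𝕜 := ℝ) (n := ∞) (f := Prod.snd) (y₀, κ q₀) hproj contDiffAt_snd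
    · exact (hΘd i).sub
        (ContDiffAt.comp (𝕜 := ℝ) (n := ∞) (f := Prod.snd) (y₀, κ q₀) (hact i) contDiffAt_snd)
  have hcd : ContDiffAt ℝ ∞ c y₀ := by
    refine contDiffAt_of_comp_immersion (f := f) (by simp) hfd ?_ ?_ ?_
    · change Function.Injective (fderiv ℝ f (y₀, κ q₀))
      have hfder := (hfd.differentiableAt (by simp)).hasFDerivAt
      rw [injective_iff_map_eq_zero]
      rintro ⟨a, b⟩ hab
      have ha : a = 0 := by
        have h1 : HasFDerivAt (fun q : Y × EP => q.1)
            (ContinuousLinearMap.fst ℝ Y _ ∘L fderiv ℝ f (y₀, κ q₀)) (y₀, κ q₀) := hfder.fst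
        have h2 := congrArg (fun L : Y × EP →L[ℝ] Y => L (a, b)) (h1.unique hasFDerivAt_fst)
        have h3 : (fderiv ℝ f (y₀, κ q₀) (a, b)).1 = a := h2
        rw [← h3, hab]; rfl
      subst ha
      have hg : HasFDerivAt (fun z : EP => f (y₀, z))
          (fderiv ℝ f (y₀, κ q₀) ∘L ContinuousLinearMap.inr ℝ Y EP) (κ q₀) := by
        refine HasFDerivAt.comp (f := fun z : EP => (y₀, z)) (κ q₀) hfder ?_
        exact (hasFDerivAt_const y₀ _).prodMk (hasFDerivAt_id _)
      have hΘ₀ : ∀ i, ContMDiff 𝓘(ℝ, EP) 𝓘(ℝ, EP) ∞ (fun p => Θ i (y₀, p)) := fun i =>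
        ContMDiff.comp (hΘ i) (contMDiff_const.prodMk contMDiff_id)
      have hΘ₀q : ∀ i, Θ i (y₀, q₀) = Q.act q₀ i.1.1.2 := fun i => hΘp i y₀
      have hmem : ∀ i : t, Θ i (y₀, q₀) ∈
          (extChartAt 𝓘(ℝ, EP) (Q.act q₀ i.1.1.2)).source := fun i => by
        rw [hΘ₀q i]; exact mem_extChartAt_source _
      have hΘc : ∀ i : t, ContDiffAt ℝ ∞ (chartRep (E := EP) (F := EP) q₀ (Q.act q₀ i.1.1.2)
          (fun p => Θ i (y₀, p))) (κ q₀) := fun i =>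
        ContMDiffAt.contDiffAt_chartRep le_rfl (hΘ₀ i).contMDiffAt hs (hmem i)
      have hg2 : HasFDerivAt (chartRep (E := EP) (F := EM) q₀ (Q.proj q₀) Q.proj)
          (ContinuousLinearMap.fst ℝ EM _ ∘L ContinuousLinearMap.snd ℝ Y _ ∘L
            (fderiv ℝ f (y₀, κ q₀) ∘L ContinuousLinearMap.inr ℝ Y EP)) (κ q₀) := hg.snd.fst
      have hg3 : ∀ i : t, HasFDerivAt (fun z => chartRep (E := EP) (F := EP) q₀
          (Q.act q₀ i.1.1.2) (fun p => Θ i (y₀, p)) z - chartRep (E := EP) (F := EP) q₀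
          (Q.act q₀ i.1.1.2) (fun p => Q.act p i.1.1.2) z)
          (ContinuousLinearMap.proj i ∘L ContinuousLinearMap.snd ℝ EM _ ∘L
            ContinuousLinearMap.snd ℝ Y _ ∘L
            (fderiv ℝ f (y₀, κ q₀) ∘L ContinuousLinearMap.inr ℝ Y EP)) (κ q₀) := fun i =>
        hasFDerivAt_pi'.1 hg.snd.snd i
      obtain ⟨v, rfl⟩ := (tderiv_extChartAt_bijective hs).2 b
      have hv : tderiv EP EM Q.proj q₀ v = 0 := by
        have h1 := fderiv_chartRep_tderiv (x₀ := q₀) (y₀ := Q.proj q₀) (Q.mdiff_proj q₀) hs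
          (mem_extChartAt_source _) v
        rw [← hκ, hg2.fderiv] at h1
        refine (tderiv_extChartAt_bijective (mem_extChartAt_source (I := 𝓘(ℝ, EM))
          (Q.proj q₀))).1 (h1.symm.trans ?_)
        rw [map_zero]
        exact congrArg (fun w : Y × EM × (t → EP) => w.2.1) hab
      obtain ⟨X, rfl⟩ := Q.exists_fund_eq hv
      have hX : X = 0 := by
        refine ht X fun i hi => ?_
        have h1 := fderiv_chartRep_tderiv (x₀ := q₀) (y₀ := Q.act q₀ i.1.2)
          ((hΘ₀ ⟨i, hi⟩).mdifferentiableAt (by simp)) hs (hmem ⟨i, hi⟩) (Q.fund q₀ X)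
        have h2 := fderiv_chartRep_tderiv (x₀ := q₀) (y₀ := Q.act q₀ i.1.2)
          (Q.mdiff_act_left i.1.2 q₀) hs (mem_extChartAt_source _) (Q.fund q₀ X)
        have h3 := (((hΘc ⟨i, hi⟩).differentiableAt (by simp)).hasFDerivAt.sub
          ((hact ⟨i, hi⟩).differentiableAt (by simp)).hasFDerivAt).unique (hg3 ⟨i, hi⟩)
        have h4 := congrArg (fun L : EP →L[ℝ] EP => L (tderiv EP EP κ q₀ (Q.fund q₀ X))) h3
        have h5 : fderiv ℝ (chartRep (E := EP) (F := EP) q₀ (Q.act q₀ i.1.2)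
            (fun p => Θ ⟨i, hi⟩ (y₀, p))) (κ q₀) (tderiv EP EP κ q₀ (Q.fund q₀ X)) -
            fderiv ℝ (chartRep (E := EP) (F := EP) q₀ (Q.act q₀ i.1.2)
            (fun p => Q.act p i.1.2)) (κ q₀) (tderiv EP EP κ q₀ (Q.fund q₀ X)) = 0 :=
          h4.trans (congrArg (fun w : Y × EM × (t → EP) => w.2.2 ⟨i, hi⟩) hab)
        rw [sub_eq_zero] at h5
        have h6 := (h1.symm.trans h5).trans h2
        have hequiv : ∀ g : G, Θ ⟨i, hi⟩ (y₀, Q.act q₀ g) = Q.act (Θ ⟨i, hi⟩ (y₀, q₀)) g := by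
          intro g
          have e : (ψ y₀).symm (Q.act q₀ g) = Q.act ((ψ y₀).symm q₀) g := by
            rw [hq₀, ← (hψ y₀).2.2.1, Homeomorph.symm_apply_apply, Homeomorph.symm_apply_apply]
          change ψ y₀ (i.1.1 ((ψ y₀).symm (Q.act q₀ g))) = _
          rw [e, transport_act i.2.1, (hψ y₀).2.2.1]
        -- `Θ i` keeps the generator `X`, whereas right translation by `hᵢ` replaces it by `Ad(hᵢ⁻¹)
        -- X`. The linearized equation equates the two.
        have h7 := PrincipalBundle.tderiv_fund_of_equivariant (Q := Q)
          (ψ := fun p => Θ ⟨i, hi⟩ (y₀, p)) ((hΘ₀ ⟨i, hi⟩).mdifferentiableAt (by simp)) hequiv X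
        rw [h7, Q.tderiv_act_fund, hΘ₀q ⟨i, hi⟩] at h6
        have h8 := (tderiv_extChartAt_bijective
          (mem_extChartAt_source (I := 𝓘(ℝ, EP)) (Q.act q₀ i.1.2))).1 h6
        have h9 := congrArg (A.formAt (Q.act q₀ i.1.2)) h8
        rw [A.formAt_fund] at h9
        exact ((A.formAt_fund _ _).symm.trans h9.symm)
      rw [hX, map_zero, map_zero]; rfl
    · exact continuousAt_id.prodMk (ContinuousAt.comp (g := κ) (continuousAt_extChartAt q₀)
        hcont.continuousAt)
    · have h1 : ContDiffAt ℝ ∞ (fun y => extChartAt 𝓘(ℝ, EM) (Q.proj q₀) (φ y (Q.proj p₀)))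
          y₀ := by
        rw [← contMDiffAt_iff_contDiffAt]
        have h2 : ContMDiffAt 𝓘(ℝ, Y) 𝓘(ℝ, EM) ∞ (fun y => φ y (Q.proj p₀)) y₀ :=
          ContMDiffAt.comp y₀ (g := fun q : Y × M => φ q.1 q.2) hφ.contMDiffAt
            (contMDiffAt_id.prodMk contMDiffAt_const)
        refine ContMDiffAt.comp y₀ (g := extChartAt 𝓘(ℝ, EM) (Q.proj q₀)) ?_ h2
        rw [← hcov y₀]
        exact contMDiffAt_extChartAt
      have h3 : ContDiffAt ℝ ∞ (fun y => ((y, extChartAt 𝓘(ℝ, EM) (Q.proj q₀)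
          (φ y (Q.proj p₀)), 0) : Y × EM × (t → EP))) y₀ :=
        contDiffAt_id.prodMk (h1.prodMk contDiffAt_const)
      refine h3.congr_of_eventuallyEq ?_
      filter_upwards [hcont.continuousAt.preimage_mem_nhds
        ((isOpen_extChartAt_source q₀).mem_nhds hs)] with y hy
      refine Prod.ext rfl (Prod.ext ?_ (funext fun i => ?_))
      · refine (chartRep_extChartAt hy).trans ?_
        rw [hcov y]
      · change κ' i (Θ i (y, κ.symm (κ (ψ y p₀)))) - chartRep (E := EP) (F := EP) q₀
          (Q.act q₀ i.1.1.2) (fun p => Q.act p i.1.1.2) (κ (ψ y p₀)) = 0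
        rw [κ.left_inv hy, hΘp i y, sub_eq_zero]
        exact (chartRep_extChartAt (f := fun p => Q.act p i.1.1.2) hy).symm
  have hfin : ContMDiffAt 𝓘(ℝ, Y) 𝓘(ℝ, EP) ∞ (fun y => κ.symm (c y).2) y₀ :=
    ContMDiffAt.comp y₀ (g := κ.symm)
      (contMDiffAt_extChartAt_symm (mem_extChartAt_target q₀))
      (contMDiffAt_iff_contDiffAt.2 (contDiffAt_snd.comp _ hcd))
  refine hfin.congr_of_eventuallyEq ?_
  filter_upwards [hcont.continuousAt.preimage_mem_nhds
    ((isOpen_extChartAt_source q₀).mem_nhds hs)] with y hy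
  exact (κ.left_inv hy).symm

/-- A continuous family of automorphisms of an irreducible connection is smooth as soon as the
family of diffeomorphisms of the base that it covers is smooth. -/
theorem IsIrreducible.contMDiff_family (hirr : A.IsIrreducible) (hZ : Subgroup.center G = ⊥)
    (hψ : ∀ y, ψ y ∈ A.aut) (hcov : ∀ y p, Q.proj (ψ y p) = φ y (Q.proj p))
    (hφ : ContMDiff (𝓘(ℝ, Y).prod 𝓘(ℝ, EM)) 𝓘(ℝ, EM) ∞ (fun q : Y × M => φ q.1 q.2))
    (hφ' : ContMDiff (𝓘(ℝ, Y).prod 𝓘(ℝ, EM)) 𝓘(ℝ, EM) ∞ (fun q : Y × M => (φ q.1).symm q.2))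
    (hcont : ∀ p, Continuous fun y => ψ y p) :
    ContMDiff (𝓘(ℝ, Y).prod 𝓘(ℝ, EP)) 𝓘(ℝ, EP) ∞ (fun q : Y × P => ψ q.1 q.2) := by
  rintro ⟨y₀, p₀⟩
  obtain ⟨V, hV, κ, hκ, hs, hsec⟩ := A.exists_transport_section p₀
  obtain ⟨k, hk, hkp⟩ := PrincipalBundle.exists_smooth_division hs hsec
  -- Write `p = τ p₀ · k(p)` with `τ` a horizontal flow depending smoothly on `p`. Then `ψ y p` is
  -- the conjugate of `τ` by `ψ y`, applied to the orbit point `ψ y p₀`, times `k(p)`, and all three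
  -- ingredients are smooth.
  have h0 := hirr.contMDiff_orbit hZ hψ hcov hφ hφ' (hcont p₀)
  have h1 : ContMDiffAt (𝓘(ℝ, Y).prod 𝓘(ℝ, EP)) 𝓘(ℝ, EM) ∞ (fun q : Y × P => κ (Q.proj q.2))
      (y₀, p₀) :=
    ContMDiffAt.comp (y₀, p₀) (g := fun p => κ (Q.proj p)) (f := Prod.snd)
      (ContMDiffAt.comp p₀ hκ Q.smooth_proj.contMDiffAt) contMDiffAt_snd
  have h2 : ContMDiffAt (𝓘(ℝ, Y).prod 𝓘(ℝ, EP)) (𝓘(ℝ, Y × EM).prod 𝓘(ℝ, EP)) ∞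
      (fun q : Y × P => ((q.1, κ (Q.proj q.2)), ψ q.1 p₀)) (y₀, p₀) :=
    (contMDiffAt_fst.prodMk_space h1).prodMk
      (ContMDiffAt.comp (y₀, p₀) (g := fun y => ψ y p₀) h0.contMDiffAt contMDiffAt_fst)
  have h3 := ContMDiffAt.comp (y₀, p₀)
    (contMDiff_conj_hflow hψ hcov hφ hφ' hV 1).contMDiffAt h2
  have h4 : ContMDiffAt (𝓘(ℝ, Y).prod 𝓘(ℝ, EP)) 𝓘(ℝ, EG) ∞ (fun q : Y × P => k q.2) (y₀, p₀) :=
    ContMDiffAt.comp (y₀, p₀) (g := k) hk contMDiffAt_snd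
  have h5 := ContMDiffAt.comp (y₀, p₀) (g := fun q : P × G => Q.act q.1 q.2)
    Q.smooth_act.contMDiffAt (h3.prodMk h4)
  refine h5.congr_of_eventuallyEq ?_
  have hsnd : Filter.Tendsto (Prod.snd : Y × P → P) (𝓝 (y₀, p₀)) (𝓝 p₀) := continuousAt_snd
  filter_upwards [hsnd.eventually hkp] with q hq
  simp only [Function.comp_apply, Homeomorph.symm_apply_apply]
  rw [← (hψ q.1).2.2.1, hq]

end Connection

end AutomorphismFamilies

end ContactInstanton

end

open ContactInstanton in
theorem mainTheorem10
    {M : Type*} [TopologicalSpace M] [ChartedSpace E5 M] [IsManifold (𝓡 5) ∞ M]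
    [T2Space M] [CompactSpace M] [ConnectedSpace M]
    (C : ContactMetricStructure M) (hC : C.IsKContact)
    {EG : Type*} [NormedAddCommGroup EG] [NormedSpace ℝ EG] [FiniteDimensional ℝ EG]
    {G : Type*} [TopologicalSpace G] [ChartedSpace EG G] [Group G] [LieGroup 𝓘(ℝ, EG) ∞ G]
    [T2Space G] [CompactSpace G] [ConnectedSpace G]
    (hG : IsSemisimpleLieGroup (EG := EG) G) (hZ : Subgroup.center G = ⊥)
    {EP : Type*} [NormedAddCommGroup EP] [NormedSpace ℝ EP] [FiniteDimensional ℝ EP]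
    {P : Type*} [TopologicalSpace P] [ChartedSpace EP P] [IsManifold 𝓘(ℝ, EP) ∞ P] [T2Space P]
    (Q : PrincipalBundle (EP := EP) (EM := E5) (EG := EG) P M G)
    (A : Connection Q) (hA : IsContactInstanton C A) (hirr : A.IsIrreducible) :
    ∃ ρ : C.torus →* A.aut, IsSmoothLift C A ρ := by
  have : CompactSpace P := PrincipalBundle.compactSpace Q
  obtain ⟨ρ, hcov, hcont⟩ := Connection.IsIrreducible.exists_lift_action (g := C.metric) hirr hZ
    C.smooth_reeb hA.extDerivOneForm_reeb
  refine ⟨ρ, hcov, hcont, fun k u hu => ?_⟩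
  -- Currying: joint continuity on `ℝᵏ × M` gives continuity of `u` for the compact-open topology,
  -- and the topological group structure then gives continuity of the inverses.
  have hφc : Continuous fun y => (u y).1.1 := by
    rw [continuous_induced_rng]
    exact ContinuousMap.continuous_of_continuous_uncurry _ hu.continuous
  have huc : Continuous u := continuous_induced_rng.2 (continuous_induced_rng.2 hφc)
  have hsymm : Continuous fun q : EuclideanSpace ℝ (Fin k) × M => (u q.1).1.1.symm q.2 :=
    continuous_homeo_apply.comp
      ((hφc.inv.comp continuous_fst).prodMk continuous_snd)
  exact hirr.contMDiff_family hZ (φ := fun y => (u y).1.1) (fun y => (ρ (u y)).2)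
    (fun y p => hcov (u y) p) hu
    (contMDiff_family_symm (φ := fun y => (u y).1.1) hu (fun y => (u y).1.2.2.1) hsymm)
    (fun p => hcont.comp (huc.prodMk continuous_const))
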